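/- **Setting.** Consider the planar piecewise linear Filippov system $Z$: $\dot z=f^+(z):=A^+z+b^+$ for $x>0$, $\dot z=f^-(z):=A^-z+b^-$ for $x<0$, where $z=(x,y)^\top$, with switching line $\Sigma=\{x=0\}$; $Z$ is *nondegenerate* if $\det A^+\neq0\neq\det A^-$. Write $f^\pm_1$ for the first component of $f^\pm$. Let $\Sigma^c=\{z\in\Sigma: f_1^+f_1^->0\}$ (crossing region), $\Sigma^s=\{z\in\Sigma: f_1^+f_1^-\le0\}$ (sliding region), $\Sigma^s_a=\{z\in\Sigma: f^+_1<0<f^-_1\}$ and $\Sigma^s_r=\{z\in\Sigma: f^-_1<0<f^+_1\}$ (attractive and repulsive sliding regions). The sliding field on $\Sigma^s$ is $F^s=\dfrac{f^-_1f^+-f^+_1f^-}{f^-_1-f^+_1}$ where $f_1^+\ne f_1^-$; at the remaining (singular) points of $\Sigma^s$ it is the continuous extension if there is one, and $0$ otherwise. Forward solutions are continuous concatenations of solutions of $\dot z=F^s(z)$ in $\Sigma^s$, of $\dot z=f^+(z)$ in $\{x>0\}$ and of $\dot z=f^-(z)$ in $\{x<0\}$, where the solution slides from every point from which a forward solution of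 $\dot z=F^s(z)$ inside $\Sigma^s$ starts, and otherwise moves into an open half plane along the field of that half plane. Backward solutions are the forward solutions of the time-reversed system $-Z$. A *sliding periodic orbit* is the orbit (as a set) of a nonconstant periodic forward or backward solution that stays in $\Sigma^s$ during some nontrivial time interval. A *$\Sigma$-equivalence* of two systems is a homeomorphism of $\mathbb R^2$ that maps $\Sigma$ onto $\Sigma$ and forward (backward) orbits onto forward (backward) orbits. A *visible* (*invisible*) tangency point of $f^+$ is a point of $\Sigma$ with $f^+\neq0\ne f^-$ and $f_1^+=0$ such that the local orbit of $f^+$ through it lies in $\{x\ge0\}$ ($\{x\le0\}$); for $f^-$ the half planes are exchanged. "Through the right (left) half plane" means along an orbit arc of $f^+$ ($f^-$) that lies in the open half plane except for its end points. **Theorem.** A nondegenerate system $Z$ has at most $2$ sliding periodic orbits. Moreover: (i) If $Z$ has exactly one sliding periodic orbit $\gamma$, then there are a nondegenerate system $Z'$ of the same form and a $\Sigma$-equivalence $h$ from $Z$ or from $-Z$ to $Z'$ such that $h(\gamma)$ is the only sliding periodic orbit of $Z'$ and has one of the following forms. Here $T_R=(0,y_R)$ is a visible tangency point of $f^+$ at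 which the orbit starts into the right half plane. * (a) From $T_R$ through the right half plane to $(0,y_0)$ with $y_0<y_R$, then sliding up to $T_R$; $\{0\}\times(y_0,y_R)\subset\Sigma^s_a$, and $(0,y_0)$ lies in $\Sigma^s_a$ or, as a limit case, is an invisible tangency point of $f^-$. * (b) From $T_R$ through the right half plane to $(0,y_0)\in\Sigma^c$, through the left half plane to $(0,y_1)$, then sliding up to $T_R$, where $y_0<y_1<y_R$ and $\{0\}\times[y_1,y_R)\subset\Sigma^s_a$. * (c) As (b), except that $(0,y_0)$ is a visible tangency point of $f^-$. * (d) From $T_R$ through the right half plane to $(0,y_0)$, sliding down to a visible tangency point $(0,y_L)$ of $f^-$, through the left half plane to $(0,y_1)$, sliding up to $T_R$, where $y_L<y_0<y_1<y_R$ and $\{0\}\times(y_L,y_R)\subset\Sigma_a^s$. (ii) If $Z$ has exactly two sliding periodic orbits $\gamma_1\neq\gamma_2$, then there are a nondegenerate system $Z'$ of the same form and a $\Sigma$-equivalence $h$ from $Z$ or from $-Z$ to $Z'$ such that $h(\gamma_1),h(\gamma_2)$ are the only sliding periodic orbits of $Z'$ and, in a suitable order $\psi,\varphi$, have one of the following forms.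 In each of them $\psi$ is as in (i)(a) with $(0,y_0)\in\Sigma^s_a$, and $T_L=(0,y_L)$ is a visible tangency point of $f^-$. * (a) $y_R<y_L<y_1$, $\{0\}\times(y_R,y_L)\subset\Sigma^c$, $\{0\}\times(y_L,y_1]\subset\Sigma^s_r$; $\varphi$ slides from $T_L$ up to $(0,y_1)$ and returns through the left half plane to $T_L$. * (b) $y_L<y_1<y_0<y_R$, $\{0\}\times(y_L,y_R)\subset\Sigma^s_a$; $\varphi$ goes from $T_L$ through the left half plane to $(0,y_1)$ and slides down to $T_L$. * (c) $y_L<y_2<y_0<y_R<y_1$, $\{0\}\times(y_L,y_R)\subset\Sigma^s_a$, $(0,y_1)\in\Sigma^c$; $\varphi$ goes from $T_L$ through the left half plane to $(0,y_1)$, through the right half plane to $(0,y_2)$, and slides down to $T_L$. -/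

import Mathlib

open Set Filter Topology

/-- The phase plane; a point is `z = (x, y)` with `x = z 0` and `y = z 1`. -/
abbrev Plane : Type := Fin 2 → ℝ

/-- A planar piecewise linear system with switching line `x = 0`:
`z' = Ap z + bp` for `x > 0` and `z' = Am z + bm` for `x < 0`. -/
structure PWLSystem where
  Ap : Matrix (Fin 2) (Fin 2) ℝ
  bp : Plane
  Am : Matrix (Fin 2) (Fin 2) ℝ
  bm : Plane

/-- The point `(0, y)` of the switching line. -/
def onLine (y : ℝ) : Plane := ![0, y]

/-- The switching line, i.e. the `y`-axis. -/
def switchLine : Set Plane := {z | z 0 = 0}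

namespace PWLSystem

/-- Both matrices are invertible. -/
def Nondegenerate (Z : PWLSystem) : Prop := Z.Ap.det ≠ 0 ∧ Z.Am.det ≠ 0

/-- The vector field of the right half plane. -/
def fp (Z : PWLSystem) (z : Plane) : Plane := Z.Ap.mulVec z + Z.bp

/-- The vector field of the left half plane. -/
def fm (Z : PWLSystem) (z : Plane) : Plane := Z.Am.mulVec z + Z.bm

/-- The system with time reversed. -/
def reverse (Z : PWLSystem) : PWLSystem := ⟨-Z.Ap, -Z.bp, -Z.Am, -Z.bm⟩

/-- The crossing region. -/
def crossing (Z : PWLSystem) : Set Plane := {z | z ∈ switchLine ∧ 0 < Z.fp z 0 * Z.fm z 0}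

/-- The (closed) sliding region. -/
def sliding (Z : PWLSystem) : Set Plane := {z | z ∈ switchLine ∧ Z.fp z 0 * Z.fm z 0 ≤ 0}

/-- The attractive sliding region. -/
def attractive (Z : PWLSystem) : Set Plane :=
  {z | z ∈ Z.sliding ∧ Z.fp z 0 < 0 ∧ 0 < Z.fm z 0}

/-- The repulsive sliding region. -/
def repulsive (Z : PWLSystem) : Set Plane :=
  {z | z ∈ Z.sliding ∧ 0 < Z.fp z 0 ∧ Z.fm z 0 < 0}

/-- The nonsingular sliding points. -/
def regularSliding (Z : PWLSystem) : Set Plane := {z | z ∈ Z.sliding ∧ Z.fm z 0 ≠ Z.fp z 0}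

/-- The convex combination of the two fields that is tangent to the switching line
(meaningful where the two normal components differ). -/
noncomputable def convexField (Z : PWLSystem) (z : Plane) : Plane :=
  (Z.fm z 0 - Z.fp z 0)⁻¹ • (Z.fm z 0 • Z.fp z - Z.fp z 0 • Z.fm z)

open Classical in
/-- The sliding vector field. At a singular sliding point it is the continuous extension from the
nonsingular sliding points if there is one, and `0` otherwise. -/
noncomputable def slidingField (Z : PWLSystem) (z : Plane) : Plane :=
  if Z.fm z 0 ≠ Z.fp z 0 then Z.convexField z
  else if h : ∃ L : Plane, (𝓝[Z.regularSliding] z).NeBot ∧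
      Tendsto Z.convexField (𝓝[Z.regularSliding] z) (𝓝 L) then h.choose
  else 0

/-! ### Solutions -/

/-- On the time set `I`, `w` is a sliding solution. -/
def SlidesOn (Z : PWLSystem) (w : ℝ → Plane) (I : Set ℝ) : Prop :=
  ∀ s ∈ I, w s ∈ Z.sliding ∧ HasDerivWithinAt w (Z.slidingField (w s)) I s

/-- On the open time set `I`, `w` is a solution of the right system in the right half plane. -/
def RightOn (Z : PWLSystem) (w : ℝ → Plane) (I : Set ℝ) : Prop :=
  ∀ s ∈ I, 0 < w s 0 ∧ HasDerivAt w (Z.fp (w s)) s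

/-- On the open time set `I`, `w` is a solution of the left system in the left half plane. -/
def LeftOn (Z : PWLSystem) (w : ℝ → Plane) (I : Set ℝ) : Prop :=
  ∀ s ∈ I, w s 0 < 0 ∧ HasDerivAt w (Z.fm (w s)) s

/-- A sliding solution starts at `p` (forward in time, for a short time). -/
def CanSlide (Z : PWLSystem) (p : Plane) : Prop :=
  ∃ ε > 0, ∃ w : ℝ → Plane, w 0 = p ∧ Z.SlidesOn w (Ico 0 ε)

/-- The rule that continues a solution from time `t` to time `t + ε`: it slides whenever a sliding
solution starts at the present point (on the attractive as well as on the repulsive region);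
otherwise it moves in one of the open half planes along the field of this half plane. -/
def StepsFrom (Z : PWLSystem) (z : ℝ → Plane) (t ε : ℝ) : Prop :=
  (Z.CanSlide (z t) ∧ Z.SlidesOn z (Ico t (t + ε))) ∨
  (¬ Z.CanSlide (z t) ∧ (Z.RightOn z (Ioo t (t + ε)) ∨ Z.LeftOn z (Ioo t (t + ε))))

/-- `z` is a forward solution on the time interval `[0, T]`. -/
def IsForwardSolutionOn (Z : PWLSystem) (z : ℝ → Plane) (T : ℝ) : Prop :=
  ContinuousOn z (Icc 0 T) ∧ ∀ t ∈ Ico 0 T, ∃ ε > 0, t + ε ≤ T ∧ Z.StepsFrom z t ε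

/-- The forward orbit of `p`. -/
def forwardOrbit (Z : PWLSystem) (p : Plane) : Set Plane :=
  {q | ∃ T ≥ 0, ∃ z : ℝ → Plane, Z.IsForwardSolutionOn z T ∧ z 0 = p ∧ z T = q}

/-- The backward orbit of `p`, i.e. its forward orbit under the system with time reversed. -/
def backwardOrbit (Z : PWLSystem) (p : Plane) : Set Plane := Z.reverse.forwardOrbit p

/-- `γ` is the orbit of a nonconstant periodic forward solution that has a sliding segment. -/
def IsForwardSlidingPeriodicOrbit (Z : PWLSystem) (γ : Set Plane) : Prop :=
  ∃ (z : ℝ → Plane) (T : ℝ), 0 < T ∧ Continuous z ∧ (∀ t, z (t + T) = z t) ∧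
    (∀ t, ∃ ε > 0, Z.StepsFrom z t ε) ∧ (∃ s t, z s ≠ z t) ∧
    (∃ a b, a < b ∧ ∀ t ∈ Icc a b, z t ∈ Z.sliding) ∧ γ = range z

/-- The sliding periodic orbits, as subsets of the plane: those of the forward
solutions and those of the backward solutions. -/
def slidingPeriodicOrbits (Z : PWLSystem) : Set (Set Plane) :=
  {γ | Z.IsForwardSlidingPeriodicOrbit γ ∨ Z.reverse.IsForwardSlidingPeriodicOrbit γ}

/-- `h` is an equivalence between `Z` and `Z'`: it maps the switching line onto the
switching line, and orbits onto orbits with their direction. -/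
def IsSigmaEquivalence (Z Z' : PWLSystem) (h : Plane ≃ₜ Plane) : Prop :=
  h '' switchLine = switchLine ∧
  ∀ p, h '' Z.forwardOrbit p = Z'.forwardOrbit (h p) ∧
    h '' Z.backwardOrbit p = Z'.backwardOrbit (h p)

/-! ### Tangency points and arcs -/

/-- `p` is a visible tangency point of the right system. -/
def VisibleRight (Z : PWLSystem) (p : Plane) : Prop :=
  p ∈ switchLine ∧ Z.fp p ≠ 0 ∧ Z.fm p ≠ 0 ∧ Z.fp p 0 = 0 ∧
  ∃ ε > 0, ∃ w : ℝ → Plane, w 0 = p ∧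
    ∀ s ∈ Ioo (-ε) ε, HasDerivAt w (Z.fp (w s)) s ∧ 0 ≤ w s 0

/-- `p` is a visible tangency point of the left system. -/
def VisibleLeft (Z : PWLSystem) (p : Plane) : Prop :=
  p ∈ switchLine ∧ Z.fp p ≠ 0 ∧ Z.fm p ≠ 0 ∧ Z.fm p 0 = 0 ∧
  ∃ ε > 0, ∃ w : ℝ → Plane, w 0 = p ∧
    ∀ s ∈ Ioo (-ε) ε, HasDerivAt w (Z.fm (w s)) s ∧ w s 0 ≤ 0

/-- `p` is an invisible tangency point of the left system. -/
def InvisibleLeft (Z : PWLSystem) (p : Plane) : Prop :=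
  p ∈ switchLine ∧ Z.fp p ≠ 0 ∧ Z.fm p ≠ 0 ∧ Z.fm p 0 = 0 ∧
  ∃ ε > 0, ∃ w : ℝ → Plane, w 0 = p ∧
    ∀ s ∈ Ioo (-ε) ε, HasDerivAt w (Z.fm (w s)) s ∧ 0 ≤ w s 0

/-- `C` is an orbit arc of the right system from `p` to `q`, inside the open right half plane
except for its end points. -/
def RightArc (Z : PWLSystem) (p q : Plane) (C : Set Plane) : Prop :=
  ∃ (w : ℝ → Plane) (T : ℝ), 0 < T ∧ ContinuousOn w (Icc 0 T) ∧ w 0 = p ∧ w T = q ∧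
    Z.RightOn w (Ioo 0 T) ∧ C = w '' Icc 0 T

/-- `C` is an orbit arc of the left system from `p` to `q`, inside the open left half plane
except for its end points. -/
def LeftArc (Z : PWLSystem) (p q : Plane) (C : Set Plane) : Prop :=
  ∃ (w : ℝ → Plane) (T : ℝ), 0 < T ∧ ContinuousOn w (Icc 0 T) ∧ w 0 = p ∧ w T = q ∧
    Z.LeftOn w (Ioo 0 T) ∧ C = w '' Icc 0 T

/-- `C` is a sliding arc from `p` to `q`. -/
def SlidingArc (Z : PWLSystem) (p q : Plane) (C : Set Plane) : Prop :=
  ∃ (w : ℝ → Plane) (T : ℝ), 0 < T ∧ w 0 = p ∧ w T = q ∧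
    Z.SlidesOn w (Icc 0 T) ∧ C = w '' Icc 0 T

/-! ### Configurations of one sliding periodic orbit -/

/-- From the visible tangency point `(0, yR)` of the right system through the right half
plane to `(0, y₀)` below it, then sliding up to `(0, yR)` through attractive sliding points. -/
def RightLoop (Z : PWLSystem) (yR y₀ : ℝ) (γ : Set Plane) : Prop :=
  y₀ < yR ∧ Z.VisibleRight (onLine yR) ∧ (∀ y ∈ Ioo y₀ yR, onLine y ∈ Z.attractive) ∧
  ∃ C₁ C₂, Z.RightArc (onLine yR) (onLine y₀) C₁ ∧ Z.SlidingArc (onLine y₀) (onLine yR) C₂ ∧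
    γ = C₁ ∪ C₂

/-- The orbit stays in the closed right half plane. Its landing point is an attractive sliding
point or, in the limit case, an invisible tangency point of the left system. -/
def ConfigOneA (Z : PWLSystem) (γ : Set Plane) : Prop :=
  ∃ yR y₀, (onLine y₀ ∈ Z.attractive ∨ Z.InvisibleLeft (onLine y₀)) ∧ Z.RightLoop yR y₀ γ

/-- From the visible tangency point `(0, yR)` of the right system through the right half plane to
`(0, y₀)`, on through the left half plane to `(0, y₁)` between them, and sliding up to `(0, yR)`
through attractive sliding points. -/
def BothSidesLoop (Z : PWLSystem) (yR y₀ y₁ : ℝ) (γ : Set Plane) : Prop :=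
  y₀ < y₁ ∧ y₁ < yR ∧ Z.VisibleRight (onLine yR) ∧
  (∀ y ∈ Ico y₁ yR, onLine y ∈ Z.attractive) ∧
  ∃ C₁ C₂ C₃, Z.RightArc (onLine yR) (onLine y₀) C₁ ∧ Z.LeftArc (onLine y₀) (onLine y₁) C₂ ∧
    Z.SlidingArc (onLine y₁) (onLine yR) C₃ ∧ γ = C₁ ∪ C₂ ∪ C₃

/-- One sliding segment and one crossing point. -/
def ConfigOneB (Z : PWLSystem) (γ : Set Plane) : Prop :=
  ∃ yR y₀ y₁, onLine y₀ ∈ Z.crossing ∧ Z.BothSidesLoop yR y₀ y₁ γ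

/-- One sliding segment; the orbit passes from the right to the left half plane at a visible
tangency point of the left system. -/
def ConfigOneC (Z : PWLSystem) (γ : Set Plane) : Prop :=
  ∃ yR y₀ y₁, Z.VisibleLeft (onLine y₀) ∧ Z.BothSidesLoop yR y₀ y₁ γ

/-- Two sliding segments: from the visible tangency point `(0, yR)` through the right half plane
to `(0, y₀)`, sliding down to the visible tangency point `(0, yL)` of the left system, through the
left half plane to `(0, y₁)`, sliding up to `(0, yR)`. -/
def ConfigOneD (Z : PWLSystem) (γ : Set Plane) : Prop :=
  ∃ yR yL y₀ y₁, yL < y₀ ∧ y₀ < y₁ ∧ y₁ < yR ∧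
    Z.VisibleRight (onLine yR) ∧ Z.VisibleLeft (onLine yL) ∧
    (∀ y ∈ Ioo yL yR, onLine y ∈ Z.attractive) ∧
    ∃ C₁ C₂ C₃ C₄, Z.RightArc (onLine yR) (onLine y₀) C₁ ∧
      Z.SlidingArc (onLine y₀) (onLine yL) C₂ ∧ Z.LeftArc (onLine yL) (onLine y₁) C₃ ∧
      Z.SlidingArc (onLine y₁) (onLine yR) C₄ ∧ γ = C₁ ∪ C₂ ∪ C₃ ∪ C₄

/-- The four configurations of one sliding periodic orbit. -/
def ConfigOne (Z : PWLSystem) (γ : Set Plane) : Prop :=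
  Z.ConfigOneA γ ∨ Z.ConfigOneB γ ∨ Z.ConfigOneC γ ∨ Z.ConfigOneD γ

/-! ### Configurations of two sliding periodic orbits -/

/-- A loop in the closed right half plane on the attractive sliding region and, higher up and
separated from it by crossing points, a loop `φ` in the closed left half plane on the repulsive
sliding region: `φ` slides up from `(0, yL)` to `(0, y₁)`, where it enters the left half plane, and
it returns to the visible tangency point `(0, yL)` of the left system. -/
def ConfigTwoA (Z : PWLSystem) (ψ φ : Set Plane) : Prop :=
  ∃ yR y₀ yL y₁, yR < yL ∧ yL < y₁ ∧ onLine y₀ ∈ Z.attractive ∧ Z.RightLoop yR y₀ ψ ∧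
    (∀ y ∈ Ioo yR yL, onLine y ∈ Z.crossing) ∧
    Z.VisibleLeft (onLine yL) ∧ (∀ y ∈ Ioc yL y₁, onLine y ∈ Z.repulsive) ∧
    ∃ C₁ C₂, Z.SlidingArc (onLine yL) (onLine y₁) C₁ ∧ Z.LeftArc (onLine y₁) (onLine yL) C₂ ∧
      φ = C₁ ∪ C₂

/-- Two loops on one attractive sliding segment, whose end points are the visible tangency points
`(0, yL)` and `(0, yR)`: one loop in the closed right half plane that slides up to `(0, yR)`, and
one in the closed left half plane that slides down to `(0, yL)`. -/
def ConfigTwoB (Z : PWLSystem) (ψ φ : Set Plane) : Prop :=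
  ∃ yR y₀ yL y₁, yL < y₁ ∧ y₁ < y₀ ∧ (∀ y ∈ Ioo yL yR, onLine y ∈ Z.attractive) ∧
    Z.RightLoop yR y₀ ψ ∧ Z.VisibleLeft (onLine yL) ∧
    ∃ C₁ C₂, Z.LeftArc (onLine yL) (onLine y₁) C₁ ∧ Z.SlidingArc (onLine y₁) (onLine yL) C₂ ∧
      φ = C₁ ∪ C₂

/-- Two loops on one attractive sliding segment, whose end points are the visible tangency points
`(0, yL)` and `(0, yR)`: one in the closed right half plane that slides up to `(0, yR)`, and around
it one that leaves `(0, yL)` through the left half plane, crosses at `(0, y₁)` above `(0, yR)`,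
returns through the right half plane to `(0, y₂)` and slides down to `(0, yL)`. -/
def ConfigTwoC (Z : PWLSystem) (ψ φ : Set Plane) : Prop :=
  ∃ yR y₀ yL y₁ y₂, yL < y₂ ∧ y₂ < y₀ ∧ yR < y₁ ∧
    (∀ y ∈ Ioo yL yR, onLine y ∈ Z.attractive) ∧ Z.RightLoop yR y₀ ψ ∧
    Z.VisibleLeft (onLine yL) ∧ onLine y₁ ∈ Z.crossing ∧
    ∃ C₁ C₂ C₃, Z.LeftArc (onLine yL) (onLine y₁) C₁ ∧ Z.RightArc (onLine y₁) (onLine y₂) C₂ ∧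
      Z.SlidingArc (onLine y₂) (onLine yL) C₃ ∧ φ = C₁ ∪ C₂ ∪ C₃

/-- The three configurations of two sliding periodic orbits. -/
def ConfigTwo (Z : PWLSystem) (ψ φ : Set Plane) : Prop :=
  Z.ConfigTwoA ψ φ ∨ Z.ConfigTwoB ψ φ ∨ Z.ConfigTwoC ψ φ

end PWLSystem

/-! A periodic orbit that slides must also leave the sliding region, since a curve that always
slides solves a scalar autonomous equation and is constant if periodic. It can leave only at a
sliding point where no sliding solution starts. The normal components of both fields are affine in
`y` on the switching line. If they have a common zero, or are both constant, sliding is possible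
from every sliding point and there are no such orbits (`canSlide_of_singular`,
`canSlide_of_parallel`). Otherwise rotation by π, reflection in the x-axis and time reversal lead to
a right tangency point `yR` with positive slope `Z.Ap 0 1`, at which the left field points to the
right. The slope of the left normal component then decides between `AttractiveBand`, a compact
sliding segment between two tangency points, and `AttractiveRay`, a half line of attractive sliding.

Three facts carry the analysis. Forward solutions are unique (`IsFlow.eq_of_eq`): where the two half
planes would compete, sliding is possible and takes precedence. Hence orbits that meet coincide, and
a closed piece of an orbit is the whole orbit. Half plane arcs are nested (`RightArc.nested`): `x`
solves a linear second order equation, and a greater initial velocity gives a smaller or equal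
return velocity (`ReturnSol.velocity_antitone`), whatever the type of the eigenvalues. Sliding
solutions cannot traverse the same interval in both directions, and starting points of descent lie
below those of ascent (`RightSol.not_up_down`, `RightSol.lt_of_down_of_up`).

On a band, a forward orbit leaves at `yR` or, after rotation, at `yL`. Following it and using
nestedness to exclude outward spirals gives the shapes in `RightClass`. Each shape contains its exit
point, so there are at most two orbits. If there are two, neither contains both end points, which
leaves the configurations (b) and (c) of two orbits. A backward orbit on a band must hit both end
points exactly; it is then the only sliding periodic orbit, and gives the limit case of
configuration (a).

On a ray, an orbit once at or below `yR` never meets the line above it again, so every forward orbit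
is a loop from `yR`. Reversal and rotation turn a repulsive ray above into another attractive ray.
Thus there is at most one orbit in each direction, and the two together give configuration (a) of
two orbits. -/

/-! ### Real analysis on the line -/

/-- A continuous function with a continuous right derivative is differentiable. -/
lemma hasDerivWithinAt_Icc_of_right {E : Type*} [NormedAddCommGroup E] [NormedSpace ℝ E]
    [CompleteSpace E] {f φ : ℝ → E} {a b : ℝ} (hf : ContinuousOn f (Icc a b))
    (hφ : ContinuousOn φ (Icc a b))
    (h : ∀ s ∈ Ico a b, HasDerivWithinAt f (φ s) (Ici s) s) :
    ∀ s ∈ Icc a b, HasDerivWithinAt f (φ s) (Icc a b) s := by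
  intro s hs
  have hab : a ≤ b := hs.1.trans hs.2
  -- Extending `φ` constantly beyond the interval gives a primitive that is differentiable on the
  -- whole line. Its difference from `f` has zero right derivative.
  have hc : Continuous (IccExtend hab ((Icc a b).domRestrict φ)) :=
    (continuousOn_iff_continuous_domRestrict.1 hφ).Icc_extend'
  have hF : ∀ x, HasDerivAt (fun x => ∫ t in a..x, IccExtend hab ((Icc a b).domRestrict φ) t)
      (IccExtend hab ((Icc a b).domRestrict φ) x) x := fun x =>
    intervalIntegral.integral_hasDerivAt_right (hc.intervalIntegrable _ _)
      (hc.stronglyMeasurableAtFilter _ _) hc.continuousAt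
  have hφ' : ∀ x ∈ Icc a b, IccExtend hab ((Icc a b).domRestrict φ) x = φ x := fun x hx => by
    rw [IccExtend_of_mem hab _ hx]; rfl
  have hconst := constant_of_has_deriv_right_zero
    (f := fun x => f x - ∫ t in a..x, IccExtend hab ((Icc a b).domRestrict φ) t) (a := a) (b := b)
    (hf.sub fun x _ => (hF x).continuousAt.continuousWithinAt)
    (fun x hx => by
      have := (h x hx).sub (hF x).hasDerivWithinAt
      rwa [hφ' x ⟨hx.1, hx.2.le⟩, sub_self] at this)
  have h1 : HasDerivWithinAt (fun x => f a + ∫ t in a..x,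
      IccExtend hab ((Icc a b).domRestrict φ) t) (φ s) (Icc a b) s := by
    have := ((hF s).hasDerivWithinAt (s := Icc a b)).const_add (f a)
    rwa [hφ' s hs] at this
  have he : ∀ x ∈ Icc a b, f x = f a + ∫ t in a..x,
      IccExtend hab ((Icc a b).domRestrict φ) t := fun x hx => by
    have := hconst x hx
    simp only [intervalIntegral.integral_same, sub_zero] at this
    rw [← this]; abel
  exact h1.congr he (he s hs)

/-- `y` solves the scalar equation `y' = g y` on `[a, b]`, with right derivatives. -/
def RightSol (g y : ℝ → ℝ) (a b : ℝ) : Prop :=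
  ContinuousOn y (Icc a b) ∧ ∀ t ∈ Ico a b, HasDerivWithinAt y (g (y t)) (Ici t) t

lemma RightSol.mono {g y : ℝ → ℝ} {a b c d : ℝ} (h : RightSol g y a b) (hc : a ≤ c) (hd : d ≤ b) :
    RightSol g y c d :=
  ⟨h.1.mono (Icc_subset_Icc hc hd), fun t ht => h.2 t ⟨hc.trans ht.1, ht.2.trans_le hd⟩⟩

lemma RightSol.neg {g y : ℝ → ℝ} {a b : ℝ} (h : RightSol g y a b) :
    RightSol (fun v => -g (-v)) (fun t => -y t) a b :=
  ⟨h.1.neg, fun t ht => by simpa only [neg_neg] using (h.2 t ht).fun_neg⟩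

lemma HasDerivWithinAt.exists_lt_right {y : ℝ → ℝ} {d t b : ℝ}
    (h : HasDerivWithinAt y d (Ici t) t) (hd : d < 0) (hb : t < b) :
    ∃ s ∈ Ioo t b, y s < y t := by
  have h1 := (hasDerivWithinAt_iff_tendsto_slope' (by simp)).1 (h.Ioi_of_Ici)
  have h2 := (h1.eventually_lt_const hd).and (Ioo_mem_nhdsGT hb)
  obtain ⟨s, hs1, hs2⟩ := h2.exists
  refine ⟨s, hs2, ?_⟩
  rw [slope_def_field, div_neg_iff] at hs1
  rcases hs1 with h | h
  · linarith [hs2.1, h.2]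
  · linarith

/-- By compactness there is a last time at or below the level. Staying strictly above afterwards is
what makes one-sided derivative arguments work without any regularity of the field. -/
lemma last_time {y : ℝ → ℝ} {a b c : ℝ} (hab : a ≤ b) (hy : ContinuousOn y (Icc a b))
    (ha : y a ≤ c) (hb : c < y b) :
    ∃ t ∈ Ico a b, y t = c ∧ ∀ s ∈ Ioc t b, c < y s := by
  let S := Icc a b ∩ y ⁻¹' Iic c
  have hS : IsCompact S := (hy.preimage_isClosed_of_isClosed isClosed_Icc isClosed_Iic
    |> fun h => isCompact_Icc.of_isClosed_subset h inter_subset_left)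
  obtain ⟨t, htS, hmax⟩ := hS.exists_isGreatest ⟨a, ⟨le_rfl, hab⟩, ha⟩
  have htb : t ≠ b := by rintro rfl; exact absurd htS.2 (not_le.2 hb)
  have htb' : t < b := lt_of_le_of_ne htS.1.2 htb
  have hgt : ∀ s ∈ Ioc t b, c < y s := fun s hs => by
    by_contra hcon
    exact absurd (hmax ⟨⟨htS.1.1.trans hs.1.le, hs.2⟩, not_lt.1 hcon⟩) (not_le.2 hs.1)
  refine ⟨t, ⟨htS.1.1, htb'⟩, le_antisymm htS.2 ?_, hgt⟩
  have hcw : ContinuousWithinAt y (Ioc t b) t :=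
    (hy t htS.1).mono fun s hs => ⟨htS.1.1.trans hs.1.le, hs.2⟩
  have : (𝓝[Ioc t b] t).NeBot := by
    rw [nhdsWithin_Ioc_eq_nhdsGT htb']; infer_instance
  exact ge_of_tendsto hcw (eventually_mem_nhdsWithin.mono fun s hs => (hgt s hs).le)

lemma first_time {y : ℝ → ℝ} {a b c : ℝ} (hab : a ≤ b) (hy : ContinuousOn y (Icc a b))
    (ha : y a < c) (hb : c ≤ y b) :
    ∃ t ∈ Ioc a b, y t = c ∧ ∀ s ∈ Ico a t, y s < c := by
  obtain ⟨t, ht, h1, h2⟩ := last_time (y := fun s => -y (-s)) (a := -b) (b := -a) (c := -c)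
    (by linarith) ((hy.comp continuousOn_neg fun s hs => ⟨by linarith [hs.2], by linarith [hs.1]⟩).neg)
    (by simpa using hb) (by simpa using ha)
  refine ⟨-t, ⟨by linarith [ht.2], by linarith [ht.1]⟩, by linarith, fun s hs => ?_⟩
  have := h2 (-s) ⟨by linarith [hs.2], by linarith [hs.1]⟩
  simp only [neg_neg] at this; linarith

/-- At the last passage of `c` a negative right derivative would push the solution below `c` again.
-/
lemma RightSol.nonneg_of_up {g y : ℝ → ℝ} {a b c : ℝ} (h : RightSol g y a b) (hab : a ≤ b)
    (ha : y a ≤ c) (hb : c < y b) : 0 ≤ g c := by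
  obtain ⟨t, ht, rfl, h2⟩ := last_time hab h.1 ha hb
  by_contra hneg
  obtain ⟨s, hs, hlt⟩ := (h.2 t ht).exists_lt_right (not_le.1 hneg) ht.2
  exact absurd (h2 s ⟨hs.1, hs.2.le⟩) (not_lt.2 hlt.le)

lemma RightSol.nonpos_of_down {g y : ℝ → ℝ} {a b c : ℝ} (h : RightSol g y a b) (hab : a ≤ b)
    (ha : c ≤ y a) (hb : y b < c) : g c ≤ 0 := by
  have := h.neg.nonneg_of_up hab (c := -c) (by simpa using ha) (by simpa using hb)
  simpa using this

/-- Between the last passage of one interior level and the next passage of a higher one, the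
solution runs entirely through zeros of `g`. Its right derivative vanishes there, so it cannot have
moved. -/
lemma RightSol.not_zero_between {g y : ℝ → ℝ} {a b p q : ℝ} (h : RightSol g y a b) (hab : a ≤ b)
    (hpq : p < q) (ha : y a ≤ p) (hb : q ≤ y b) (hg : ∀ c ∈ Ioo p q, g c = 0) : False := by
  obtain ⟨p', hp, hp'⟩ := exists_between hpq
  obtain ⟨q', hq, hq'⟩ := exists_between hp'
  obtain ⟨t, ht, h1, h2⟩ := last_time (c := p') hab h.1 (by linarith) (by linarith)
  obtain ⟨r, hr, h3, h4⟩ := first_time (c := q') ht.2.le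
    (h.1.mono (Icc_subset_Icc ht.1 le_rfl)) (by linarith) (by linarith)
  have := constant_of_has_deriv_right_zero (h.1.mono (Icc_subset_Icc ht.1 hr.2))
    (fun s hs => by
      have hd := h.2 s ⟨ht.1.trans hs.1, hs.2.trans_le hr.2⟩
      rwa [hg (y s) ?_] at hd
      refine ⟨?_, (h4 s hs).trans hq'⟩
      rcases hs.1.eq_or_lt with rfl | hlt
      · linarith
      · linarith [h2 s ⟨hlt, hs.2.le.trans hr.2⟩]) r ⟨hr.1.le, le_rfl⟩
  linarith

/-- A scalar autonomous equation has no solutions in both directions between two points. -/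
lemma RightSol.not_up_down {g y z : ℝ → ℝ} {a b c d p q : ℝ} (hy : RightSol g y a b) (hab : a ≤ b)
    (hz : RightSol g z c d) (hcd : c ≤ d) (hpq : p < q) (ha : y a ≤ p) (hb : q ≤ y b)
    (hc : q ≤ z c) (hd : z d ≤ p) : False :=
  hy.not_zero_between hab hpq ha hb fun _ hv => le_antisymm
    (hz.nonpos_of_down hcd (hv.2.le.trans hc) (hd.trans_lt hv.1))
    (hy.nonneg_of_up hab (ha.trans hv.1.le) (hv.2.trans_le hb))

lemma exists_add_nat_mul_gt {T : ℝ} (hT : 0 < T) (s t : ℝ) : ∃ n : ℕ, s < t + n * T := by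
  obtain ⟨n, hn⟩ := exists_nat_gt ((s - t) / T)
  exact ⟨n, by rw [div_lt_iff₀ hT] at hn; linarith⟩

/-- Periodic solutions of a scalar autonomous equation are constant. -/
lemma RightSol.periodic_const {g y : ℝ → ℝ} {T : ℝ} (hT : 0 < T) (hp : Function.Periodic y T)
    (h : ∀ a b, RightSol g y a b) (s t : ℝ) : y s = y t := by
  by_contra hne
  wlog hlt : y s < y t generalizing s t
  · exact this t s (Ne.symm hne) (lt_of_le_of_ne (not_lt.1 hlt) (Ne.symm hne))
  obtain ⟨n, hn⟩ := exists_add_nat_mul_gt hT s t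
  obtain ⟨m, hm⟩ := exists_add_nat_mul_gt hT (t + n * T) s
  have h1 : y (t + n * T) = y t := hp.nat_mul n t
  have h2 : y (s + m * T) = y s := hp.nat_mul m s
  exact (h s (t + n * T)).not_up_down hn.le (h (t + n * T) (s + m * T)) hm.le hlt le_rfl h1.ge
    h1.ge h2.le

/-- A closed condition that always recurs, with `z` in `C` in between, keeps `z` in `C`. -/
lemma forall_mem_of_recurrence {X : Type*} {z : ℝ → X} {C : Set X} {P : Set ℝ} (hP : IsClosed P)
    (step : ∀ t ∈ P, ∃ t' > t, t' ∈ P ∧ ∀ s ∈ Icc t t', z s ∈ C) {t₀ : ℝ} (h0 : t₀ ∈ P) :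
    ∀ s ≥ t₀, z s ∈ C := by
  intro s hs
  by_contra hns
  -- Closedness of `P` rules out accumulation of the recurrence times before `s`: the last of them
  -- exists, and the step from it must reach beyond `s`.
  have hK : IsCompact (P ∩ Icc t₀ s) := isCompact_Icc.inter_left hP
  obtain ⟨t, ht, hmax⟩ := hK.exists_isGreatest ⟨t₀, h0, le_rfl, hs⟩
  obtain ⟨t', htt', hP', hC⟩ := step t ht.1
  rcases le_or_gt t' s with h | h
  · exact absurd (hmax ⟨hP', ht.2.1.trans htt'.le, h⟩) (not_le.2 htt')
  · exact hns (hC s ⟨ht.2.2, h.le⟩)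

/-- At the left end the derivative is the limit of the interior derivatives; the right end then
follows from right derivatives alone. -/
lemma hasDerivWithinAt_Icc_of_Ioo {E : Type*} [NormedAddCommGroup E] [NormedSpace ℝ E]
    [CompleteSpace E] {f φ : ℝ → E} {a b : ℝ} (hf : ContinuousOn f (Icc a b))
    (hφ : ContinuousOn φ (Icc a b)) (h : ∀ s ∈ Ioo a b, HasDerivAt f (φ s) s) :
    ∀ s ∈ Icc a b, HasDerivWithinAt f (φ s) (Icc a b) s := by
  refine hasDerivWithinAt_Icc_of_right hf hφ fun s hs => ?_
  rcases hs.1.eq_or_lt with rfl | hlt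
  · refine hasDerivWithinAt_Ici_of_tendsto_deriv (s := Ioo a b)
      (fun t ht => (h t ht).differentiableAt.differentiableWithinAt)
      ((hf a ⟨le_rfl, hs.2.le⟩).mono Ioo_subset_Icc_self) (Ioo_mem_nhdsGT hs.2) ?_
    have h1 : Tendsto φ (𝓝[>] a) (𝓝 (φ a)) := by
      rw [← nhdsWithin_Ioo_eq_nhdsGT hs.2]
      exact (hφ a ⟨le_rfl, hs.2.le⟩).mono Ioo_subset_Icc_self
    exact h1.congr' (by
      filter_upwards [Ioo_mem_nhdsGT hs.2] with t ht using (h t ht).deriv.symm)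
  · exact (h s ⟨hlt, hs.2⟩).hasDerivWithinAt

lemma HasDerivWithinAt.Ici_of_Icc {E : Type*} [NormedAddCommGroup E] [NormedSpace ℝ E]
    {f : ℝ → E} {f' : E} {a b s : ℝ} (h : HasDerivWithinAt f f' (Icc a b) s) (hs : s ∈ Ico a b) :
    HasDerivWithinAt f f' (Ici s) s :=
  h.mono_of_mem_nhdsWithin (mem_of_superset (Icc_mem_nhdsGE hs.2) (Icc_subset_Icc hs.1 le_rfl))

/-! ### Second order scalar equations -/

/-- The fundamental solutions of `y'' = δ y`. -/
structure FundPair (δ : ℝ) (C S : ℝ → ℝ) : Prop where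
  derivC : ∀ t, HasDerivAt C (δ * S t) t
  derivS : ∀ t, HasDerivAt S (C t) t
  C0 : C 0 = 1
  S0 : S 0 = 0
  pyth : ∀ t, C t ^ 2 - δ * S t ^ 2 = 1

/-- The pairs are trigonometric, affine or hyperbolic. The final disjunction records all that is
needed later of the type of the eigenvalues: `S` either stays positive or is a sine of known
frequency. -/
lemma exists_fundPair (δ : ℝ) : ∃ C S, FundPair δ C S ∧ ((∀ t > 0, 0 < S t) ∨
    ∃ ω > 0, δ = -ω ^ 2 ∧ C = (fun t => Real.cos (ω * t)) ∧ S = fun t => Real.sin (ω * t) / ω) := by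
  rcases lt_trichotomy δ 0 with h | rfl | h
  · have hω : 0 < √(-δ) := Real.sqrt_pos.2 (by linarith)
    have hsq : √(-δ) ^ 2 = -δ := Real.sq_sqrt (by linarith)
    set ω := √(-δ)
    have hl : ∀ t, HasDerivAt (fun t => ω * t) ω t := fun t => by
      simpa using (hasDerivAt_id t).const_mul ω
    refine ⟨_, _, ⟨fun t => ?_, fun t => ?_, by simp, by simp, fun t => ?_⟩,
      Or.inr ⟨ω, hω, by linarith, rfl, rfl⟩⟩
    · convert (hl t).cos using 1
      rw [show δ = -ω ^ 2 by linarith]; field_simp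
    · exact ((hl t).sin.div_const ω).congr_deriv (mul_div_cancel_right₀ _ hω.ne')
    · rw [show δ = -ω ^ 2 by linarith]; field_simp
      linarith [Real.cos_sq_add_sin_sq (ω * t)]
  · refine ⟨fun _ => 1, fun t => t, ⟨fun t => ?_, fun t => hasDerivAt_id t, rfl, rfl, by simp⟩,
      Or.inl fun t ht => ht⟩
    simpa using hasDerivAt_const t (1 : ℝ)
  · have hω : 0 < √δ := Real.sqrt_pos.2 h
    have hsq : √δ ^ 2 = δ := Real.sq_sqrt h.le
    set ω := √δ
    have hl : ∀ t, HasDerivAt (fun t => ω * t) ω t := fun t => by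
      simpa using (hasDerivAt_id t).const_mul ω
    refine ⟨fun t => Real.cosh (ω * t), fun t => Real.sinh (ω * t) / ω,
      ⟨fun t => ?_, fun t => ?_, by simp, by simp, fun t => ?_⟩, Or.inl fun t ht => ?_⟩
    · convert (hl t).cosh using 1
      rw [← hsq]; field_simp
    · exact ((hl t).sinh.div_const ω).congr_deriv (mul_div_cancel_right₀ _ hω.ne')
    · rw [← hsq]; field_simp
      linarith [Real.cosh_sq (ω * t)]
    · exact div_pos (Real.sinh_pos_iff.2 (by positivity)) hω

/-- A solution of `x' = u`, `u' = τ u - d x + c` on `[0, T]` that starts with `x = 0`. -/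
structure ScalarSol (τ d c : ℝ) (x u : ℝ → ℝ) (T : ℝ) : Prop where
  pos : 0 < T
  cx : ContinuousOn x (Icc 0 T)
  cu : ContinuousOn u (Icc 0 T)
  hx : ∀ t ∈ Ioo 0 T, HasDerivAt x (u t) t
  hu : ∀ t ∈ Ioo 0 T, HasDerivAt u (τ * u t - d * x t + c) t
  x0 : x 0 = 0

/-- The solution `x` with `x(0) = x'(0) = 0` for the unit forcing. -/
noncomputable def forced (τ d : ℝ) (C S : ℝ → ℝ) (t : ℝ) : ℝ :=
  (1 - Real.exp (τ / 2 * t) * (C t - τ / 2 * S t)) / d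

/-- Shifting by the equilibrium `c / d` and removing the factor `exp (τ / 2 * t)` turns the equation
into `ξ'' = δ ξ` with `δ = (τ / 2) ^ 2 - d`. Then `ξ C - η S` and `η C - δ ξ S` are first integrals,
and the identity `pyth` lets one solve them for `ξ` and `η`. -/
lemma ScalarSol.formula {τ d c T : ℝ} {x u C S : ℝ → ℝ} (h : ScalarSol τ d c x u T) (hd : d ≠ 0)
    (hCS : FundPair ((τ / 2) ^ 2 - d) C S) : ∀ t ∈ Icc 0 T,
    x t = u 0 * (Real.exp (τ / 2 * t) * S t) + c * forced τ d C S t ∧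
    u t = u 0 * (Real.exp (τ / 2 * t) * (C t + τ / 2 * S t)) +
      c * (Real.exp (τ / 2 * t) * S t) := by
  set s := τ / 2 with hs
  set e := c / d with he
  have hde : d * e = c := by rw [he]; field_simp
  have hτ : τ = 2 * s := by rw [hs]; ring
  have hexp : ∀ t, HasDerivAt (fun t => Real.exp (-(s * t))) (-s * Real.exp (-(s * t))) t :=
    fun t => by
      have := ((hasDerivAt_id t).const_mul s).neg.exp
      simp only [id, mul_one] at this
      rw [mul_comm]; exact this
  let ξ : ℝ → ℝ := fun t => Real.exp (-(s * t)) * (x t - e)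
  let η : ℝ → ℝ := fun t => Real.exp (-(s * t)) * (u t - s * (x t - e))
  have hec : Continuous fun t => Real.exp (-(s * t)) := by fun_prop
  have cC : Continuous C := continuous_iff_continuousAt.2 fun t => (hCS.derivC t).continuousAt
  have cS : Continuous S := continuous_iff_continuousAt.2 fun t => (hCS.derivS t).continuousAt
  have cξ : ContinuousOn ξ (Icc 0 T) := hec.continuousOn.mul (h.cx.sub continuousOn_const)
  have cη : ContinuousOn η (Icc 0 T) := hec.continuousOn.mul
    (h.cu.sub (continuousOn_const.mul (h.cx.sub continuousOn_const)))
  have dξ : ∀ t ∈ Ioo 0 T, HasDerivAt ξ (η t) t := fun t ht => by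
    refine ((hexp t).mul ((h.hx t ht).sub_const e)).congr_deriv ?_
    simp only [η]; ring
  have dη : ∀ t ∈ Ioo 0 T, HasDerivAt η ((s ^ 2 - d) * ξ t) t := fun t ht => by
    refine ((hexp t).mul ((h.hu t ht).sub (((h.hx t ht).sub_const e).const_mul s))).congr_deriv ?_
    simp only [ξ, Pi.sub_apply]; rw [← hde, hτ]; ring
  have key : ∀ f : ℝ → ℝ, ContinuousOn f (Icc 0 T) → (∀ t ∈ Ioo 0 T, HasDerivAt f 0 t) →
      ∀ t ∈ Icc 0 T, f t = f 0 := fun f hf hf' =>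
    constant_of_has_deriv_right_zero hf fun t ht =>
      (hasDerivWithinAt_Icc_of_Ioo (φ := fun _ => 0) hf continuousOn_const hf' t
        ⟨ht.1, ht.2.le⟩).Ici_of_Icc ht
  intro t ht
  have ha := key (fun t => ξ t * C t - η t * S t)
    ((cξ.mul cC.continuousOn).sub (cη.mul cS.continuousOn)) (fun t ht =>
      (((dξ t ht).mul (hCS.derivC t)).sub ((dη t ht).mul (hCS.derivS t))).congr_deriv (by ring)) t ht
  have hb := key (fun t => η t * C t - (s ^ 2 - d) * (ξ t * S t))
    ((cη.mul cC.continuousOn).sub (continuousOn_const.mul (cξ.mul cS.continuousOn))) (fun t ht =>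
      (((dη t ht).mul (hCS.derivC t)).sub
        (((dξ t ht).mul (hCS.derivS t)).const_mul _)).congr_deriv (by ring)) t ht
  simp only [hCS.C0, hCS.S0, mul_one, mul_zero, sub_zero] at ha hb
  have hξ0 : ξ 0 = -e := by simp [ξ, h.x0]
  have hη0 : η 0 = u 0 + s * e := by simp [η, h.x0]
  rw [hξ0] at ha; rw [hη0] at hb
  have hp := hCS.pyth t
  have hξt : ξ t = -e * C t + (u 0 + s * e) * S t := by
    linear_combination ξ t * (-hp) + C t * ha + S t * hb
  have hηt : η t = (u 0 + s * e) * C t + (s ^ 2 - d) * (-e) * S t := by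
    linear_combination η t * (-hp) + C t * hb + (s ^ 2 - d) * S t * ha
  have hE : Real.exp (s * t) * Real.exp (-(s * t)) = 1 := by rw [← Real.exp_add]; simp
  have hx : x t = e + Real.exp (s * t) * ξ t := by
    simp only [ξ]; linear_combination (-(x t - e)) * hE
  have hu : u t = s * (x t - e) + Real.exp (s * t) * η t := by
    simp only [η]; linear_combination (-(u t - s * (x t - e))) * hE
  have hx' : x t = u 0 * (Real.exp (s * t) * S t) + c * forced τ d C S t := by
    rw [hx, hξt]; simp only [forced, ← hs, he]; field_simp; ring
  refine ⟨hx', ?_⟩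
  rw [hu, hx, hξt, hηt, ← hde]; ring

/-- The derivative of the forced solution is the impulse response `exp (τ / 2 * t) * S t`, which is
positive as long as `S` is. -/
lemma forced_pos {τ d r : ℝ} {C S : ℝ → ℝ} (hd : d ≠ 0) (hCS : FundPair ((τ / 2) ^ 2 - d) C S)
    (hr : 0 < r) (hS : ∀ t ∈ Ioo 0 r, 0 < S t) : 0 < forced τ d C S r := by
  have hexp : ∀ t, HasDerivAt (fun t => Real.exp (τ / 2 * t)) (Real.exp (τ / 2 * t) * (τ / 2)) t :=
    fun t => by simpa using ((hasDerivAt_id t).const_mul (τ / 2)).exp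
  have hder : ∀ t, HasDerivAt (forced τ d C S) (Real.exp (τ / 2 * t) * S t) t := fun t => by
    refine ((((hexp t).mul ((hCS.derivC t).sub ((hCS.derivS t).const_mul (τ / 2)))).const_sub
      1).div_const d).congr_deriv ?_
    simp only [Pi.sub_apply]; field_simp; ring
  have hm : StrictMonoOn (forced τ d C S) (Icc 0 r) := by
    refine strictMonoOn_of_deriv_pos (convex_Icc 0 r)
      (fun t _ => (hder t).continuousAt.continuousWithinAt) fun t ht => ?_
    rw [interior_Icc] at ht
    rw [(hder t).deriv]
    exact mul_pos (Real.exp_pos _) (hS t ht)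
  have h0 : forced τ d C S 0 = 0 := by simp [forced, hCS.C0, hCS.S0]
  simpa [h0] using hm ⟨le_rfl, hr.le⟩ ⟨hr.le, le_rfl⟩ hr

/-! ### Excursions that return to the switching line -/

/-- A solution that is positive between two zeros. -/
structure ReturnSol (τ d c : ℝ) (x u : ℝ → ℝ) (T : ℝ) : Prop extends ScalarSol τ d c x u T where
  xT : x T = 0
  xpos : ∀ t ∈ Ioo 0 T, 0 < x t

/-- Reversal exchanges the start and return velocities up to sign and changes only the sign of `τ`.
The constant `δ`, which depends on `τ ^ 2`, is unaffected. -/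
lemma ReturnSol.reverse {τ d c T : ℝ} {x u : ℝ → ℝ} (h : ReturnSol τ d c x u T) :
    ReturnSol (-τ) d c (fun t => x (T - t)) (fun t => -u (T - t)) T where
  pos := h.pos
  cx := h.cx.comp (by fun_prop) fun t ht => ⟨by linarith [ht.2], by linarith [ht.1]⟩
  cu := (h.cu.comp (f := fun t => T - t) (by fun_prop)
    fun t ht => ⟨by linarith [ht.2], by linarith [ht.1]⟩).neg
  hx t ht := by
    have := (h.hx (T - t) ⟨by linarith [ht.2], by linarith [ht.1]⟩).comp_const_sub T t
    simpa using this
  hu t ht := by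
    have := ((h.hu (T - t) ⟨by linarith [ht.2], by linarith [ht.1]⟩).comp_const_sub T t).neg
    refine this.congr_deriv ?_
    ring
  x0 := by simp [h.xT]
  xT := by simp [h.x0]
  xpos t ht := h.xpos _ ⟨by linarith [ht.2], by linarith [ht.1]⟩

lemma ScalarSol.u0_nonneg {τ d c T : ℝ} {x u : ℝ → ℝ} (h : ScalarSol τ d c x u T)
    (hpos : ∀ t ∈ Ioo 0 T, 0 < x t) : 0 ≤ u 0 := by
  by_contra hneg
  obtain ⟨t, ht, hlt⟩ := ((hasDerivWithinAt_Icc_of_Ioo h.cx h.cu h.hx 0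
    ⟨le_rfl, h.pos.le⟩).Ici_of_Icc ⟨le_rfl, h.pos⟩).exists_lt_right (not_le.1 hneg) h.pos
  rw [h.x0] at hlt
  exact absurd (hpos t ht) (not_lt.2 hlt.le)

lemma ReturnSol.u_end_nonpos {τ d c T : ℝ} {x u : ℝ → ℝ} (h : ReturnSol τ d c x u T) : u T ≤ 0 := by
  have := h.reverse.u0_nonneg h.reverse.xpos
  simpa using this

lemma FundPair.sin_pos {ω r : ℝ} (hω : 0 < ω) (hr : r ≤ Real.pi / ω) :
    ∀ t ∈ Ioo 0 r, 0 < Real.sin (ω * t) / ω := fun t ht => by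
  refine div_pos (Real.sin_pos_of_pos_of_lt_pi (mul_pos hω ht.1) ?_) hω
  have := ht.2.trans_le hr
  rw [lt_div_iff₀ hω] at this; linarith

/-- A solution with a tangential start enters `x > 0` only if the forcing is positive. -/
lemma ScalarSol.forcing_pos {τ d c T : ℝ} {x u : ℝ → ℝ} (h : ScalarSol τ d c x u T) (hd : d ≠ 0)
    (hpos : ∀ t ∈ Ioo 0 T, 0 < x t) (hu0 : u 0 = 0) : 0 < c := by
  obtain ⟨C, S, hCS, hS⟩ := exists_fundPair ((τ / 2) ^ 2 - d)
  obtain ⟨r, hr, hrT, hS'⟩ : ∃ r > 0, r < T ∧ ∀ t ∈ Ioo 0 r, 0 < S t := by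
    rcases hS with hS | ⟨ω, hω, -, -, rfl⟩
    · exact ⟨T / 2, by linarith [h.pos], by linarith [h.pos], fun t ht => hS t ht.1⟩
    · have h1 : 0 < Real.pi / ω := div_pos Real.pi_pos hω
      refine ⟨min (T / 2) (Real.pi / ω), lt_min (by linarith [h.pos]) h1,
        (min_le_left _ _).trans_lt (by linarith [h.pos]), FundPair.sin_pos hω (min_le_right _ _)⟩
  have h1 := (h.formula hd hCS r ⟨hr.le, hrT.le⟩).1
  rw [hu0, zero_mul, zero_add] at h1
  have h2 := hpos r ⟨hr, hrT⟩
  rw [h1] at h2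
  exact pos_of_mul_pos_left h2 (forced_pos hd hCS hr hS').le

/-- At the half period `π / ω` the homogeneous part vanishes and only the nonpositive forced part
remains. So the excursion is over by then, while `S` is still nonnegative. -/
lemma ReturnSol.nonneg_of_forcing_nonpos {τ d c T : ℝ} {x u C S : ℝ → ℝ}
    (h : ReturnSol τ d c x u T) (hd : d ≠ 0) (hCS : FundPair ((τ / 2) ^ 2 - d) C S)
    (hS : (∀ t > 0, 0 < S t) ∨ ∃ ω > 0, (τ / 2) ^ 2 - d = -ω ^ 2 ∧
      C = (fun t => Real.cos (ω * t)) ∧ S = fun t => Real.sin (ω * t) / ω) (hc : c ≤ 0) :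
    0 ≤ S T := by
  rcases hS with hS | ⟨ω, hω, -, -, rfl⟩
  · exact (hS T h.pos).le
  · have h1 : 0 < Real.pi / ω := div_pos Real.pi_pos hω
    have hle : T ≤ Real.pi / ω := by
      by_contra hlt
      have hlt := not_le.1 hlt
      have h2 := (h.formula hd hCS _ ⟨h1.le, hlt.le⟩).1
      have h3 := h.xpos _ ⟨h1, hlt⟩
      have h4 := forced_pos hd hCS h1 (FundPair.sin_pos hω le_rfl)
      have h5 : Real.sin (ω * (Real.pi / ω)) = 0 := by
        rw [mul_div_cancel₀ _ hω.ne']; exact Real.sin_pi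
      rw [h2, h5] at h3
      simp only [zero_div, mul_zero, zero_add] at h3
      nlinarith
    refine div_nonneg (Real.sin_nonneg_of_nonneg_of_le_pi (mul_nonneg hω.le h.pos.le) ?_) hω.le
    rw [le_div_iff₀ hω] at hle; linarith

/-- After a full period the homogeneous part vanishes, and positivity of the solution reads `0 < c *
(1 - exp (τ * π / ω)) / d`. Here `d > 0` because the eigenvalues are not real, so damping is
necessary. -/
lemma ReturnSol.growth_nonneg {τ d c T ω : ℝ} {x u : ℝ → ℝ}
    (h : ReturnSol τ d c x u T) (hd : d ≠ 0) (hω : 0 < ω) (hδ : (τ / 2) ^ 2 - d = -ω ^ 2)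
    (hCS : FundPair ((τ / 2) ^ 2 - d) (fun t => Real.cos (ω * t)) (fun t => Real.sin (ω * t) / ω))
    (hc : 0 < c) (hT : 2 * Real.pi / ω < T) : τ < 0 := by
  have hP : 0 < 2 * Real.pi / ω := by positivity
  have h1 := (h.formula hd hCS _ ⟨hP.le, hT.le⟩).1
  have h2 := h.xpos _ ⟨hP, hT⟩
  have h3 : ω * (2 * Real.pi / ω) = 2 * Real.pi := by field_simp
  have hd' : 0 < d := by nlinarith [sq_nonneg (τ / 2), sq_pos_of_pos hω]
  rw [h1] at h2
  simp only [forced, h3, Real.sin_two_pi, Real.cos_two_pi, zero_div, mul_zero, zero_add, sub_zero,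
    mul_one] at h2
  have h4 := pos_of_mul_pos_right h2 hc.le
  rw [div_pos_iff_of_pos_right hd', sub_pos, Real.exp_lt_one_iff] at h4
  by_contra hτ
  have := mul_nonneg (div_nonneg (not_lt.1 hτ) (by norm_num : (0 : ℝ) ≤ 2)) hP.le
  linarith

/-- If `S` were positive up to the return time and at it, the formula would be a sum of a
nonnegative and a positive term. A positive `S T` therefore needs more than a full period, but then
`growth_nonneg`, applied to the solution and to its reversal, gives `τ < 0` and `-τ < 0`. -/
lemma ReturnSol.nonpos_of_forcing_pos {τ d c T : ℝ} {x u C S : ℝ → ℝ}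
    (h : ReturnSol τ d c x u T) (hd : d ≠ 0) (hCS : FundPair ((τ / 2) ^ 2 - d) C S)
    (hS : (∀ t > 0, 0 < S t) ∨ ∃ ω > 0, (τ / 2) ^ 2 - d = -ω ^ 2 ∧
      C = (fun t => Real.cos (ω * t)) ∧ S = fun t => Real.sin (ω * t) / ω) (hc : 0 < c) :
    S T ≤ 0 := by
  have hu := h.u0_nonneg h.xpos
  by_contra hST
  have hST := not_le.1 hST
  have hno : ¬ ∀ t ∈ Ioo 0 T, 0 < S t := fun hpos => by
    have h1 := (h.formula hd hCS T ⟨h.pos.le, le_rfl⟩).1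
    have h2 := forced_pos hd hCS h.pos hpos
    rw [h.xT] at h1
    have h3 := mul_nonneg hu (mul_pos (Real.exp_pos (τ / 2 * T)) hST).le
    have h4 := mul_pos hc h2
    linarith
  rcases hS with hS | ⟨ω, hω, hδ, rfl, rfl⟩
  · exact hno fun t ht => hS t ht.1
  · have h1 : Real.pi / ω < T := by
      by_contra hle
      exact hno (FundPair.sin_pos hω (not_lt.1 hle))
    have h2 : 2 * Real.pi / ω < T := by
      by_contra hle
      have h3 := not_lt.1 hle
      rw [div_lt_iff₀ hω] at h1
      rw [le_div_iff₀ hω] at h3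
      have : Real.sin (ω * T) ≤ 0 := by
        rw [← Real.sin_sub_two_pi]
        exact Real.sin_nonpos_of_nonpos_of_neg_pi_le (by linarith) (by linarith)
      exact absurd hST (not_lt.2 (div_nonpos_of_nonpos_of_nonneg this hω.le))
    have h3 := h.growth_nonneg hd hω hδ hCS hc h2
    have h4 := h.reverse.growth_nonneg hd hω (by rw [← hδ]; ring)
      (by rwa [show (-τ / 2) ^ 2 - d = (τ / 2) ^ 2 - d by ring]) hc h2
    linarith

/-- The return time is monotone in the initial velocity. -/
lemma ReturnSol.time_compare {τ d c T₁ T₂ : ℝ} {x₁ u₁ x₂ u₂ : ℝ → ℝ}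
    (h₁ : ReturnSol τ d c x₁ u₁ T₁) (h₂ : ReturnSol τ d c x₂ u₂ T₂) (hd : d ≠ 0)
    (hu : u₁ 0 ≤ u₂ 0) : (c ≤ 0 → T₁ ≤ T₂) ∧ (0 < c → T₂ ≤ T₁) := by
  obtain ⟨C, S, hCS, hS⟩ := exists_fundPair ((τ / 2) ^ 2 - d)
  constructor
  · intro hc
    by_contra hlt
    have hlt := not_le.1 hlt
    -- Compared at the shorter time, the forced parts cancel and leave the difference of the initial
    -- velocities times a multiple of `S T₂`, whose sign is known.
    have e1 := (h₁.formula hd hCS T₂ ⟨h₂.pos.le, hlt.le⟩).1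
    have e2 := (h₂.formula hd hCS T₂ ⟨h₂.pos.le, le_rfl⟩).1
    rw [h₂.xT] at e2
    have h3 := h₁.xpos T₂ ⟨h₂.pos, hlt⟩
    have h4 := mul_nonneg (Real.exp_pos (τ / 2 * T₂)).le (h₂.nonneg_of_forcing_nonpos hd hCS hS hc)
    have h5 := mul_le_mul_of_nonneg_right hu h4
    linarith
  · intro hc
    by_contra hlt
    have hlt := not_le.1 hlt
    have e1 := (h₂.formula hd hCS T₁ ⟨h₁.pos.le, hlt.le⟩).1
    have e2 := (h₁.formula hd hCS T₁ ⟨h₁.pos.le, le_rfl⟩).1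
    rw [h₁.xT] at e2
    have h3 := h₂.xpos T₁ ⟨h₁.pos, hlt⟩
    have h4 := mul_nonpos_of_nonneg_of_nonpos (Real.exp_pos (τ / 2 * T₁)).le
      (h₁.nonpos_of_forcing_pos hd hCS hS hc)
    have h5 := mul_le_mul_of_nonpos_right hu h4
    linarith

/-- The return velocity is antitone in the initial velocity. -/
lemma ReturnSol.velocity_antitone {τ d c T₁ T₂ : ℝ} {x₁ u₁ x₂ u₂ : ℝ → ℝ}
    (h₁ : ReturnSol τ d c x₁ u₁ T₁) (h₂ : ReturnSol τ d c x₂ u₂ T₂) (hd : d ≠ 0)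
    (hu : u₁ 0 ≤ u₂ 0) : u₂ T₂ ≤ u₁ T₁ := by
  by_contra hlt
  have hlt := not_le.1 hlt
  have hf := h₁.time_compare h₂ hd hu
  -- If the return velocities were in the wrong order, the reversed solutions would give the
  -- opposite inequality between the return times, which must then be equal.
  have hb := h₂.reverse.time_compare h₁.reverse hd (by simpa using hlt.le)
  have hT : T₁ = T₂ := by
    rcases le_or_gt c 0 with hc | hc
    · exact le_antisymm (hf.1 hc) (hb.1 hc)
    · exact le_antisymm (hb.2 hc) (hf.2 hc)
  subst hT
  obtain ⟨C, S, hCS, -⟩ := exists_fundPair ((τ / 2) ^ 2 - d)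
  obtain ⟨e1, f1⟩ := h₁.formula hd hCS T₁ ⟨h₁.pos.le, le_rfl⟩
  obtain ⟨e2, f2⟩ := h₂.formula hd hCS T₁ ⟨h₁.pos.le, le_rfl⟩
  rw [h₁.xT] at e1
  rw [h₂.xT] at e2
  have hE := Real.exp_pos (τ / 2 * T₁)
  rcases hu.eq_or_lt with heq | hne
  · rw [f1, f2, heq] at hlt; exact lt_irrefl _ hlt
  · have h0 : (u₂ 0 - u₁ 0) * (Real.exp (τ / 2 * T₁) * S T₁) = 0 := by linarith
    -- Different velocities with a common return time force a zero of `S`, hence `C = ±1`. The value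
    -- `-1` reverses the order as wanted; with the value `1` each return velocity is a positive
    -- multiple of the nonnegative start velocity, against the assumed order below zero.
    have hS : S T₁ = 0 := by
      rcases mul_eq_zero.1 h0 with h | h
      · linarith
      · exact (mul_eq_zero.1 h).resolve_left hE.ne'
    have hC : C T₁ = 1 ∨ C T₁ = -1 := by
      have := hCS.pyth T₁
      rw [hS] at this
      exact sq_eq_one_iff.1 (by linarith)
    have hv1 := h₁.u_end_nonpos
    have hv2 := h₂.u_end_nonpos
    have hp1 := h₁.u0_nonneg h₁.xpos
    rw [f1] at hlt hv1
    rw [f2] at hlt hv2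
    rw [hS] at hlt hv1 hv2
    rcases hC with h | h
    · rw [h] at hlt hv1 hv2
      simp only [mul_zero, add_zero, mul_one] at hlt hv1 hv2
      nlinarith [mul_nonneg hp1 hE.le]
    · rw [h] at hlt
      nlinarith

namespace PWLSystem

variable {Z Z' : PWLSystem}

/-! ### Coordinates -/

lemma fp_zero (Z : PWLSystem) (z : Plane) :
    Z.fp z 0 = Z.Ap 0 0 * z 0 + Z.Ap 0 1 * z 1 + Z.bp 0 := by
  simp [fp]

lemma fp_one (Z : PWLSystem) (z : Plane) :
    Z.fp z 1 = Z.Ap 1 0 * z 0 + Z.Ap 1 1 * z 1 + Z.bp 1 := by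
  simp [fp]

lemma fm_zero (Z : PWLSystem) (z : Plane) :
    Z.fm z 0 = Z.Am 0 0 * z 0 + Z.Am 0 1 * z 1 + Z.bm 0 := by
  simp [fm]

lemma fm_one (Z : PWLSystem) (z : Plane) :
    Z.fm z 1 = Z.Am 1 0 * z 0 + Z.Am 1 1 * z 1 + Z.bm 1 := by
  simp [fm]

end PWLSystem

@[simp] lemma onLine_zero (y : ℝ) : onLine y 0 = 0 := rfl
@[simp] lemma onLine_one (y : ℝ) : onLine y 1 = y := rfl

lemma plane_ext {z w : Plane} (h0 : z 0 = w 0) (h1 : z 1 = w 1) : z = w := by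
  ext i; fin_cases i <;> assumption

lemma onLine_mem (y : ℝ) : onLine y ∈ switchLine := rfl

lemma eq_onLine {z : Plane} (h : z 0 = 0) : z = onLine (z 1) := plane_ext h rfl

lemma onLine_injective : Function.Injective onLine := fun a b h => by
  simpa using congrFun h 1

lemma neg_onLine (y : ℝ) : -onLine y = onLine (-y) := plane_ext (by simp) (by simp)

lemma continuous_onLine : Continuous onLine := by
  refine continuous_pi fun i => ?_
  fin_cases i
  · exact continuous_const
  · exact continuous_id

lemma isClosed_switchLine : IsClosed switchLine :=
  isClosed_eq (continuous_apply 0) continuous_const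

namespace PWLSystem

variable {Z Z' : PWLSystem}

lemma fp_onLine_zero (Z : PWLSystem) (y : ℝ) :
    Z.fp (onLine y) 0 = Z.Ap 0 1 * y + Z.bp 0 := by simp [fp_zero]

lemma fp_onLine_one (Z : PWLSystem) (y : ℝ) :
    Z.fp (onLine y) 1 = Z.Ap 1 1 * y + Z.bp 1 := by simp [fp_one]

lemma fm_onLine_zero (Z : PWLSystem) (y : ℝ) :
    Z.fm (onLine y) 0 = Z.Am 0 1 * y + Z.bm 0 := by simp [fm_zero]

lemma fm_onLine_one (Z : PWLSystem) (y : ℝ) :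
    Z.fm (onLine y) 1 = Z.Am 1 1 * y + Z.bm 1 := by simp [fm_one]

lemma contDiff_fp (Z : PWLSystem) : ContDiff ℝ 1 Z.fp := by
  have : Z.fp = fun z => Matrix.mulVecLin Z.Ap z + Z.bp := rfl
  rw [this]
  exact (LinearMap.toContinuousLinearMap (Matrix.mulVecLin Z.Ap)).contDiff.add contDiff_const

lemma contDiff_fm (Z : PWLSystem) : ContDiff ℝ 1 Z.fm := by
  have : Z.fm = fun z => Matrix.mulVecLin Z.Am z + Z.bm := rfl
  rw [this]
  exact (LinearMap.toContinuousLinearMap (Matrix.mulVecLin Z.Am)).contDiff.add contDiff_const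

lemma continuous_fp (Z : PWLSystem) : Continuous Z.fp := Z.contDiff_fp.continuous
lemma continuous_fm (Z : PWLSystem) : Continuous Z.fm := Z.contDiff_fm.continuous

lemma exists_lipschitz_fp (Z : PWLSystem) : ∃ K, LipschitzWith K Z.fp := by
  refine ⟨_, LipschitzWith.of_dist_le_mul
    (K := ‖LinearMap.toContinuousLinearMap (Matrix.mulVecLin Z.Ap)‖₊) fun x y => ?_⟩
  have h : Z.fp x - Z.fp y = LinearMap.toContinuousLinearMap (Matrix.mulVecLin Z.Ap) (x - y) := by
    rw [LinearMap.coe_toContinuousLinearMap', Matrix.mulVecLin_apply, Matrix.mulVec_sub]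
    exact add_sub_add_right_eq_sub _ _ _
  rw [dist_eq_norm, dist_eq_norm, h]
  exact ContinuousLinearMap.le_opNorm _ _

/-! ### The sliding field -/

lemma convexField_zero (Z : PWLSystem) (z : Plane) : Z.convexField z 0 = 0 := by
  simp only [convexField, Pi.smul_apply, Pi.sub_apply, smul_eq_mul]; ring

lemma convexField_one (Z : PWLSystem) (z : Plane) : Z.convexField z 1 =
    (Z.fm z 0 - Z.fp z 0)⁻¹ * (Z.fm z 0 * Z.fp z 1 - Z.fp z 0 * Z.fm z 1) := by
  simp only [convexField, Pi.smul_apply, Pi.sub_apply, smul_eq_mul]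

lemma slidingField_of_ne {z : Plane} (h : Z.fm z 0 ≠ Z.fp z 0) :
    Z.slidingField z = Z.convexField z := by
  rw [slidingField, if_pos h]

/-- The chosen limit is independent of the choice because the filter is nontrivial, so limits are
unique. -/
lemma slidingField_of_tendsto {z L : Plane} (h : Z.fm z 0 = Z.fp z 0)
    (hn : (𝓝[Z.regularSliding] z).NeBot)
    (hL : Tendsto Z.convexField (𝓝[Z.regularSliding] z) (𝓝 L)) : Z.slidingField z = L := by
  have hex : ∃ L : Plane, (𝓝[Z.regularSliding] z).NeBot ∧
      Tendsto Z.convexField (𝓝[Z.regularSliding] z) (𝓝 L) := ⟨L, hn, hL⟩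
  rw [slidingField, if_neg (not_not.2 h), dif_pos hex]
  exact tendsto_nhds_unique hex.choose_spec.2 hL

lemma slidingField_of_not {z : Plane} (h : Z.fm z 0 = Z.fp z 0)
    (hn : ¬ ∃ L : Plane, (𝓝[Z.regularSliding] z).NeBot ∧
      Tendsto Z.convexField (𝓝[Z.regularSliding] z) (𝓝 L)) : Z.slidingField z = 0 := by
  rw [slidingField, if_neg (not_not.2 h), dif_neg hn]

/-! ### Time reversal -/

@[simp] lemma reverse_fp (Z : PWLSystem) (z : Plane) : Z.reverse.fp z = -Z.fp z := by
  simp [fp, reverse, Matrix.neg_mulVec, add_comm]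

@[simp] lemma reverse_fm (Z : PWLSystem) (z : Plane) : Z.reverse.fm z = -Z.fm z := by
  simp [fm, reverse, Matrix.neg_mulVec, add_comm]

@[simp] lemma reverse_reverse (Z : PWLSystem) : Z.reverse.reverse = Z := by
  simp [reverse]

lemma Nondegenerate.reverse (h : Z.Nondegenerate) : Z.reverse.Nondegenerate := by
  simpa [Nondegenerate, PWLSystem.reverse, Matrix.det_neg] using h

lemma reverse_sliding (Z : PWLSystem) : Z.reverse.sliding = Z.sliding := by
  simp [sliding]

lemma reverse_regularSliding (Z : PWLSystem) : Z.reverse.regularSliding = Z.regularSliding := by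
  simp [regularSliding, reverse_sliding]

lemma reverse_convexField (Z : PWLSystem) (z : Plane) :
    Z.reverse.convexField z = -Z.convexField z := by
  simp only [convexField, reverse_fp, reverse_fm, Pi.neg_apply]
  rw [show -Z.fm z 0 - -Z.fp z 0 = -(Z.fm z 0 - Z.fp z 0) by ring, inv_neg]
  simp

lemma reverse_slidingField (Z : PWLSystem) (z : Plane) :
    Z.reverse.slidingField z = -Z.slidingField z := by
  by_cases h : Z.fm z 0 = Z.fp z 0
  · have h' : Z.reverse.fm z 0 = Z.reverse.fp z 0 := by simp [h]
    have hc : Z.reverse.convexField = fun z => -Z.convexField z :=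
      funext Z.reverse_convexField
    by_cases hL : ∃ L : Plane, (𝓝[Z.regularSliding] z).NeBot ∧
      Tendsto Z.convexField (𝓝[Z.regularSliding] z) (𝓝 L)
    · obtain ⟨L, hn, hL⟩ := hL
      rw [slidingField_of_tendsto h hn hL]
      refine slidingField_of_tendsto h' (by rwa [reverse_regularSliding]) ?_
      rw [reverse_regularSliding, hc]
      exact hL.neg
    · rw [slidingField_of_not h hL, slidingField_of_not h', neg_zero]
      rintro ⟨L, hn, hL'⟩
      rw [reverse_regularSliding] at hn hL'
      refine hL ⟨-L, hn, ?_⟩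
      rw [hc] at hL'
      simpa using hL'.neg
  · rw [slidingField_of_ne h, slidingField_of_ne (by simpa using h), reverse_convexField]

lemma slidingPeriodicOrbits_reverse (Z : PWLSystem) :
    Z.reverse.slidingPeriodicOrbits = Z.slidingPeriodicOrbits := by
  ext γ; simp [slidingPeriodicOrbits, or_comm]

/-! ### Symmetries -/

/-- `S` is a linear conjugacy from `Z` to `Z'` that keeps the two half planes. -/
def IsKeep (Z Z' : PWLSystem) (S : Plane ≃L[ℝ] Plane) : Prop :=
  ∀ z, S z 0 = z 0 ∧ Z'.fp (S z) = S (Z.fp z) ∧ Z'.fm (S z) = S (Z.fm z)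

/-- `S` is a linear conjugacy from `Z` to `Z'` that exchanges the two half planes. -/
def IsSwap (Z Z' : PWLSystem) (S : Plane ≃L[ℝ] Plane) : Prop :=
  ∀ z, S z 0 = -z 0 ∧ Z'.fp (S z) = S (Z.fm z) ∧ Z'.fm (S z) = S (Z.fp z)

/-- `S` is a linear conjugacy from `Z` to `Z'`. -/
def IsConj (Z Z' : PWLSystem) (S : Plane ≃L[ℝ] Plane) : Prop := IsKeep Z Z' S ∨ IsSwap Z Z' S

variable {S : Plane ≃L[ℝ] Plane}

lemma IsKeep.symm (h : IsKeep Z Z' S) : IsKeep Z' Z S.symm := fun z => by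
  obtain ⟨h0, h1, h2⟩ := h (S.symm z)
  rw [S.apply_symm_apply] at h0 h1 h2
  exact ⟨h0.symm, by rw [h1, S.symm_apply_apply], by rw [h2, S.symm_apply_apply]⟩

lemma IsSwap.symm (h : IsSwap Z Z' S) : IsSwap Z' Z S.symm := fun z => by
  obtain ⟨h0, h1, h2⟩ := h (S.symm z)
  rw [S.apply_symm_apply] at h0 h1 h2
  exact ⟨by rw [h0, neg_neg], by rw [h2, S.symm_apply_apply], by rw [h1, S.symm_apply_apply]⟩

lemma IsConj.symm (h : IsConj Z Z' S) : IsConj Z' Z S.symm := h.imp IsKeep.symm IsSwap.symm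

lemma IsKeep.reverse (h : IsKeep Z Z' S) : IsKeep Z.reverse Z'.reverse S := fun z => by
  simp [h z]

lemma IsSwap.reverse (h : IsSwap Z Z' S) : IsSwap Z.reverse Z'.reverse S := fun z => by
  simp [h z]

lemma IsConj.reverse (h : IsConj Z Z' S) : IsConj Z.reverse Z'.reverse S :=
  h.imp IsKeep.reverse IsSwap.reverse

lemma IsConj.apply_zero (h : IsConj Z Z' S) :
    (∀ z, S z 0 = z 0) ∨ (∀ z, S z 0 = -z 0) :=
  h.imp (fun h z => (h z).1) (fun h z => (h z).1)

lemma IsConj.mem_switchLine (h : IsConj Z Z' S) (z : Plane) :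
    S z ∈ switchLine ↔ z ∈ switchLine := by
  rcases h.apply_zero with h | h <;> simp [switchLine, h]

lemma IsConj.mem_sliding (h : IsConj Z Z' S) (z : Plane) :
    S z ∈ Z'.sliding ↔ z ∈ Z.sliding := by
  refine and_congr (h.mem_switchLine z) ?_
  rcases h with h | h <;> obtain ⟨-, h1, h2⟩ := h z <;> rw [h1, h2, (h _).1, (h _).1]
  rw [neg_mul_neg, mul_comm]

lemma IsConj.ne_iff (h : IsConj Z Z' S) (z : Plane) :
    Z'.fm (S z) 0 ≠ Z'.fp (S z) 0 ↔ Z.fm z 0 ≠ Z.fp z 0 := by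
  rcases h with h | h <;> obtain ⟨-, h1, h2⟩ := h z <;> rw [h1, h2, (h _).1, (h _).1]
  rw [ne_eq, neg_inj, eq_comm]

lemma IsConj.convexField (h : IsConj Z Z' S) (z : Plane) :
    Z'.convexField (S z) = S (Z.convexField z) := by
  rcases h with h | h <;> obtain ⟨-, h1, h2⟩ := h z <;>
    simp only [PWLSystem.convexField, map_smul, map_sub] <;> rw [h1, h2, (h _).1, (h _).1]
  rw [show -Z.fp z 0 - -Z.fm z 0 = Z.fm z 0 - Z.fp z 0 by ring]
  congr 1
  rw [neg_smul, neg_smul]; abel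

/-- This transports the limits that define the sliding field at singular points, so that conjugacies
respect the field there as well. -/
lemma IsConj.nhdsWithin (h : IsConj Z Z' S) (z : Plane) :
    𝓝[Z'.regularSliding] (S z) = map S (𝓝[Z.regularSliding] z) := by
  have := S.toHomeomorph.isEmbedding.map_nhdsWithin_eq Z.regularSliding z
  change map S (𝓝[Z.regularSliding] z) = 𝓝[S '' Z.regularSliding] (S z) at this
  rw [this]
  congr 1
  ext w
  obtain ⟨w, rfl⟩ := S.surjective w
  rw [S.injective.mem_set_image]
  exact and_congr (h.mem_sliding w) (h.ne_iff w)

lemma IsConj.slidingField (h : IsConj Z Z' S) (z : Plane) :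
    Z'.slidingField (S z) = S (Z.slidingField z) := by
  by_cases hz : Z.fm z 0 = Z.fp z 0
  · have hz' : Z'.fm (S z) 0 = Z'.fp (S z) 0 := by
      by_contra hne; exact (h.ne_iff z).1 hne hz
    have hc : Z'.convexField ∘ S = S ∘ Z.convexField := funext h.convexField
    by_cases hL : ∃ L : Plane, (𝓝[Z.regularSliding] z).NeBot ∧
      Tendsto Z.convexField (𝓝[Z.regularSliding] z) (𝓝 L)
    · obtain ⟨L, hn, hL⟩ := hL
      rw [slidingField_of_tendsto hz hn hL]
      refine slidingField_of_tendsto hz' (by rw [h.nhdsWithin]; infer_instance) ?_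
      rw [h.nhdsWithin, tendsto_map'_iff, hc]
      exact (S.continuous.tendsto L).comp hL
    · rw [slidingField_of_not hz hL, slidingField_of_not hz', map_zero]
      rintro ⟨L, hn, hL'⟩
      rw [h.nhdsWithin] at hn hL'
      rw [map_neBot_iff] at hn
      refine hL ⟨S.symm L, hn, ?_⟩
      rw [tendsto_map'_iff, hc] at hL'
      have := (S.symm.continuous.tendsto L).comp hL'
      refine this.congr fun w => ?_
      simp
  · rw [slidingField_of_ne hz, slidingField_of_ne ((h.ne_iff z).2 hz), h.convexField]

variable {w : ℝ → Plane} {I : Set ℝ}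

lemma IsConj.slidesOn (h : IsConj Z Z' S) (hw : Z.SlidesOn w I) : Z'.SlidesOn (S ∘ w) I :=
  fun s hs => ⟨(h.mem_sliding _).2 (hw s hs).1, by
    rw [Function.comp_apply, h.slidingField]
    exact (S : Plane →L[ℝ] Plane).hasFDerivAt.comp_hasDerivWithinAt s (hw s hs).2⟩

lemma IsKeep.rightOn (h : IsKeep Z Z' S) (hw : Z.RightOn w I) : Z'.RightOn (S ∘ w) I :=
  fun s hs => ⟨by rw [Function.comp_apply, (h _).1]; exact (hw s hs).1, by
    rw [Function.comp_apply, (h _).2.1]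
    exact (S : Plane →L[ℝ] Plane).hasFDerivAt.comp_hasDerivAt s (hw s hs).2⟩

lemma IsKeep.leftOn (h : IsKeep Z Z' S) (hw : Z.LeftOn w I) : Z'.LeftOn (S ∘ w) I :=
  fun s hs => ⟨by rw [Function.comp_apply, (h _).1]; exact (hw s hs).1, by
    rw [Function.comp_apply, (h _).2.2]
    exact (S : Plane →L[ℝ] Plane).hasFDerivAt.comp_hasDerivAt s (hw s hs).2⟩

lemma IsSwap.leftOn (h : IsSwap Z Z' S) (hw : Z.RightOn w I) : Z'.LeftOn (S ∘ w) I :=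
  fun s hs => ⟨by rw [Function.comp_apply, (h _).1]; exact neg_neg_of_pos (hw s hs).1, by
    rw [Function.comp_apply, (h _).2.2]
    exact (S : Plane →L[ℝ] Plane).hasFDerivAt.comp_hasDerivAt s (hw s hs).2⟩

lemma IsSwap.rightOn (h : IsSwap Z Z' S) (hw : Z.LeftOn w I) : Z'.RightOn (S ∘ w) I :=
  fun s hs => ⟨by rw [Function.comp_apply, (h _).1]; exact neg_pos_of_neg (hw s hs).1, by
    rw [Function.comp_apply, (h _).2.1]
    exact (S : Plane →L[ℝ] Plane).hasFDerivAt.comp_hasDerivAt s (hw s hs).2⟩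

lemma IsConj.rightOn_or_leftOn (h : IsConj Z Z' S) (hw : Z.RightOn w I ∨ Z.LeftOn w I) :
    Z'.RightOn (S ∘ w) I ∨ Z'.LeftOn (S ∘ w) I := by
  rcases h with h | h
  · exact hw.imp h.rightOn h.leftOn
  · exact hw.symm.imp h.rightOn h.leftOn

lemma IsConj.canSlide (h : IsConj Z Z' S) {p : Plane} (hp : Z.CanSlide p) :
    Z'.CanSlide (S p) := by
  obtain ⟨ε, hε, w, hw, hs⟩ := hp
  exact ⟨ε, hε, S ∘ w, by simp [hw], h.slidesOn hs⟩

lemma IsConj.canSlide_iff (h : IsConj Z Z' S) {p : Plane} :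
    Z'.CanSlide (S p) ↔ Z.CanSlide p :=
  ⟨fun hp => by simpa using h.symm.canSlide hp, h.canSlide⟩

lemma IsConj.stepsFrom (h : IsConj Z Z' S) {t ε : ℝ} (hw : Z.StepsFrom w t ε) :
    Z'.StepsFrom (S ∘ w) t ε :=
  hw.imp (fun h1 => ⟨h.canSlide h1.1, h.slidesOn h1.2⟩)
    (fun h1 => ⟨by rw [Function.comp_apply, h.canSlide_iff]; exact h1.1,
      h.rightOn_or_leftOn h1.2⟩)

lemma IsConj.forwardOrbit_subset (h : IsConj Z Z' S) (p : Plane) :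
    S '' Z.forwardOrbit p ⊆ Z'.forwardOrbit (S p) := by
  rintro _ ⟨q, ⟨T, hT, z, ⟨hc, hz⟩, h0, h1⟩, rfl⟩
  refine ⟨T, hT, S ∘ z, ⟨S.continuous.comp_continuousOn hc, fun t ht => ?_⟩, by simp [h0],
    by simp [h1]⟩
  obtain ⟨ε, hε, hle, hs⟩ := hz t ht
  exact ⟨ε, hε, hle, h.stepsFrom hs⟩

lemma IsConj.forwardOrbit (h : IsConj Z Z' S) (p : Plane) :
    S '' Z.forwardOrbit p = Z'.forwardOrbit (S p) := by
  refine Subset.antisymm (h.forwardOrbit_subset p) fun q hq => ?_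
  have := h.symm.forwardOrbit_subset (S p) ⟨q, hq, rfl⟩
  rw [S.symm_apply_apply] at this
  exact ⟨_, this, S.apply_symm_apply q⟩

lemma IsConj.isSigmaEquivalence (h : IsConj Z Z' S) : IsSigmaEquivalence Z Z' S.toHomeomorph := by
  refine ⟨?_, fun p => ⟨h.forwardOrbit p, h.reverse.forwardOrbit p⟩⟩
  ext q
  obtain ⟨q, rfl⟩ := S.surjective q
  exact (S.injective.mem_set_image).trans (h.mem_switchLine q).symm

lemma IsConj.isForwardSlidingPeriodicOrbit (h : IsConj Z Z' S) {γ : Set Plane}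
    (hγ : Z.IsForwardSlidingPeriodicOrbit γ) : Z'.IsForwardSlidingPeriodicOrbit (S '' γ) := by
  obtain ⟨z, T, hT, hc, hp, hs, ⟨a, b, hab⟩, ⟨c, d, hcd, hsl⟩, rfl⟩ := hγ
  refine ⟨S ∘ z, T, hT, S.continuous.comp hc, fun t => by simp [hp], fun t => ?_,
    ⟨a, b, fun he => hab (S.injective he)⟩,
    ⟨c, d, hcd, fun t ht => (h.mem_sliding _).2 (hsl t ht)⟩, (range_comp _ _).symm⟩
  obtain ⟨ε, hε, hs⟩ := hs t
  exact ⟨ε, hε, h.stepsFrom hs⟩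

lemma IsConj.slidingPeriodicOrbits (h : IsConj Z Z' S) :
    Z'.slidingPeriodicOrbits = image S '' Z.slidingPeriodicOrbits := by
  refine Subset.antisymm (fun γ hγ => ?_) ?_
  · refine ⟨S.symm '' γ, hγ.imp h.symm.isForwardSlidingPeriodicOrbit
      h.symm.reverse.isForwardSlidingPeriodicOrbit, ?_⟩
    simp [image_image]
  · rintro _ ⟨γ, hγ, rfl⟩
    exact hγ.imp h.isForwardSlidingPeriodicOrbit h.reverse.isForwardSlidingPeriodicOrbit

/-! ### Arcs under symmetries -/

variable {p q : Plane} {C : Set Plane}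

lemma IsConj.slidingArc (h : IsConj Z Z' S) (hC : Z.SlidingArc p q C) :
    Z'.SlidingArc (S p) (S q) (S '' C) := by
  obtain ⟨w, T, hT, rfl, rfl, hs, rfl⟩ := hC
  exact ⟨S ∘ w, T, hT, rfl, rfl, h.slidesOn hs, (image_comp _ _ _).symm⟩

lemma IsSwap.leftArc (h : IsSwap Z Z' S) (hC : Z.RightArc p q C) :
    Z'.LeftArc (S p) (S q) (S '' C) := by
  obtain ⟨w, T, hT, hc, rfl, rfl, hs, rfl⟩ := hC
  exact ⟨S ∘ w, T, hT, S.continuous.comp_continuousOn hc, rfl, rfl, h.leftOn hs,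
    (image_comp _ _ _).symm⟩

lemma IsSwap.rightArc (h : IsSwap Z Z' S) (hC : Z.LeftArc p q C) :
    Z'.RightArc (S p) (S q) (S '' C) := by
  obtain ⟨w, T, hT, hc, rfl, rfl, hs, rfl⟩ := hC
  exact ⟨S ∘ w, T, hT, S.continuous.comp_continuousOn hc, rfl, rfl, h.rightOn hs,
    (image_comp _ _ _).symm⟩

lemma IsSwap.visibleLeft (h : IsSwap Z Z' S) (hp : Z.VisibleRight p) : Z'.VisibleLeft (S p) := by
  obtain ⟨h0, h1, h2, h3, ε, hε, w, rfl, hw⟩ := hp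
  obtain ⟨e0, e1, e2⟩ := h (w 0)
  refine ⟨(IsConj.mem_switchLine (Or.inr h) _).2 h0, by rwa [e1, Ne, map_eq_zero_iff _ S.injective],
    by rwa [e2, Ne, map_eq_zero_iff _ S.injective], by rw [e2, (h _).1, h3, neg_zero], ε, hε,
    S ∘ w, rfl, fun s hs => ⟨?_, ?_⟩⟩
  · rw [Function.comp_apply, (h _).2.2]
    exact (S : Plane →L[ℝ] Plane).hasFDerivAt.comp_hasDerivAt s (hw s hs).1
  · rw [Function.comp_apply, (h _).1]; linarith [(hw s hs).2]

lemma reverse_time_image (w : ℝ → Plane) (T : ℝ) :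
    (fun t => w (T - t)) '' Icc 0 T = w '' Icc 0 T := by
  have : (fun t => w (T - t)) = w ∘ fun t => T - t := rfl
  rw [this, image_comp]
  simp

lemma RightArc.reverse (hC : Z.RightArc p q C) : Z.reverse.RightArc q p C := by
  obtain ⟨w, T, hT, hc, rfl, rfl, hs, rfl⟩ := hC
  refine ⟨fun t => w (T - t), T, hT, hc.comp (by fun_prop)
    fun t ht => ⟨by linarith [ht.2], by linarith [ht.1]⟩, by simp, by simp, fun t ht => ?_,
    (reverse_time_image w T).symm⟩
  have := hs (T - t) ⟨by linarith [ht.2], by linarith [ht.1]⟩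
  exact ⟨this.1, by rw [reverse_fp]; exact this.2.comp_const_sub T t⟩

lemma LeftArc.reverse (hC : Z.LeftArc p q C) : Z.reverse.LeftArc q p C := by
  obtain ⟨w, T, hT, hc, rfl, rfl, hs, rfl⟩ := hC
  refine ⟨fun t => w (T - t), T, hT, hc.comp (by fun_prop)
    fun t ht => ⟨by linarith [ht.2], by linarith [ht.1]⟩, by simp, by simp, fun t ht => ?_,
    (reverse_time_image w T).symm⟩
  have := hs (T - t) ⟨by linarith [ht.2], by linarith [ht.1]⟩
  exact ⟨this.1, by rw [reverse_fm]; exact this.2.comp_const_sub T t⟩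

lemma SlidingArc.reverse (hC : Z.SlidingArc p q C) : Z.reverse.SlidingArc q p C := by
  obtain ⟨w, T, hT, rfl, rfl, hs, rfl⟩ := hC
  refine ⟨fun t => w (T - t), T, hT, by simp, by simp, fun t ht => ?_,
    (reverse_time_image w T).symm⟩
  have := hs (T - t) ⟨by linarith [ht.2], by linarith [ht.1]⟩
  refine ⟨by rw [reverse_sliding]; exact this.1, ?_⟩
  rw [reverse_slidingField]
  have h1 : HasDerivWithinAt (fun t => T - t) (-1) (Icc 0 T) t := by
    simpa using ((hasDerivAt_id t).const_sub T).hasDerivWithinAt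
  have h2 := this.2.scomp t h1 fun s hs => ⟨by linarith [hs.2], by linarith [hs.1]⟩
  simpa [Function.comp_def] using h2

/-! ### The two symmetries used for normalization -/

/-- The system rotated by `π`. -/
def rot (Z : PWLSystem) : PWLSystem := ⟨Z.Am, -Z.bm, Z.Ap, -Z.bp⟩

lemma rot_isSwap (Z : PWLSystem) : IsSwap Z Z.rot (ContinuousLinearEquiv.neg ℝ) := fun z => by
  refine ⟨rfl, ?_, ?_⟩
  · simp [rot, fp, fm, Matrix.mulVec_neg, add_comm]
  · simp [rot, fp, fm, Matrix.mulVec_neg, add_comm]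

lemma Nondegenerate.rot (h : Z.Nondegenerate) : Z.rot.Nondegenerate := ⟨h.2, h.1⟩

@[simp] lemma rot_rot (Z : PWLSystem) : Z.rot.rot = Z := by simp [rot]

lemma rot_reverse (Z : PWLSystem) : Z.rot.reverse = Z.reverse.rot := by simp [rot, reverse]

/-- The reflection of the plane in the `x`-axis. -/
noncomputable def reflectY : Plane ≃L[ℝ] Plane :=
  ContinuousLinearEquiv.piCongrRight fun i : Fin 2 =>
    if i = 0 then ContinuousLinearEquiv.refl ℝ ℝ else ContinuousLinearEquiv.neg ℝ

@[simp] lemma reflectY_zero (z : Plane) : reflectY z 0 = z 0 := by simp [reflectY]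
@[simp] lemma reflectY_one (z : Plane) : reflectY z 1 = -z 1 := by simp [reflectY]

/-- The system reflected in the `x`-axis. -/
def flipY (Z : PWLSystem) : PWLSystem :=
  ⟨!![Z.Ap 0 0, -Z.Ap 0 1; -Z.Ap 1 0, Z.Ap 1 1], ![Z.bp 0, -Z.bp 1],
   !![Z.Am 0 0, -Z.Am 0 1; -Z.Am 1 0, Z.Am 1 1], ![Z.bm 0, -Z.bm 1]⟩

lemma flipY_isKeep (Z : PWLSystem) : IsKeep Z Z.flipY reflectY := fun z => by
  refine ⟨by simp, plane_ext ?_ ?_, plane_ext ?_ ?_⟩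
  · simp [fp_zero, flipY]
  · simp only [fp_one, flipY, reflectY_zero, reflectY_one]; simp; ring
  · simp [fm_zero, flipY]
  · simp only [fm_one, flipY, reflectY_zero, reflectY_one]; simp; ring

lemma Nondegenerate.flipY (h : Z.Nondegenerate) : Z.flipY.Nondegenerate := by
  simpa [Nondegenerate, PWLSystem.flipY, Matrix.det_fin_two] using h

end PWLSystem

namespace PWLSystem

variable {Z : PWLSystem} {z w : ℝ → Plane} {p : Plane} {a b y t ε : ℝ}

/-! ### Normal components and the scalar sliding equation -/

/-- The product of the normal components on the switching line. -/
def normalProd (Z : PWLSystem) (y : ℝ) : ℝ := Z.fp (onLine y) 0 * Z.fm (onLine y) 0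

/-- The sliding field as a scalar field on the switching line. -/
noncomputable def scalarField (Z : PWLSystem) (y : ℝ) : ℝ := Z.convexField (onLine y) 1

/-- The two fields are nowhere tangent to the switching line at the same point. -/
def Nonsingular (Z : PWLSystem) : Prop :=
  ∀ y, Z.fp (onLine y) 0 = 0 → Z.fm (onLine y) 0 ≠ 0

lemma onLine_mem_sliding : onLine y ∈ Z.sliding ↔ Z.normalProd y ≤ 0 :=
  and_iff_right (onLine_mem y)

/-- Equal normal components have a square as product. On the sliding region it is nonpositive, so
both components would vanish. -/
lemma Nonsingular.ne (h : Z.Nonsingular) (hy : Z.normalProd y ≤ 0) :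
    Z.fm (onLine y) 0 ≠ Z.fp (onLine y) 0 := fun he => by
  have h0 : Z.fp (onLine y) 0 = 0 := by
    rw [normalProd, he] at hy; nlinarith
  exact h y h0 (he.trans h0)

lemma Nonsingular.slidingField (h : Z.Nonsingular) (hp : p ∈ Z.sliding) :
    Z.slidingField p = Z.convexField p := by
  obtain ⟨y, rfl⟩ : ∃ y, p = onLine y := ⟨_, eq_onLine hp.1⟩
  exact slidingField_of_ne (h.ne (onLine_mem_sliding.1 hp))

lemma convexField_onLine (Z : PWLSystem) (y : ℝ) :
    Z.convexField (onLine y) = onLine (Z.scalarField y) :=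
  plane_ext (Z.convexField_zero _) rfl

lemma scalarField_of_fp_eq_zero (h : Z.fp (onLine y) 0 = 0) (h' : Z.fm (onLine y) 0 ≠ 0) :
    Z.scalarField y = Z.fp (onLine y) 1 := by
  rw [scalarField, convexField_one, h]; field_simp; ring

lemma scalarField_of_fm_eq_zero (h : Z.fm (onLine y) 0 = 0) (h' : Z.fp (onLine y) 0 ≠ 0) :
    Z.scalarField y = Z.fm (onLine y) 1 := by
  rw [scalarField, convexField_one, h]; field_simp; ring

lemma hasDerivAt_fp_onLine (Z : PWLSystem) (y : ℝ) :
    HasDerivAt (fun y => Z.fp (onLine y) 0) (Z.Ap 0 1) y := by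
  simp only [fp_onLine_zero]
  simpa using ((hasDerivAt_id y).const_mul (Z.Ap 0 1)).add_const (Z.bp 0)

lemma hasDerivAt_fm_onLine (Z : PWLSystem) (y : ℝ) :
    HasDerivAt (fun y => Z.fm (onLine y) 0) (Z.Am 0 1) y := by
  simp only [fm_onLine_zero]
  simpa using ((hasDerivAt_id y).const_mul (Z.Am 0 1)).add_const (Z.bm 0)

lemma hasDerivAt_normalProd (Z : PWLSystem) (y : ℝ) : HasDerivAt Z.normalProd
    (Z.Ap 0 1 * Z.fm (onLine y) 0 + Z.fp (onLine y) 0 * Z.Am 0 1) y :=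
  (Z.hasDerivAt_fp_onLine y).mul (Z.hasDerivAt_fm_onLine y)

lemma continuous_normalProd (Z : PWLSystem) : Continuous Z.normalProd :=
  continuous_iff_continuousAt.2 fun y => (Z.hasDerivAt_normalProd y).continuousAt

lemma contDiffAt_scalarField (h : Z.fm (onLine y) 0 ≠ Z.fp (onLine y) 0) :
    ContDiffAt ℝ 1 Z.scalarField y := by
  have : Z.scalarField = fun y => (Z.fm (onLine y) 0 - Z.fp (onLine y) 0)⁻¹ *
    (Z.fm (onLine y) 0 * Z.fp (onLine y) 1 - Z.fp (onLine y) 0 * Z.fm (onLine y) 1) :=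
    funext fun y => Z.convexField_one _
  rw [this]
  have h' := sub_ne_zero.2 h
  simp only [fp_onLine_zero, fm_onLine_zero, fp_onLine_one, fm_onLine_one] at h' ⊢
  refine ContDiffAt.mul (ContDiffAt.inv ?_ h') ?_
  · fun_prop
  · fun_prop

lemma isClosed_sliding (Z : PWLSystem) : IsClosed Z.sliding := by
  have h1 : Continuous fun z : Plane => Z.fp z 0 := (continuous_apply 0).comp Z.continuous_fp
  have h2 : Continuous fun z : Plane => Z.fm z 0 := (continuous_apply 0).comp Z.continuous_fm
  exact isClosed_switchLine.inter (isClosed_le (h1.mul h2) continuous_const)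

lemma hasDerivWithinAt_one {f : ℝ → Plane} {f' : Plane} {s : Set ℝ}
    (h : HasDerivWithinAt f f' s t) : HasDerivWithinAt (fun t => f t 1) (f' 1) s t :=
  (hasDerivWithinAt_pi.1 h) 1

/-! ### Sliding solutions -/

lemma SlidesOn.mono {I J : Set ℝ} (h : Z.SlidesOn z I) (hJ : J ⊆ I) : Z.SlidesOn z J :=
  fun s hs => ⟨(h s (hJ hs)).1, (h s (hJ hs)).2.mono hJ⟩

lemma hasDerivWithinAt_comp_add {f : ℝ → Plane} {f' : Plane} {I J : Set ℝ} (k : ℝ)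
    (h : HasDerivWithinAt f f' I (t + k)) (hJ : ∀ s ∈ J, s + k ∈ I) :
    HasDerivWithinAt (fun s => f (s + k)) f' J t := by
  have h1 : HasDerivWithinAt (fun s => s + k) 1 J t := ((hasDerivAt_id t).add_const k).hasDerivWithinAt
  simpa [Function.comp_def] using h.scomp t h1 hJ

lemma SlidesOn.shift {I J : Set ℝ} (k : ℝ) (h : Z.SlidesOn z I) (hJ : ∀ s ∈ J, s + k ∈ I) :
    Z.SlidesOn (fun s => z (s + k)) J := fun s hs =>
  ⟨(h _ (hJ s hs)).1, hasDerivWithinAt_comp_add k (h _ (hJ s hs)).2 hJ⟩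

lemma RightOn.shift {I J : Set ℝ} (k : ℝ) (h : Z.RightOn z I) (hJ : ∀ s ∈ J, s + k ∈ I) :
    Z.RightOn (fun s => z (s + k)) J := fun s hs =>
  ⟨(h _ (hJ s hs)).1, (h _ (hJ s hs)).2.comp_add_const s k⟩

lemma LeftOn.shift {I J : Set ℝ} (k : ℝ) (h : Z.LeftOn z I) (hJ : ∀ s ∈ J, s + k ∈ I) :
    Z.LeftOn (fun s => z (s + k)) J := fun s hs =>
  ⟨(h _ (hJ s hs)).1, (h _ (hJ s hs)).2.comp_add_const s k⟩

lemma StepsFrom.shift (k : ℝ) (h : Z.StepsFrom z (t + k) ε) :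
    Z.StepsFrom (fun s => z (s + k)) t ε := by
  have h1 : ∀ s ∈ Ico t (t + ε), s + k ∈ Ico (t + k) (t + k + ε) := fun s hs =>
    ⟨by linarith [hs.1], by linarith [hs.2]⟩
  have h2 : ∀ s ∈ Ioo t (t + ε), s + k ∈ Ioo (t + k) (t + k + ε) := fun s hs =>
    ⟨by linarith [hs.1], by linarith [hs.2]⟩
  exact h.imp (fun h => ⟨h.1, h.2.shift k h1⟩)
    (fun h => ⟨h.1, h.2.imp (fun h => h.shift k h2) fun h => h.shift k h2⟩)

lemma SlidesOn.canSlide (h : Z.SlidesOn z (Ico a b)) (ht : t ∈ Ico a b) : Z.CanSlide (z t) :=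
  ⟨b - t, by linarith [ht.2], fun s => z (s + t), by simp, h.shift t fun s hs =>
    ⟨by linarith [hs.1, ht.1], by linarith [hs.2]⟩⟩

lemma CanSlide.mem (h : Z.CanSlide p) : p ∈ Z.sliding := by
  obtain ⟨ε, hε, w, rfl, hw⟩ := h
  exact (hw 0 ⟨le_rfl, hε⟩).1

lemma SlidesOn.hasDerivWithinAt (h : Z.SlidesOn z (Ico a b)) (ht : t ∈ Ico a b) :
    HasDerivWithinAt z (Z.slidingField (z t)) (Ici t) t :=
  (h t ht).2.mono_of_mem_nhdsWithin
    (mem_of_superset (Ico_mem_nhdsGE ht.2) (Ico_subset_Ico ht.1 le_rfl))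

lemma Nonsingular.hasDerivWithinAt_of_slides (hZ : Z.Nonsingular) (hp : z t ∈ Z.sliding)
    {s : Set ℝ} (h : HasDerivWithinAt z (Z.slidingField (z t)) s t) :
    HasDerivWithinAt (fun t => z t 1) (Z.scalarField (z t 1)) s t := by
  have := hasDerivWithinAt_one h
  rwa [hZ.slidingField hp, eq_onLine hp.1] at this

lemma SlidesOn.rightSol (hZ : Z.Nonsingular) (h : Z.SlidesOn z (Icc a b)) :
    RightSol Z.scalarField (fun t => z t 1) a b :=
  ⟨fun t ht => (hZ.hasDerivWithinAt_of_slides (h t ht).1 (h t ht).2).continuousWithinAt,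
   fun t ht => (hZ.hasDerivWithinAt_of_slides (h t ⟨ht.1, ht.2.le⟩).1
    (h t ⟨ht.1, ht.2.le⟩).2).Ici_of_Icc ht⟩

/-- Picard–Lindelöf solves the scalar sliding equation near `y₀`. What remains, and is left as a
hypothesis, is that solutions stay in the sliding region for a short time. -/
lemma canSlide_of_solution {y₀ : ℝ} (hne : Z.fm (onLine y₀) 0 ≠ Z.fp (onLine y₀) 0)
    (h : ∀ y : ℝ → ℝ, y 0 = y₀ → HasDerivAt y (Z.scalarField y₀) 0 →
      ∀ᶠ t in 𝓝[>] 0, Z.normalProd (y t) ≤ 0) (h0 : Z.normalProd y₀ ≤ 0) :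
    Z.CanSlide (onLine y₀) := by
  obtain ⟨y, hy0, ε, hε, hy⟩ := ContDiffAt.exists_forall_mem_closedBall_exists_eq_forall_mem_Ioo_hasDerivAt₀
    (contDiffAt_scalarField hne) 0
  simp only [zero_sub, zero_add] at hy
  have hd0 := hy 0 ⟨by linarith, hε⟩
  rw [hy0] at hd0
  have h1 := h y hy0 hd0
  have hev : ∀ᶠ t in 𝓝[>] (0 : ℝ), Z.fm (onLine (y t)) 0 ≠ Z.fp (onLine (y t)) 0 := by
    have hc : ContinuousAt (fun t => Z.fm (onLine (y t)) 0 - Z.fp (onLine (y t)) 0) 0 := by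
      simp only [fp_onLine_zero, fm_onLine_zero]
      have := hd0.continuousAt
      fun_prop
    have hc' : ∀ᶠ t in 𝓝 (0 : ℝ), Z.fm (onLine (y t)) 0 - Z.fp (onLine (y t)) 0 ≠ 0 :=
      hc.eventually_ne (by rw [hy0]; exact sub_ne_zero.2 hne)
    exact nhdsWithin_le_nhds (hc'.mono fun t ht => sub_ne_zero.1 ht)
  obtain ⟨δ, hδ, hδ'⟩ := mem_nhdsGT_iff_exists_Ioo_subset.1
    (inter_mem (h1.and hev) (Ioo_mem_nhdsGT hε))
  have hall : ∀ t ∈ Ico 0 δ, Z.normalProd (y t) ≤ 0 ∧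
      Z.fm (onLine (y t)) 0 ≠ Z.fp (onLine (y t)) 0 ∧ t < ε := fun t ht => by
    rcases ht.1.eq_or_lt with rfl | hlt
    · rw [hy0]; exact ⟨h0, hne, hε⟩
    · obtain ⟨⟨h2, h3⟩, h4⟩ := hδ' ⟨hlt, ht.2⟩
      exact ⟨h2, h3, h4.2⟩
  refine ⟨δ, hδ, fun t => onLine (y t), congrArg onLine hy0, fun t ht => ?_⟩
  obtain ⟨h2, h3, h4⟩ := hall t ht
  refine ⟨onLine_mem_sliding.2 h2, ?_⟩
  rw [slidingField_of_ne h3, convexField_onLine]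
  refine hasDerivWithinAt_pi.2 fun i => ?_
  fin_cases i
  · exact hasDerivWithinAt_const _ _ _
  · exact (hy t ⟨by linarith [ht.1], h4⟩).hasDerivWithinAt

lemma canSlide_of_neg (h : Z.normalProd y < 0) : Z.CanSlide (onLine y) := by
  refine canSlide_of_solution (fun he => ?_) (fun u hu hd => ?_) h.le
  · rw [normalProd, he] at h; nlinarith [mul_self_nonneg (Z.fp (onLine y) 0)]
  · have hc : ContinuousAt (fun t => Z.normalProd (u t)) 0 :=
      Z.continuous_normalProd.continuousAt.comp hd.continuousAt
    exact nhdsWithin_le_nhds ((hc.eventually_lt_const (by simpa only [hu] using h)).mono fun t ht => ht.le)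

lemma _root_.HasDerivWithinAt.eventually_neg {f : ℝ → ℝ} {d : ℝ} (h : HasDerivWithinAt f d (Ici t) t)
    (h0 : f t = 0) (hd : d < 0) : ∀ᶠ s in 𝓝[>] t, f s < 0 := by
  have h1 := (hasDerivWithinAt_iff_tendsto_slope' (by simp)).1 h.Ioi_of_Ici
  filter_upwards [h1.eventually_lt_const hd, self_mem_nhdsWithin] with s hs hts
  rw [slope_def_field, div_neg_iff, h0] at hs
  rcases hs with h | h
  · linarith [h.2, mem_Ioi.1 hts]
  · linarith [h.1]

/-- The rate of change of the normal product along the sliding field. -/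
noncomputable def inwardRate (Z : PWLSystem) (y : ℝ) : ℝ :=
  (Z.Ap 0 1 * Z.fm (onLine y) 0 + Z.fp (onLine y) 0 * Z.Am 0 1) * Z.scalarField y

/-- At a boundary point of the sliding region, a negative derivative of the normal product along the
sliding field carries the solution into the region. -/
lemma canSlide_of_inward (hZ : Z.Nonsingular) (h0 : Z.normalProd y = 0)
    (h : Z.inwardRate y < 0) : Z.CanSlide (onLine y) := by
  refine canSlide_of_solution (hZ.ne h0.le) (fun u hu hd => ?_) h0.le
  have h1 : HasDerivAt (fun t => Z.normalProd (u t)) (Z.inwardRate y) 0 :=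
    HasDerivAt.comp (h₂ := Z.normalProd) 0 (by rw [hu]; exact Z.hasDerivAt_normalProd y) hd
  exact (h1.hasDerivWithinAt.eventually_neg (by rw [hu, h0]) h).mono fun t ht => ht.le

/-- Along any candidate sliding solution the normal product would become positive at once. -/
lemma not_canSlide_of_outward (hZ : Z.Nonsingular) (h0 : Z.normalProd y = 0)
    (h : 0 < Z.inwardRate y) : ¬ Z.CanSlide (onLine y) := by
  rintro ⟨ε, hε, w, hw0, hw⟩
  have h1 := hZ.hasDerivWithinAt_of_slides (hw 0 ⟨le_rfl, hε⟩).1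
    (hw.hasDerivWithinAt ⟨le_rfl, hε⟩)
  rw [hw0, onLine_one] at h1
  have h2 : HasDerivWithinAt (fun t => -Z.normalProd (w t 1)) (-Z.inwardRate y) (Ici 0) 0 :=
    (HasDerivAt.comp_hasDerivWithinAt (h₂ := Z.normalProd) 0
      (by rw [hw0]; exact Z.hasDerivAt_normalProd y) h1).neg
  have h3 := h2.eventually_neg (by simp [hw0, h0]) (by linarith)
  obtain ⟨s, hs, hs'⟩ := (h3.and (Ioo_mem_nhdsGT hε)).exists
  have h4 := (hw s ⟨hs'.1.le, hs'.2⟩).1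
  rw [eq_onLine h4.1, onLine_mem_sliding] at h4
  linarith

/-- At a tangency point the sliding field is the tangent field itself. The factor `Z.Ap 0 1 * Z.fp
(onLine y) 1` is then the second derivative of `x` along its orbit, which is positive at a visible
tangency. -/
lemma inwardRate_of_fp_eq_zero (h : Z.fp (onLine y) 0 = 0) (h' : Z.fm (onLine y) 0 ≠ 0) :
    Z.inwardRate y = Z.fm (onLine y) 0 * (Z.Ap 0 1 * Z.fp (onLine y) 1) := by
  rw [inwardRate, scalarField_of_fp_eq_zero h h', h]; ring

lemma inwardRate_of_fm_eq_zero (h : Z.fm (onLine y) 0 = 0) (h' : Z.fp (onLine y) 0 ≠ 0) :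
    Z.inwardRate y = Z.fp (onLine y) 0 * (Z.Am 0 1 * Z.fm (onLine y) 1) := by
  rw [inwardRate, scalarField_of_fm_eq_zero h h', h]; ring

/-! ### Starting into an open half plane -/

/-- A solution starts at `p` into the right half plane. -/
def RightStart (Z : PWLSystem) (p : Plane) : Prop :=
  ∃ ε > 0, ∃ w : ℝ → Plane, w 0 = p ∧ ContinuousOn w (Icc 0 ε) ∧ Z.RightOn w (Ioo 0 ε)

/-- A solution starts at `p` into the left half plane. -/
def LeftStart (Z : PWLSystem) (p : Plane) : Prop :=
  ∃ ε > 0, ∃ w : ℝ → Plane, w 0 = p ∧ ContinuousOn w (Icc 0 ε) ∧ Z.LeftOn w (Ioo 0 ε)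

lemma RightOn.rightStart (hz : Continuous z) (hε : 0 < ε) (h : Z.RightOn z (Ioo t (t + ε))) :
    Z.RightStart (z t) :=
  ⟨ε, hε, fun s => z (s + t), by simp, (hz.comp (by fun_prop)).continuousOn,
    h.shift t fun s hs => ⟨by linarith [hs.1], by linarith [hs.2]⟩⟩

lemma LeftOn.leftStart (hz : Continuous z) (hε : 0 < ε) (h : Z.LeftOn z (Ioo t (t + ε))) :
    Z.LeftStart (z t) :=
  ⟨ε, hε, fun s => z (s + t), by simp, (hz.comp (by fun_prop)).continuousOn,
    h.shift t fun s hs => ⟨by linarith [hs.1], by linarith [hs.2]⟩⟩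

lemma rot_fp_neg (Z : PWLSystem) (z : Plane) : Z.rot.fp (-z) = -Z.fm z := (Z.rot_isSwap z).2.1
lemma rot_fm_neg (Z : PWLSystem) (z : Plane) : Z.rot.fm (-z) = -Z.fp z := (Z.rot_isSwap z).2.2

lemma rot_fp_onLine (Z : PWLSystem) (y : ℝ) : Z.rot.fp (onLine y) = -Z.fm (onLine (-y)) := by
  rw [← rot_fp_neg, neg_onLine, neg_neg]

lemma rot_fm_onLine (Z : PWLSystem) (y : ℝ) : Z.rot.fm (onLine y) = -Z.fp (onLine (-y)) := by
  rw [← rot_fm_neg, neg_onLine, neg_neg]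

lemma LeftStart.rot (h : Z.LeftStart p) : Z.rot.RightStart (-p) := by
  obtain ⟨ε, hε, w, rfl, hc, hw⟩ := h
  exact ⟨ε, hε, fun t => -w t, rfl, hc.neg, Z.rot_isSwap.rightOn hw⟩

/-- The constant term of the second order equation of `x` in the right half plane. -/
def forcing (Z : PWLSystem) : ℝ := Z.Ap 0 1 * Z.bp 1 - Z.Ap 1 1 * Z.bp 0

lemma RightOn.scalarSol {T : ℝ} (hT : 0 < T) (hc : ContinuousOn w (Icc 0 T)) (h0 : w 0 0 = 0)
    (hw : Z.RightOn w (Ioo 0 T)) :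
    ScalarSol (Z.Ap 0 0 + Z.Ap 1 1) Z.Ap.det Z.forcing (fun t => w t 0) (fun t => Z.fp (w t) 0) T where
  pos := hT
  cx := (continuous_apply 0).comp_continuousOn hc
  cu := ((continuous_apply 0).comp Z.continuous_fp).comp_continuousOn hc
  hx t ht := hasDerivAt_pi.1 (hw t ht).2 0
  hu t ht := by
    have h0 := hasDerivAt_pi.1 (hw t ht).2 0
    have h1 := hasDerivAt_pi.1 (hw t ht).2 1
    have := ((h0.const_mul (Z.Ap 0 0)).add (h1.const_mul (Z.Ap 0 1))).add_const (Z.bp 0)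
    simp only [fp_zero]
    refine this.congr_deriv ?_
    rw [Matrix.det_fin_two, forcing, fp_one, fp_zero]; ring
  x0 := h0

lemma RightStart.nonneg (h : Z.RightStart p) (hp : p ∈ switchLine) : 0 ≤ Z.fp p 0 := by
  obtain ⟨ε, hε, w, rfl, hc, hw⟩ := h
  exact (hw.scalarSol hε hc hp).u0_nonneg fun t ht => (hw t ht).1

/-- At a tangency point `x` and `x'` vanish, so the constant term of the second order equation is
the value of `x''`. -/
lemma forcing_eq (hp : p ∈ switchLine) (h0 : Z.fp p 0 = 0) :
    Z.forcing = Z.Ap 0 1 * Z.fp p 1 := by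
  have hp : p 0 = 0 := hp
  rw [fp_zero, hp] at h0
  rw [fp_one, hp, forcing]
  linear_combination (-Z.Ap 1 1) * h0

lemma RightStart.tangent (hd : Z.Ap.det ≠ 0) (h : Z.RightStart p) (hp : p ∈ switchLine)
    (h0 : Z.fp p 0 = 0) : 0 < Z.Ap 0 1 * Z.fp p 1 := by
  rw [← forcing_eq hp h0]
  obtain ⟨ε, hε, w, rfl, hc, hw⟩ := h
  exact (hw.scalarSol hε hc hp).forcing_pos hd (fun t ht => (hw t ht).1) h0

lemma LeftStart.nonpos (h : Z.LeftStart p) (hp : p ∈ switchLine) : Z.fm p 0 ≤ 0 := by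
  have := h.rot.nonneg (by simpa [switchLine] using hp)
  rw [rot_fp_neg, Pi.neg_apply] at this; linarith

lemma LeftStart.tangent (hd : Z.Am.det ≠ 0) (h : Z.LeftStart p) (hp : p ∈ switchLine)
    (h0 : Z.fm p 0 = 0) : Z.Am 0 1 * Z.fm p 1 < 0 := by
  have := h.rot.tangent hd (by simpa [switchLine] using hp) (by simp [rot_fp_neg, h0])
  rw [rot_fp_neg, Pi.neg_apply] at this
  change 0 < Z.Am 0 1 * _ at this
  linarith

/-- Both fields leave the line here, the right one possibly tangentially. Either the normal product
is negative, or the tangency is visible and makes the sliding field point into the sliding region.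
-/
lemma canSlide_of_rightStart (hN : Z.Nondegenerate) (hZ : Z.Nonsingular)
    (h : Z.RightStart (onLine y)) (h' : Z.fm (onLine y) 0 < 0) : Z.CanSlide (onLine y) := by
  rcases (h.nonneg (onLine_mem y)).eq_or_lt with h0 | h0
  · have h1 := h.tangent hN.1 (onLine_mem y) h0.symm
    refine canSlide_of_inward hZ (by rw [normalProd, ← h0, zero_mul]) ?_
    rw [inwardRate_of_fp_eq_zero h0.symm h'.ne]
    exact mul_neg_of_neg_of_pos h' h1
  · exact canSlide_of_neg (mul_neg_of_pos_of_neg h0 h')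

lemma canSlide_of_leftStart (hN : Z.Nondegenerate) (hZ : Z.Nonsingular)
    (h : Z.LeftStart (onLine y)) (h' : 0 < Z.fp (onLine y) 0) : Z.CanSlide (onLine y) := by
  rcases (h.nonpos (onLine_mem y)).eq_or_lt with h0 | h0
  · have h1 := h.tangent hN.2 (onLine_mem y) h0
    refine canSlide_of_inward hZ (by rw [normalProd, h0, mul_zero]) ?_
    rw [inwardRate_of_fm_eq_zero h0 h'.ne']
    exact mul_neg_of_pos_of_neg h' h1
  · exact canSlide_of_neg (mul_neg_of_pos_of_neg h' h0)

/-- There is no choice between the two half planes. -/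
lemma canSlide_of_rightStart_of_leftStart (hN : Z.Nondegenerate) (hZ : Z.Nonsingular)
    (hr : Z.RightStart p) (hl : Z.LeftStart p) (hp : p ∈ switchLine) : Z.CanSlide p := by
  obtain ⟨y, rfl⟩ : ∃ y, p = onLine y := ⟨_, eq_onLine hp⟩
  rcases (hl.nonpos hp).eq_or_lt with h0 | h0
  · refine canSlide_of_leftStart hN hZ hl ((hr.nonneg hp).lt_of_ne fun h1 => hZ _ h1.symm h0)
  · exact canSlide_of_rightStart hN hZ hr h0

/-! ### Forward uniqueness -/

/-- Agreement is claimed only for a short time, because `g` is known to be Lipschitz only near the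
initial value. -/
lemma eqOn_of_rightSol {g u v : ℝ → ℝ} (hg : ContDiffAt ℝ 1 g (u a)) (hab : a < b)
    (hu : RightSol g u a b) (hv : RightSol g v a b) (h0 : u a = v a) :
    ∃ c ∈ Ioo a b, ∀ t ∈ Icc a c, u t = v t := by
  obtain ⟨K, s, hs, hl⟩ := hg.exists_lipschitzOnWith
  have h1 : ∀ᶠ t in 𝓝[≥] a, u t ∈ s ∧ v t ∈ s := by
    have hcu : ContinuousWithinAt u (Ici a) a :=
      (hu.1 a ⟨le_rfl, hab.le⟩).mono_of_mem_nhdsWithin (Icc_mem_nhdsGE hab)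
    have hcv : ContinuousWithinAt v (Ici a) a :=
      (hv.1 a ⟨le_rfl, hab.le⟩).mono_of_mem_nhdsWithin (Icc_mem_nhdsGE hab)
    exact (hcu.eventually_mem hs).and (hcv.eventually_mem (by rwa [← h0]))
  obtain ⟨c, hc, hsub⟩ := (mem_nhdsGE_iff_exists_mem_Ioc_Ico_subset hab).1 h1
  obtain ⟨c', hc1, hc2⟩ := exists_between hc.1
  refine ⟨c', ⟨hc1, hc2.trans_le hc.2⟩, ?_⟩
  have hub := hu.mono le_rfl (hc2.le.trans hc.2)
  have hvb := hv.mono le_rfl (hc2.le.trans hc.2)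
  exact ODE_solution_unique_of_mem_Icc_right (v := fun _ => g) (s := fun _ => s) (K := K)
    (fun _ _ => hl) hub.1 hub.2 (fun t ht => (hsub ⟨ht.1, ht.2.trans hc2⟩).1)
    hvb.1 hvb.2 (fun t ht => (hsub ⟨ht.1, ht.2.trans hc2⟩).2) h0

lemma eqOn_of_rightOn (hz : ContinuousOn z (Icc a b)) (hw : ContinuousOn w (Icc a b))
    (hzr : Z.RightOn z (Ioo a b)) (hwr : Z.RightOn w (Ioo a b)) (h0 : z a = w a) :
    ∀ t ∈ Icc a b, z t = w t := by
  obtain ⟨K, hK⟩ := Z.exists_lipschitz_fp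
  exact ODE_solution_unique_of_mem_Icc_right (v := fun _ => Z.fp) (s := fun _ => univ) (K := K)
    (fun _ _ => hK.lipschitzOnWith) hz
    (fun t ht => (hasDerivWithinAt_Icc_of_Ioo hz (Z.continuous_fp.comp_continuousOn hz)
      (fun s hs => (hzr s hs).2) t ⟨ht.1, ht.2.le⟩).Ici_of_Icc ht) (fun _ _ => mem_univ _) hw
    (fun t ht => (hasDerivWithinAt_Icc_of_Ioo hw (Z.continuous_fp.comp_continuousOn hw)
      (fun s hs => (hwr s hs).2) t ⟨ht.1, ht.2.le⟩).Ici_of_Icc ht) (fun _ _ => mem_univ _) h0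

lemma eqOn_of_leftOn (hz : ContinuousOn z (Icc a b)) (hw : ContinuousOn w (Icc a b))
    (hzr : Z.LeftOn z (Ioo a b)) (hwr : Z.LeftOn w (Ioo a b)) (h0 : z a = w a) :
    ∀ t ∈ Icc a b, z t = w t := fun t ht => neg_injective <|
  eqOn_of_rightOn (Z := Z.rot) hz.neg hw.neg (Z.rot_isSwap.rightOn hzr) (Z.rot_isSwap.rightOn hwr)
    (congrArg Neg.neg h0) t ht

lemma eqOn_of_slidesOn (hZ : Z.Nonsingular) (hab : a < b) (hz : Z.SlidesOn z (Icc a b))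
    (hw : Z.SlidesOn w (Icc a b)) (h0 : z a = w a) : ∃ c ∈ Ioo a b, ∀ t ∈ Icc a c, z t = w t := by
  have hsl := (hz a ⟨le_rfl, hab.le⟩).1
  obtain ⟨c, hc, h⟩ := eqOn_of_rightSol (g := Z.scalarField) (contDiffAt_scalarField
    (hZ.ne (onLine_mem_sliding.1 (by rw [← eq_onLine hsl.1]; exact hsl)))) hab (hz.rightSol hZ)
    (hw.rightSol hZ) (by rw [h0])
  refine ⟨c, hc, fun t ht => ?_⟩
  have ht' : t ∈ Icc a b := ⟨ht.1, ht.2.trans hc.2.le⟩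
  exact plane_ext ((hz t ht').1.1.trans (hw t ht').1.1.symm) (h t ht)

lemma StepsFrom.mono (h : Z.StepsFrom z t ε) {δ : ℝ} (hδ : δ ≤ ε) : Z.StepsFrom z t δ :=
  h.imp (fun h => ⟨h.1, h.2.mono (Ico_subset_Ico le_rfl (by linarith))⟩)
    (fun h => ⟨h.1, h.2.imp (fun h s hs => h s ⟨hs.1, by linarith [hs.2]⟩)
      (fun h s hs => h s ⟨hs.1, by linarith [hs.2]⟩)⟩)

/-- By continuity the common starting point lies on the switching line. Starts into both half planes
then make sliding possible. -/
lemma not_rightOn_leftOn (hz : Continuous z) (hw : Continuous w) (hN : Z.Nondegenerate)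
    (hZ : Z.Nonsingular) (hε : 0 < ε) (hs : ¬ Z.CanSlide (z t))
    (h1 : Z.RightOn z (Ioo t (t + ε))) (h2 : Z.LeftOn w (Ioo t (t + ε))) (h0 : z t = w t) :
    False := by
  have hne : (𝓝[Ioo t (t + ε)] t).NeBot := by
    rw [nhdsWithin_Ioo_eq_nhdsGT (by linarith)]; infer_instance
  have e1 : 0 ≤ z t 0 := ge_of_tendsto
    (((continuous_apply 0).comp hz).continuousWithinAt (s := Ioo t (t + ε)) (x := t))
    (eventually_mem_nhdsWithin.mono fun s hs => (h1 s hs).1.le)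
  have e2 : w t 0 ≤ 0 := le_of_tendsto
    (((continuous_apply 0).comp hw).continuousWithinAt (s := Ioo t (t + ε)) (x := t))
    (eventually_mem_nhdsWithin.mono fun s hs => (h2 s hs).1.le)
  rw [← h0] at e2
  have h3 := h2.leftStart hw hε
  rw [← h0] at h3
  exact hs (canSlide_of_rightStart_of_leftStart hN hZ (h1.rightStart hz hε) h3 (le_antisymm e2 e1))

lemma StepsFrom.eq_right (hN : Z.Nondegenerate) (hZ : Z.Nonsingular) (hz : Continuous z)
    (hw : Continuous w) (hε : 0 < ε) (h1 : Z.StepsFrom z t ε) (h2 : Z.StepsFrom w t ε)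
    (h0 : z t = w t) : ∃ c ∈ Ioo t (t + ε), ∀ s ∈ Icc t c, z s = w s := by
  have hm : t + ε / 2 ∈ Ioo t (t + ε) := ⟨by linarith, by linarith⟩
  rcases h1 with ⟨hc1, h1⟩ | ⟨hc1, h1⟩ <;> rcases h2 with ⟨hc2, h2⟩ | ⟨hc2, h2⟩
  · have hsub : Icc t (t + ε / 2) ⊆ Ico t (t + ε) := fun s hs => ⟨hs.1, by linarith [hs.2]⟩
    obtain ⟨c, hc, h⟩ := eqOn_of_slidesOn hZ (by linarith) (h1.mono hsub) (h2.mono hsub) h0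
    exact ⟨c, ⟨hc.1, by linarith [hc.2]⟩, h⟩
  · rw [h0] at hc1; exact absurd hc1 hc2
  · rw [h0] at hc1; exact absurd hc2 hc1
  · rcases h1 with h1 | h1 <;> rcases h2 with h2 | h2
    · exact ⟨_, hm, fun s hs => eqOn_of_rightOn hz.continuousOn hw.continuousOn h1 h2 h0 s
        ⟨hs.1, hs.2.trans hm.2.le⟩⟩
    · exact (not_rightOn_leftOn hz hw hN hZ hε hc1 h1 h2 h0).elim
    · exact (not_rightOn_leftOn hw hz hN hZ hε hc2 h2 h1 h0.symm).elim
    · exact ⟨_, hm, fun s hs => eqOn_of_leftOn hz.continuousOn hw.continuousOn h1 h2 h0 s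
        ⟨hs.1, hs.2.trans hm.2.le⟩⟩

/-- A continuous curve that is a forward solution from each of its points. -/
structure IsFlow (Z : PWLSystem) (z : ℝ → Plane) : Prop where
  cont : Continuous z
  steps : ∀ t, ∃ ε > 0, Z.StepsFrom z t ε

lemma IsFlow.shift (h : Z.IsFlow z) (k : ℝ) : Z.IsFlow (fun s => z (s + k)) :=
  ⟨h.cont.comp (by fun_prop), fun t => by
    obtain ⟨ε, hε, hs⟩ := h.steps (t + k)
    exact ⟨ε, hε, hs.shift k⟩⟩

/-- The times of agreement form a closed set, so a failure would follow a last time of agreement;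
local uniqueness of the step taken there extends the agreement beyond it. -/
lemma IsFlow.eq_of_eq (hN : Z.Nondegenerate) (hZ : Z.Nonsingular) (hz : Z.IsFlow z)
    (hw : Z.IsFlow w) (h0 : z a = w a) : ∀ t ≥ a, z t = w t := by
  intro s hs
  by_contra hne
  have hK : IsCompact ({t | z t = w t} ∩ Icc a s) :=
    isCompact_Icc.inter_left (isClosed_eq hz.cont hw.cont)
  obtain ⟨t, ht, hmax⟩ := hK.exists_isGreatest ⟨a, h0, le_rfl, hs⟩
  have hts : t < s := ht.2.2.lt_of_ne fun he => hne (he ▸ ht.1)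
  obtain ⟨ε₁, hε₁, h1⟩ := hz.steps t
  obtain ⟨ε₂, hε₂, h2⟩ := hw.steps t
  have hε : 0 < min (min ε₁ ε₂) (s - t) := lt_min (lt_min hε₁ hε₂) (by linarith)
  obtain ⟨c, hc, h⟩ := (h1.mono ((min_le_left _ _).trans (min_le_left _ _))).eq_right hN hZ
    hz.cont hw.cont hε (h2.mono ((min_le_left _ _).trans (min_le_right _ _))) ht.1
  have hcs : c ≤ s := by linarith [hc.2, min_le_right (min ε₁ ε₂) (s - t)]
  exact absurd (hmax ⟨h c ⟨hc.1.le, le_rfl⟩, ht.2.1.trans hc.1.le, hcs⟩) (not_le.2 hc.1)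

end PWLSystem

/-! ### Comparison of solutions of the scalar sliding equation -/

lemma RightSol.shift {g y : ℝ → ℝ} {a b : ℝ} (k : ℝ) (h : RightSol g y (a + k) (b + k)) :
    RightSol g (fun s => y (s + k)) a b := by
  refine ⟨h.1.comp (by fun_prop) fun t ht => ⟨by linarith [ht.1], by linarith [ht.2]⟩,
    fun t ht => ?_⟩
  have h1 : HasDerivWithinAt (fun s : ℝ => s + k) 1 (Ici t) t :=
    ((hasDerivAt_id t).add_const k).hasDerivWithinAt
  have h2 := (h.2 (t + k) ⟨by linarith [ht.1], by linarith [ht.2]⟩).comp t h1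
    (fun s hs => by simpa using hs)
  simpa [Function.comp_def] using h2

/-- If one solution descends from `u a` and another one climbs from `v c`, passing the same
points, then the second one starts above the first one. -/
lemma RightSol.lt_of_down_of_up {g u v : ℝ → ℝ} {a b c d : ℝ} (hu : RightSol g u a b)
    (hab : a ≤ b) (hv : RightSol g v c d) (hcd : c ≤ d) (hg : ContDiffAt ℝ 1 g (u a))
    (h1 : u b < u a) (h2 : v c < v d) (h3 : u b ≤ v c) (h4 : u a ≤ v d) : u a < v c := by
  by_contra hle
  rcases (not_lt.1 hle).eq_or_lt with heq | hlt
  · obtain ⟨s, hs, hs1, hs2⟩ := last_time hcd hv.1 heq.le (heq ▸ h2 : u a < v d)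
    obtain ⟨t, ht, ht1, ht2⟩ := last_time (y := fun t => -u t) hab hu.1.neg le_rfl
      (neg_lt_neg h1)
    have hu' := (hu.mono ht.1 le_rfl)
    have hr : 0 < min (b - t) (d - s) := lt_min (by linarith [ht.2]) (by linarith [hs.2])
    have e1 : RightSol g (fun r => u (r + t)) 0 (min (b - t) (d - s)) :=
      RightSol.shift t (hu.mono (by linarith [ht.1]) (by linarith [min_le_left (b - t) (d - s)]))
    have e2 : RightSol g (fun r => v (r + s)) 0 (min (b - t) (d - s)) :=
      RightSol.shift s (hv.mono (by linarith [hs.1]) (by linarith [min_le_right (b - t) (d - s)]))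
    have ht1' : u t = u a := by linarith
    obtain ⟨r, hr1, hr2⟩ := PWLSystem.eqOn_of_rightSol (by simpa [ht1'] using hg) hr e1 e2
      (by simp [ht1', hs1])
    have e3 := hr2 r ⟨hr1.1.le, le_rfl⟩
    have e4 := ht2 (r + t) ⟨by linarith [hr1.1], by
      linarith [hr1.2, min_le_left (b - t) (d - s)]⟩
    have e5 := hs2 (r + s) ⟨by linarith [hr1.1], by
      linarith [hr1.2, min_le_right (b - t) (d - s)]⟩
    linarith
  · exact hv.not_up_down hcd hu hab hlt le_rfl h4 le_rfl h3

/-- A solution cannot overshoot the interval between its end values, since it would have to come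
back through the same points. -/
lemma RightSol.image_eq {g y : ℝ → ℝ} {a b : ℝ} (h : RightSol g y a b) (hab : a ≤ b) :
    y '' Icc a b = uIcc (y a) (y b) := by
  apply Subset.antisymm
  · rintro _ ⟨t, ht, rfl⟩
    have h1 := h.mono le_rfl ht.2
    have h2 := h.mono ht.1 le_rfl
    constructor
    · by_contra hlt
      have hlt := not_le.1 hlt
      exact h2.not_up_down ht.2 h1 ht.1 hlt le_rfl inf_le_right inf_le_left le_rfl
    · by_contra hlt
      have hlt := not_le.1 hlt
      exact h1.not_up_down ht.1 h2 ht.2 hlt le_sup_left le_rfl le_rfl le_sup_right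
  · have := intermediate_value_uIcc (f := y) (a := a) (b := b) (by rw [uIcc_of_le hab]; exact h.1)
    rwa [uIcc_of_le hab] at this

namespace PWLSystem

variable {Z : PWLSystem} {z w : ℝ → Plane} {p q : Plane} {a b t T : ℝ} {C : Set Plane}

/-! ### Cycles and their phases -/

/-- A nonconstant periodic forward solution with a sliding segment. -/
structure Cycle (Z : PWLSystem) (z : ℝ → Plane) (T : ℝ) : Prop extends IsFlow Z z where
  Tpos : 0 < T
  per : Function.Periodic z T
  nonconst : ∃ s t, z s ≠ z t
  slides : ∃ a b, a < b ∧ ∀ t ∈ Icc a b, z t ∈ Z.sliding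

lemma isForwardSlidingPeriodicOrbit_iff {γ : Set Plane} :
    Z.IsForwardSlidingPeriodicOrbit γ ↔ ∃ z T, Z.Cycle z T ∧ γ = range z := by
  constructor
  · rintro ⟨z, T, hT, hc, hp, hs, hn, hsl, rfl⟩
    exact ⟨z, T, ⟨⟨hc, hs⟩, hT, hp, hn, hsl⟩, rfl⟩
  · rintro ⟨z, T, h, rfl⟩
    exact ⟨z, T, h.Tpos, h.cont, h.per, h.steps, h.nonconst, h.slides, rfl⟩

lemma Cycle.rot (h : Z.Cycle z T) : Z.rot.Cycle (fun t => -z t) T where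
  cont := h.cont.neg
  steps t := by
    obtain ⟨ε, hε, hs⟩ := h.steps t
    exact ⟨ε, hε, IsConj.stepsFrom (Or.inr Z.rot_isSwap) hs⟩
  Tpos := h.Tpos
  per t := congrArg Neg.neg (h.per t)
  nonconst := by
    obtain ⟨s, t, hst⟩ := h.nonconst
    exact ⟨s, t, fun he => hst (neg_injective he)⟩
  slides := by
    obtain ⟨a, b, hab, hs⟩ := h.slides
    exact ⟨a, b, hab, fun t ht => (IsConj.mem_sliding (Or.inr Z.rot_isSwap) (z t)).2 (hs t ht)⟩

lemma rot_canSlide : Z.rot.CanSlide (-p) ↔ Z.CanSlide p :=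
  IsConj.canSlide_iff (Or.inr Z.rot_isSwap)

lemma rot_canSlide_onLine {y : ℝ} : Z.rot.CanSlide (onLine y) ↔ Z.CanSlide (onLine (-y)) := by
  rw [← rot_canSlide (Z := Z), neg_onLine, neg_neg]

lemma IsFlow.slides_of_canSlide (h : Z.IsFlow z) (hs : Z.CanSlide (z t)) :
    ∃ ε > 0, Z.SlidesOn z (Ico t (t + ε)) := by
  obtain ⟨ε, hε, h1 | h1⟩ := h.steps t
  · exact ⟨ε, hε, h1.2⟩
  · exact absurd hs h1.1

lemma IsFlow.start_of_not_canSlide (h : Z.IsFlow z) (hs : ¬ Z.CanSlide (z t)) :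
    (∃ ε > 0, Z.RightOn z (Ioo t (t + ε))) ∨ (∃ ε > 0, Z.LeftOn z (Ioo t (t + ε))) := by
  obtain ⟨ε, hε, h1 | ⟨-, h1 | h1⟩⟩ := h.steps t
  · exact absurd h1.1 hs
  · exact Or.inl ⟨ε, hε, h1⟩
  · exact Or.inr ⟨ε, hε, h1⟩

lemma IsFlow.canSlide_of_mem (h : Z.IsFlow z) 
    (hs : ∀ t ∈ Icc a b, z t ∈ Z.sliding) (ht : t ∈ Ico a b) : Z.CanSlide (z t) := by
  by_contra hn
  have key : ∀ ε > 0, ∃ s ∈ Ioo t (t + ε), z s 0 = 0 := fun ε hε => by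
    have h1 : t < min (t + ε) b := lt_min (by linarith) ht.2
    obtain ⟨s, hs1, hs2⟩ := exists_between h1
    exact ⟨s, ⟨hs1, hs2.trans_le (min_le_left _ _)⟩,
      (hs s ⟨ht.1.trans hs1.le, hs2.le.trans (min_le_right _ _)⟩).1⟩
  rcases h.start_of_not_canSlide hn with ⟨ε, hε, h1⟩ | ⟨ε, hε, h1⟩ <;>
    obtain ⟨s, hs1, hs2⟩ := key ε hε
  · exact (h1 s hs1).1.ne' hs2
  · exact (h1 s hs1).1.ne hs2

lemma Cycle.exists_canSlide (h : Z.Cycle z T) (s : ℝ) : ∃ t > s, Z.CanSlide (z t) := by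
  obtain ⟨a, b, hab, hs⟩ := h.slides
  obtain ⟨n, hn⟩ := exists_add_nat_mul_gt h.Tpos s a
  refine ⟨_, hn, ?_⟩
  rw [h.per.nat_mul n a]
  exact h.canSlide_of_mem hs ⟨le_rfl, hab⟩

/-- Periodicity spreads permanent sliding over all times. The second coordinate is then a periodic
solution of a scalar autonomous equation, hence constant. -/
lemma Cycle.exists_not_canSlide (h : Z.Cycle z T) (s : ℝ) : ∃ t > s, ¬ Z.CanSlide (z t) := by
  by_contra! hall
  have hall' : ∀ t, Z.CanSlide (z t) := fun t => by
    obtain ⟨n, hn⟩ := exists_add_nat_mul_gt h.Tpos s t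
    have := hall _ hn
    rwa [h.per.nat_mul n t] at this
  have hx : ∀ t, z t = onLine (z t 1) := fun t => eq_onLine (hall' t).mem.1
  have hd : ∀ t, HasDerivWithinAt (fun t => z t 1) (Z.slidingField (onLine (z t 1)) 1) (Ici t) t :=
    fun t => by
      obtain ⟨ε, hε, hs⟩ := h.slides_of_canSlide (hall' t)
      have := hasDerivWithinAt_one (hs.hasDerivWithinAt ⟨le_rfl, by linarith⟩)
      rwa [hx t] at this
  obtain ⟨u, v, huv⟩ := h.nonconst
  refine huv (plane_ext ((hall' u).mem.1.trans (hall' v).mem.1.symm) ?_)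
  exact RightSol.periodic_const (g := fun y => Z.slidingField (onLine y) 1) h.Tpos
    (fun t => congrFun (h.per t) 1) (fun a b =>
    ⟨((continuous_apply 1).comp h.cont).continuousOn, fun t _ => hd t⟩) u v

/-- The end is the infimum of the later times at which sliding is impossible. Since sliding, once
possible, lasts for a while, sliding is impossible at the infimum too; closedness keeps it in the
sliding region. -/
lemma Cycle.slide_phase (h : Z.Cycle z T) (hs : Z.CanSlide (z t)) :
    ∃ t' > t, ¬ Z.CanSlide (z t') ∧ z t' ∈ Z.sliding ∧ ∀ s ∈ Ico t t', Z.CanSlide (z s) := by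
  let N := {s | t ≤ s ∧ ¬ Z.CanSlide (z s)}
  obtain ⟨s₀, hs₀, hs₀'⟩ := h.exists_not_canSlide t
  have hne : N.Nonempty := ⟨s₀, hs₀.le, hs₀'⟩
  have hbd : BddBelow N := ⟨t, fun s hs => hs.1⟩
  have hbefore : ∀ s ∈ Ico t (sInf N), Z.CanSlide (z s) := fun s hs' => by
    by_contra hn
    exact absurd (csInf_le hbd ⟨hs'.1, hn⟩) (not_le.2 hs'.2)
  have hnot : ¬ Z.CanSlide (z (sInf N)) := fun hc => by
    obtain ⟨ε, hε, hsl⟩ := h.slides_of_canSlide hc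
    obtain ⟨s, hsN, hlt⟩ := exists_lt_of_csInf_lt hne (show sInf N < sInf N + ε by linarith)
    exact hsN.2 (hsl.canSlide ⟨csInf_le hbd hsN, hlt⟩)
  have hle : t ≤ sInf N := le_csInf hne fun s hs => hs.1
  have hlt : t < sInf N := hle.lt_of_ne fun he => hnot (he ▸ hs)
  refine ⟨sInf N, hlt, hnot, ?_, hbefore⟩
  have : (𝓝[Ico t (sInf N)] (sInf N)).NeBot := by
    rw [nhdsWithin_Ico_eq_nhdsLT hlt]; infer_instance
  exact Z.isClosed_sliding.mem_of_tendsto (h.cont.continuousWithinAt (s := Ico t (sInf N)))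
    (eventually_mem_nhdsWithin.mono fun s hs => (hbefore s hs).mem)

/-- The end point of a sliding phase lies in the sliding region, yet no sliding solution starts
there. -/
lemma no_cycle_of_canSlide (hall : ∀ p ∈ Z.sliding, Z.CanSlide p) (h : Z.Cycle z T) : False := by
  obtain ⟨t, -, ht⟩ := h.exists_canSlide 0
  obtain ⟨t', -, h1, h2, -⟩ := h.slide_phase ht
  exact h1 (hall _ h2)

/-- The stepping rule gives right derivatives only. Continuity of the sliding field along the curve
upgrades them to derivatives on the whole closed interval. -/
lemma IsFlow.slidesOn_Icc (hZ : Z.Nonsingular) (h : Z.IsFlow z) (hab : a < b)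
    (hs : ∀ s ∈ Ico a b, Z.CanSlide (z s)) : Z.SlidesOn z (Icc a b) := by
  have hmem : ∀ s ∈ Icc a b, z s ∈ Z.sliding := fun s hs' => by
    have : (𝓝[Ico a b] s).NeBot := by
      rw [← mem_closure_iff_nhdsWithin_neBot, closure_Ico hab.ne]; exact hs'
    exact Z.isClosed_sliding.mem_of_tendsto (h.cont.continuousWithinAt (s := Ico a b) (x := s))
      (eventually_mem_nhdsWithin.mono fun s hs' => (hs s hs').mem)
  have hne : ∀ s ∈ Icc a b, Z.fm (z s) 0 - Z.fp (z s) 0 ≠ 0 := fun s hs' => by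
    obtain ⟨y, hy⟩ : ∃ y, z s = onLine y := ⟨_, eq_onLine (hmem s hs').1⟩
    have := hmem s hs'
    rw [hy] at this ⊢
    exact sub_ne_zero.2 (hZ.ne (onLine_mem_sliding.1 this))
  have hc : ContinuousOn (fun s => Z.convexField (z s)) (Icc a b) := by
    have c1 : Continuous fun s => Z.fp (z s) := Z.continuous_fp.comp h.cont
    have c2 : Continuous fun s => Z.fm (z s) := Z.continuous_fm.comp h.cont
    have c3 : Continuous fun s => Z.fp (z s) 0 := (continuous_apply 0).comp c1
    have c4 : Continuous fun s => Z.fm (z s) 0 := (continuous_apply 0).comp c2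
    exact ((c4.sub c3).continuousOn.inv₀ hne).smul ((c4.smul c1).sub (c3.smul c2)).continuousOn
  have := hasDerivWithinAt_Icc_of_right h.cont.continuousOn hc fun s hs' => by
    obtain ⟨ε, hε, hsl⟩ := h.slides_of_canSlide (hs s hs')
    rw [← hZ.slidingField (hmem s ⟨hs'.1, hs'.2.le⟩)]
    exact hsl.hasDerivWithinAt ⟨le_rfl, by linarith⟩
  intro s hs'
  refine ⟨hmem s hs', ?_⟩
  rw [hZ.slidingField (hmem s hs')]
  exact this s hs'

/-- The phase ends at the first return to the line. Before it, sliding is impossible and continuity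
excludes the left alternative at every step, so the right derivatives are those of the right field.
-/
lemma IsFlow.right_phase (h : Z.IsFlow z) {ε : ℝ} (hε : 0 < ε)
    (hr : Z.RightOn z (Ioo t (t + ε))) (hs : ∃ s > t, z s ∈ switchLine) :
    ∃ t' > t, z t' ∈ switchLine ∧ Z.RightOn z (Ioo t t') := by
  obtain ⟨s₀, hs₀, hs₀'⟩ := hs
  have hx : Continuous fun s => z s 0 := (continuous_apply 0).comp h.cont
  let m := t + ε / 2
  have hm : 0 < z m 0 := (hr m ⟨by simp only [m]; linarith, by simp only [m]; linarith⟩).1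
  have hms : m < s₀ := by
    by_contra hle
    have := (hr s₀ ⟨hs₀, by linarith [not_lt.1 hle, show m = t + ε / 2 from rfl]⟩).1
    exact this.ne' hs₀'
  obtain ⟨t', ht', h1, h2⟩ := first_time (y := fun s => -z s 0) (c := 0) hms.le hx.neg.continuousOn
    (by simpa using hm) (by rw [show z s₀ 0 = 0 from hs₀', neg_zero])
  have hmt : t < m := by simp only [m]; linarith
  have hpos : ∀ s ∈ Ioo t t', 0 < z s 0 := fun s hs => by
    rcases lt_or_ge s m with hlt | hge
    · exact (hr s ⟨hs.1, hlt.trans (by simp only [m]; linarith)⟩).1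
    · simpa using h2 s ⟨hge, hs.2⟩
  refine ⟨t', hmt.trans ht'.1, neg_eq_zero.1 h1, fun s hs => ⟨hpos s hs, ?_⟩⟩
  have hright : ∀ r ∈ Ioo t t', HasDerivWithinAt z (Z.fp (z r)) (Ici r) r := fun r hr' => by
    have hp := hpos r hr'
    rcases h.start_of_not_canSlide (t := r) (fun hc => hp.ne' hc.mem.1) with ⟨δ, hδ, h3⟩ | ⟨δ, hδ, h3⟩
    · exact (hasDerivWithinAt_Icc_of_Ioo h.cont.continuousOn
        (Z.continuous_fp.comp h.cont).continuousOn (fun u hu => (h3 u hu).2) r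
        ⟨le_rfl, by linarith⟩).Ici_of_Icc ⟨le_rfl, by linarith⟩
    · have : (𝓝[Ioo r (r + δ)] r).NeBot := by
        rw [nhdsWithin_Ioo_eq_nhdsGT (by linarith)]; infer_instance
      exact absurd (le_of_tendsto (hx.continuousWithinAt (s := Ioo r (r + δ)) (x := r))
        (eventually_mem_nhdsWithin.mono fun u hu => (h3 u hu).1.le)) (not_le.2 hp)
  obtain ⟨c, hc1, hc2⟩ := exists_between hs.1
  obtain ⟨d, hd1, hd2⟩ := exists_between hs.2
  exact (hasDerivWithinAt_Icc_of_right h.cont.continuousOn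
    (Z.continuous_fp.comp h.cont).continuousOn (fun r hr' => hright r
      ⟨hc1.trans_le hr'.1, hr'.2.trans hd2⟩) s ⟨hc2.le, hd1.le⟩).hasDerivAt (Icc_mem_nhds hc2 hd1)

lemma Cycle.right_phase (h : Z.Cycle z T) {ε : ℝ} (hε : 0 < ε)
    (hr : Z.RightOn z (Ioo t (t + ε))) :
    ∃ t' > t, z t' ∈ switchLine ∧ Z.RightOn z (Ioo t t') := by
  obtain ⟨s, hs, hs'⟩ := h.exists_canSlide t
  exact h.toIsFlow.right_phase hε hr ⟨s, hs, hs'.mem.1⟩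

lemma arc_time_image {z : ℝ → Plane} (a b : ℝ) :
    (fun s => z (s + a)) '' Icc 0 (b - a) = z '' Icc a b := by
  have : (fun s => z (s + a)) = z ∘ fun s => s + a := rfl
  rw [this, image_comp]
  simp

lemma IsFlow.rightArc (h : Z.IsFlow z) (hab : a < b) (hr : Z.RightOn z (Ioo a b)) :
    Z.RightArc (z a) (z b) (z '' Icc a b) :=
  ⟨fun s => z (s + a), b - a, by linarith, (h.cont.comp (by fun_prop)).continuousOn, by simp,
    by simp, hr.shift a fun s hs => ⟨by linarith [hs.1], by linarith [hs.2]⟩,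
    (arc_time_image a b).symm⟩

lemma SlidesOn.slidingArc (hab : a < b) (hs : Z.SlidesOn z (Icc a b)) :
    Z.SlidingArc (z a) (z b) (z '' Icc a b) :=
  ⟨fun s => z (s + a), b - a, by linarith, by simp, by simp,
    hs.shift a fun s hs => ⟨by linarith [hs.1], by linarith [hs.2]⟩, (arc_time_image a b).symm⟩

lemma RightArc.rot (h : Z.RightArc p q C) : Z.rot.LeftArc (-p) (-q) (-C) := by
  simpa using Z.rot_isSwap.leftArc h

lemma LeftArc.rot (h : Z.LeftArc p q C) : Z.rot.RightArc (-p) (-q) (-C) := by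
  simpa using Z.rot_isSwap.rightArc h

lemma SlidingArc.rot (h : Z.SlidingArc p q C) : Z.rot.SlidingArc (-p) (-q) (-C) := by
  simpa using IsConj.slidingArc (Or.inr Z.rot_isSwap) h

/-- A closed piece of a flow determines its range, when the flow is periodic. -/
lemma Cycle.range_eq (hN : Z.Nondegenerate) (hZ : Z.Nonsingular) (h : Z.Cycle z T) (hab : a < b)
    (he : z a = z b) : range z = z '' Icc a b := by
  have key : ∀ s ≥ a, z (s + (b - a)) = z s := fun s hs =>
    (h.toIsFlow.shift (b - a)).eq_of_eq hN hZ h.toIsFlow (a := a)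
      (by simp only [add_sub_cancel]; exact he.symm) s hs
  have key' : ∀ n : ℕ, ∀ s ≥ a, z (s + n * (b - a)) = z s := fun n => by
    induction n with
    | zero => simp
    | succ n ih =>
      intro s hs
      have h1 : a ≤ s + n * (b - a) := by
        have := mul_nonneg (Nat.cast_nonneg (α := ℝ) n) (sub_nonneg.2 hab.le); linarith
      rw [← ih s hs, ← key _ h1]
      congr 1; push_cast; ring
  refine Subset.antisymm ?_ (image_subset_range _ _)
  rintro _ ⟨s, rfl⟩
  obtain ⟨n, hn⟩ := exists_add_nat_mul_gt h.Tpos a s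
  rw [← h.per.nat_mul n s]
  set u := s + n * T
  have hpos : 0 < b - a := by linarith
  have h1 : 0 ≤ (u - a) / (b - a) := div_nonneg (by linarith) hpos.le
  have h2 := Nat.floor_le h1
  have h3 := Nat.lt_floor_add_one ((u - a) / (b - a))
  rw [le_div_iff₀ hpos] at h2
  rw [div_lt_iff₀ hpos] at h3
  set m := ⌊(u - a) / (b - a)⌋₊
  refine ⟨u - m * (b - a), ⟨by linarith, by linarith⟩, ?_⟩
  have := key' m (u - m * (b - a)) (by linarith)
  rw [← this]; congr 1; ring

/-- Forward uniqueness from a common point gives the later halves, and periodicity brings every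
point of an orbit into its later half. -/
lemma Cycle.range_eq_of_meet (hN : Z.Nondegenerate) (hZ : Z.Nonsingular) {w : ℝ → Plane} {T' : ℝ}
    (h : Z.Cycle z T) (h' : Z.Cycle w T') (hm : (range z ∩ range w).Nonempty) :
    range z = range w := by
  have key : ∀ {z w : ℝ → Plane} {T T' a b : ℝ}, Z.Cycle z T → Z.Cycle w T' → z a = w b →
      range z ⊆ range w := by
    intro z w T T' a b h h' he
    rintro _ ⟨s, rfl⟩
    obtain ⟨n, hn⟩ := exists_add_nat_mul_gt h.Tpos a s
    rw [← h.per.nat_mul n s]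
    have := h.toIsFlow.eq_of_eq hN hZ (h'.toIsFlow.shift (b - a)) (a := a)
      (by simp only [add_sub_cancel]; exact he) _ hn.le
    exact ⟨_, this.symm⟩
  obtain ⟨_, ⟨a, rfl⟩, ⟨b, hb⟩⟩ := hm
  exact Subset.antisymm (key h h' hb.symm) (key h' h hb)

/-! ### Arcs -/

lemma RightArc.unique {q' : Plane} {C' : Set Plane} (hq : q ∈ switchLine) (hq' : q' ∈ switchLine)
    (h : Z.RightArc p q C) (h' : Z.RightArc p q' C') : q = q' ∧ C = C' := by
  obtain ⟨w, T, hT, hc, rfl, rfl, hw, rfl⟩ := h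
  obtain ⟨v, T', hT', hc', h0, rfl, hv, rfl⟩ := h'
  have key : ∀ {w v : ℝ → Plane} {T T' : ℝ}, 0 < T → ContinuousOn w (Icc 0 T) →
      Z.RightOn w (Ioo 0 T) → w T ∈ switchLine → ContinuousOn v (Icc 0 T') →
      Z.RightOn v (Ioo 0 T') → v 0 = w 0 → T' ≤ T := by
    intro w v T T' hT hc hw hq hc' hv h0
    by_contra hlt
    have hlt := not_le.1 hlt
    have := eqOn_of_rightOn hc (hc'.mono (Icc_subset_Icc le_rfl hlt.le)) hw
      (fun s hs => hv s ⟨hs.1, hs.2.trans hlt⟩) h0.symm T ⟨hT.le, le_rfl⟩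
    have h1 := (hv T ⟨hT, hlt⟩).1
    rw [← this] at h1
    exact h1.ne' hq
  have hTT : T = T' := le_antisymm (key hT' hc' hv hq' hc hw h0.symm) (key hT hc hw hq hc' hv h0)
  subst hTT
  have := eqOn_of_rightOn hc hc' hw hv h0.symm
  exact ⟨this T ⟨hT.le, le_rfl⟩, image_congr this⟩

lemma RightArc.returnSol (hp : p ∈ switchLine) (hq : q ∈ switchLine) (h : Z.RightArc p q C) :
    ∃ x u T, ReturnSol (Z.Ap 0 0 + Z.Ap 1 1) Z.Ap.det Z.forcing x u T ∧ u 0 = Z.fp p 0 ∧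
      u T = Z.fp q 0 := by
  obtain ⟨w, T, hT, hc, rfl, rfl, hw, rfl⟩ := h
  exact ⟨_, _, T, ⟨hw.scalarSol hT hc hp, hq, fun t ht => (hw t ht).1⟩, rfl, rfl⟩

lemma RightArc.start_nonneg (hp : p ∈ switchLine) (h : Z.RightArc p q C) : 0 ≤ Z.fp p 0 := by
  obtain ⟨w, T, hT, hc, rfl, -, hw, -⟩ := h
  exact RightStart.nonneg ⟨T, hT, w, rfl, hc, hw⟩ hp

lemma RightArc.end_nonpos (hq : q ∈ switchLine) (h : Z.RightArc p q C) :
    Z.fp q 0 ≤ 0 := by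
  have := h.reverse.start_nonneg hq
  rw [reverse_fp, Pi.neg_apply] at this; linarith

lemma RightArc.end_tangent (hd : Z.Ap.det ≠ 0) (hq : q ∈ switchLine)
    (h : Z.RightArc p q C) (h0 : Z.fp q 0 = 0) : 0 < Z.Ap 0 1 * Z.fp q 1 := by
  obtain ⟨w, T, hT, hc, rfl, -, hw, -⟩ := h.reverse
  have := RightStart.tangent (by rw [PWLSystem.reverse, Matrix.det_neg]; simpa using hd)
    ⟨T, hT, w, rfl, hc, hw⟩ hq (by simp [h0])
  rw [reverse_fp, Pi.neg_apply] at this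
  change 0 < -Z.Ap 0 1 * _ at this
  linarith

/-- Right arcs are nested. -/
lemma RightArc.nested {p' q' : Plane} {C' : Set Plane} (hd : Z.Ap.det ≠ 0) (hp : p ∈ switchLine)
    (hq : q ∈ switchLine) (hp' : p' ∈ switchLine) (hq' : q' ∈ switchLine) (h : Z.RightArc p q C)
    (h' : Z.RightArc p' q' C') (hle : Z.fp p 0 ≤ Z.fp p' 0) : Z.fp q' 0 ≤ Z.fp q 0 := by
  obtain ⟨x, u, T, hs, e0, e1⟩ := h.returnSol hp hq
  obtain ⟨x', u', T', hs', e0', e1'⟩ := h'.returnSol hp' hq'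
  rw [← e1, ← e1']
  exact hs.velocity_antitone hs' hd (by rwa [e0, e0'])

lemma LeftArc.end_nonneg (hq : q ∈ switchLine) (h : Z.LeftArc p q C) : 0 ≤ Z.fm q 0 := by
  have := h.rot.end_nonpos (by simpa [switchLine] using hq)
  rw [rot_fp_neg, Pi.neg_apply] at this; linarith

lemma LeftArc.end_tangent (hd : Z.Am.det ≠ 0) (hq : q ∈ switchLine)
    (h : Z.LeftArc p q C) (h0 : Z.fm q 0 = 0) : Z.Am 0 1 * Z.fm q 1 < 0 := by
  have := h.rot.end_tangent hd (by simpa [switchLine] using hq) (by simp [rot_fp_neg, h0])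
  rw [rot_fp_neg, Pi.neg_apply] at this
  change 0 < Z.Am 0 1 * _ at this
  linarith

lemma LeftArc.nested {p' q' : Plane} {C' : Set Plane} (hd : Z.Am.det ≠ 0) (hp : p ∈ switchLine)
    (hq : q ∈ switchLine) (hp' : p' ∈ switchLine) (hq' : q' ∈ switchLine) (h : Z.LeftArc p q C)
    (h' : Z.LeftArc p' q' C') (hle : Z.fm p' 0 ≤ Z.fm p 0) : Z.fm q 0 ≤ Z.fm q' 0 := by
  have := h.rot.nested (Z := Z.rot) hd (by simpa [switchLine] using hp)
    (by simpa [switchLine] using hq) (by simpa [switchLine] using hp')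
    (by simpa [switchLine] using hq') h'.rot
    (by rw [rot_fp_neg, rot_fp_neg, Pi.neg_apply, Pi.neg_apply]; linarith)
  rw [rot_fp_neg, rot_fp_neg, Pi.neg_apply, Pi.neg_apply] at this; linarith

lemma Cycle.left_phase (h : Z.Cycle z T) {ε : ℝ} (hε : 0 < ε)
    (hr : Z.LeftOn z (Ioo t (t + ε))) :
    ∃ t' > t, z t' ∈ switchLine ∧ Z.LeftOn z (Ioo t t') := by
  obtain ⟨t', ht', h1, h2⟩ := h.rot.right_phase hε (Z.rot_isSwap.rightOn hr)
  refine ⟨t', ht', by simpa [switchLine] using h1, ?_⟩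
  have := Z.rot.rot_isSwap.leftOn h2
  rw [rot_rot] at this
  simpa [Function.comp_def] using this

lemma IsFlow.leftArc (h : Z.IsFlow z) (hab : a < b) (hr : Z.LeftOn z (Ioo a b)) :
    Z.LeftArc (z a) (z b) (z '' Icc a b) :=
  ⟨fun s => z (s + a), b - a, by linarith, (h.cont.comp (by fun_prop)).continuousOn, by simp,
    by simp, hr.shift a fun s hs => ⟨by linarith [hs.1], by linarith [hs.2]⟩,
    (arc_time_image a b).symm⟩

lemma SlidesOn.image_eq (hZ : Z.Nonsingular) (hab : a ≤ b) (h : Z.SlidesOn z (Icc a b)) :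
    z '' Icc a b = onLine '' uIcc (z a 1) (z b 1) := by
  rw [← (h.rightSol hZ).image_eq hab, image_image]
  exact image_congr fun t ht => eq_onLine (h t ht).1.1

lemma SlidingArc.eq_segment (hZ : Z.Nonsingular) {u v : ℝ}
    (h : Z.SlidingArc (onLine u) (onLine v) C) : C = onLine '' uIcc u v := by
  obtain ⟨w, T, hT, h0, h1, hs, rfl⟩ := h
  rw [hs.image_eq hZ hT.le, h0, h1]; rfl

lemma SlidingArc.rightSol (hZ : Z.Nonsingular) {u v : ℝ}
    (h : Z.SlidingArc (onLine u) (onLine v) C) :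
    ∃ y T, 0 ≤ T ∧ RightSol Z.scalarField y 0 T ∧ y 0 = u ∧ y T = v := by
  obtain ⟨w, T, hT, h0, h1, hs, rfl⟩ := h
  exact ⟨_, T, hT.le, hs.rightSol hZ, by simp [h0], by simp [h1]⟩

/-- Sliding arcs in both directions from two points: they diverge. -/
lemma SlidingArc.lt_of_down_of_up (hZ : Z.Nonsingular) {u u' v v' : ℝ} {C' : Set Plane}
    (hu : Z.SlidingArc (onLine u) (onLine u') C) (hv : Z.SlidingArc (onLine v) (onLine v') C')
    (hs : onLine u ∈ Z.sliding)
    (h1 : u' < u) (h2 : v < v') (h3 : u' ≤ v) (h4 : u ≤ v') : u < v := by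
  obtain ⟨x, T, hT, hx, rfl, rfl⟩ := hu.rightSol hZ
  obtain ⟨y, T', hT', hy, rfl, rfl⟩ := hv.rightSol hZ
  exact hx.lt_of_down_of_up hT hy hT'
    (contDiffAt_scalarField (hZ.ne (onLine_mem_sliding.1 hs))) h1 h2 h3 h4

lemma SlidingArc.not_both (hZ : Z.Nonsingular) {u v : ℝ} {C' : Set Plane} (h : u < v)
    (h1 : Z.SlidingArc (onLine u) (onLine v) C) (h2 : Z.SlidingArc (onLine v) (onLine u) C') :
    False := by
  obtain ⟨x, T, hT, hx, rfl, rfl⟩ := h1.rightSol hZ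
  obtain ⟨y, T', hT', hy, h3, h4⟩ := h2.rightSol hZ
  exact hx.not_up_down hT hy hT' h le_rfl le_rfl h3.ge h4.le

/-- A sliding solution that climbs away from a point climbs there at a positive rate. -/
lemma SlidingArc.scalarField_pos (hZ : Z.Nonsingular) {u v : ℝ}
    (h : Z.SlidingArc (onLine u) (onLine v) C) (hs : onLine u ∈ Z.sliding) (huv : u < v) :
    0 < Z.scalarField u := by
  obtain ⟨x, T, hT, hx, h0, h1⟩ := h.rightSol hZ
  refine lt_of_le_of_ne (hx.nonneg_of_up hT h0.le (h1 ▸ huv)) fun hg => ?_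
  -- A zero rate would make the constant curve a solution. Uniqueness after the last visit to `u`
  -- contradicts the climb.
  obtain ⟨s, hs', h2, h3⟩ := last_time hT hx.1 h0.le (h1 ▸ huv)
  have hx' := hx.mono hs'.1 le_rfl
  have hc : RightSol Z.scalarField (fun _ => u) s T :=
    ⟨continuousOn_const, fun t _ => by rw [← hg]; exact hasDerivWithinAt_const _ _ _⟩
  obtain ⟨c, hc1, hc2⟩ := eqOn_of_rightSol (by
    rw [h2]; exact contDiffAt_scalarField (hZ.ne (onLine_mem_sliding.1 hs))) hs'.2 hx' hc h2
  exact absurd (hc2 c ⟨hc1.1.le, le_rfl⟩) (h3 c ⟨hc1.1, hc1.2.le⟩).ne'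

/-! ### Tangency points -/

/-- Near time zero `x'' > 0`, so `x'` increases through zero and `x` has a minimum with value zero
there. -/
lemma tangent_solution (h0 : p 0 = 0) (h1 : Z.fp p 0 = 0) (h2 : 0 < Z.Ap 0 1 * Z.fp p 1) :
    ∃ ε > 0, ∃ w : ℝ → Plane, w 0 = p ∧
      ∀ s ∈ Ioo (-ε) ε, HasDerivAt w (Z.fp (w s)) s ∧ 0 ≤ w s 0 := by
  obtain ⟨w, hw0, ε, hε, hw⟩ :=
    ContDiffAt.exists_forall_mem_closedBall_exists_eq_forall_mem_Ioo_hasDerivAt₀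
      (Z.contDiff_fp.contDiffAt (x := p)) 0
  simp only [zero_sub, zero_add] at hw
  have hx : ∀ s ∈ Ioo (-ε) ε, HasDerivAt (fun s => w s 0) (Z.fp (w s) 0) s := fun s hs =>
    hasDerivAt_pi.1 (hw s hs) 0
  have hu : ∀ s ∈ Ioo (-ε) ε, HasDerivAt (fun s => Z.fp (w s) 0)
      (Z.Ap 0 0 * Z.fp (w s) 0 + Z.Ap 0 1 * Z.fp (w s) 1) s := fun s hs => by
    have := (((hx s hs).const_mul (Z.Ap 0 0)).add
      ((hasDerivAt_pi.1 (hw s hs) 1).const_mul (Z.Ap 0 1))).add_const (Z.bp 0)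
    simpa only [← fp_zero] using this.congr_of_eventuallyEq (Eventually.of_forall fun s => by
      simp [fp_zero])
  have hc : ContinuousAt (fun s => Z.Ap 0 0 * Z.fp (w s) 0 + Z.Ap 0 1 * Z.fp (w s) 1) 0 := by
    have h3 := (hw 0 ⟨by linarith, hε⟩).continuousAt
    have h4 : ContinuousAt (fun s => Z.fp (w s)) 0 := Z.continuous_fp.continuousAt.comp h3
    have h5 := continuousAt_pi.1 h4
    exact (continuousAt_const.mul (h5 0)).add (continuousAt_const.mul (h5 1))
  have hpos : ∀ᶠ s in 𝓝 (0 : ℝ), 0 < Z.Ap 0 0 * Z.fp (w s) 0 + Z.Ap 0 1 * Z.fp (w s) 1 :=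
    hc.eventually_const_lt (by simpa [hw0, h1] using h2)
  obtain ⟨δ, hδ, hδ'⟩ := Metric.eventually_nhds_iff_ball.1 hpos
  rw [Real.ball_eq_Ioo, zero_sub, zero_add] at hδ'
  have hr : 0 < min ε δ := lt_min hε hδ
  have hsub1 : Ioo (-min ε δ) (min ε δ) ⊆ Ioo (-ε) ε := fun s hs =>
    ⟨by linarith [hs.1, min_le_left ε δ], by linarith [hs.2, min_le_left ε δ]⟩
  have hsub2 : Ioo (-min ε δ) (min ε δ) ⊆ Ioo (-δ) δ := fun s hs =>
    ⟨by linarith [hs.1, min_le_right ε δ], by linarith [hs.2, min_le_right ε δ]⟩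
  have hmono : StrictMonoOn (fun s => Z.fp (w s) 0) (Ioo (-min ε δ) (min ε δ)) := by
    refine strictMonoOn_of_deriv_pos (convex_Ioo _ _)
      (fun s hs => (hu s (hsub1 hs)).continuousAt.continuousWithinAt) fun s hs => ?_
    rw [interior_Ioo] at hs
    rw [(hu s (hsub1 hs)).deriv]
    exact hδ' s (hsub2 hs)
  have h00 : (0 : ℝ) ∈ Ioo (-min ε δ) (min ε δ) := ⟨by linarith, hr⟩
  have hu0 : Z.fp (w 0) 0 = 0 := by rw [hw0, h1]
  have hx0 : w 0 0 = 0 := by rw [hw0, h0]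
  refine ⟨min ε δ, hr, w, hw0, fun s hs => ⟨hw s (hsub1 hs), ?_⟩⟩
  rcases le_total 0 s with hs0 | hs0
  · have : MonotoneOn (fun s => w s 0) (Icc 0 s) := by
      refine monotoneOn_of_deriv_nonneg (convex_Icc _ _) (fun r hr => (hx r (hsub1
        ⟨by linarith [hr.1], by linarith [hr.2, hs.2]⟩)).continuousAt.continuousWithinAt)
        (fun r hr => ?_) (fun r hr => ?_) <;> rw [interior_Icc] at hr <;>
        have hr' : r ∈ Ioo (-min ε δ) (min ε δ) := ⟨by linarith [hr.1], by linarith [hr.2, hs.2]⟩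
      · exact (hx r (hsub1 hr')).differentiableAt.differentiableWithinAt
      · rw [(hx r (hsub1 hr')).deriv, ← hu0]
        exact (hmono h00 hr' hr.1).le
    rw [← hx0]
    exact this ⟨le_rfl, hs0⟩ ⟨hs0, le_rfl⟩ hs0
  · have : AntitoneOn (fun s => w s 0) (Icc s 0) := by
      refine antitoneOn_of_deriv_nonpos (convex_Icc _ _) (fun r hr => (hx r (hsub1
        ⟨by linarith [hr.1, hs.1], by linarith [hr.2]⟩)).continuousAt.continuousWithinAt)
        (fun r hr => ?_) (fun r hr => ?_) <;> rw [interior_Icc] at hr <;>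
        have hr' : r ∈ Ioo (-min ε δ) (min ε δ) := ⟨by linarith [hr.1, hs.1], by linarith [hr.2]⟩
      · exact (hx r (hsub1 hr')).differentiableAt.differentiableWithinAt
      · rw [(hx r (hsub1 hr')).deriv, ← hu0]
        exact (hmono hr' h00 hr.2).le
    rw [← hx0]
    exact this ⟨le_rfl, hs0⟩ ⟨hs0, le_rfl⟩ hs0

lemma ne_zero_of_apply {v : Plane} {i : Fin 2} (h : v i ≠ 0) : v ≠ 0 := fun he => h (by simp [he])

lemma visibleRight_of (hp : p ∈ switchLine) (h1 : Z.fp p 0 = 0) (h2 : 0 < Z.Ap 0 1 * Z.fp p 1)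
    (h3 : Z.fm p 0 ≠ 0) : Z.VisibleRight p :=
  ⟨hp, ne_zero_of_apply (i := 1) (right_ne_zero_of_mul h2.ne'), ne_zero_of_apply h3, h1,
    tangent_solution hp h1 h2⟩

/-- An orbit of the left field that curves into `x ≥ 0` would be visible for a right field, so the
fields are interchanged without reflecting the plane. -/
lemma invisibleLeft_of (hp : p ∈ switchLine) (h1 : Z.fm p 0 = 0) (h2 : 0 < Z.Am 0 1 * Z.fm p 1)
    (h3 : Z.fp p 0 ≠ 0) : Z.InvisibleLeft p :=
  ⟨hp, ne_zero_of_apply h3, ne_zero_of_apply (i := 1) (right_ne_zero_of_mul h2.ne'), h1,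
    tangent_solution (Z := ⟨Z.Am, Z.bm, Z.Ap, Z.bp⟩) hp h1 h2⟩

lemma visibleLeft_of (hp : p ∈ switchLine) (h1 : Z.fm p 0 = 0) (h2 : Z.Am 0 1 * Z.fm p 1 < 0)
    (h3 : Z.fp p 0 ≠ 0) : Z.VisibleLeft p := by
  have h := Z.rot.rot_isSwap.visibleLeft (p := -p) (visibleRight_of
    (by simpa [switchLine] using hp) (by simp [rot_fp_neg, h1]) ?_ (by simpa [rot_fm_neg] using h3))
  · rw [rot_rot] at h
    simpa using h
  · rw [rot_fp_neg]
    change 0 < Z.Am 0 1 * -Z.fm p 1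
    linarith

/-! ### Degenerate systems -/

lemma canSlide_of_zero (h : p ∈ Z.sliding) (h0 : Z.slidingField p = 0) : Z.CanSlide p :=
  ⟨1, one_pos, fun _ => p, rfl, fun _ _ => ⟨h, by rw [h0]; exact hasDerivWithinAt_const _ _ _⟩⟩

lemma canSlide_of_regularSliding_empty (hr : Z.regularSliding = ∅) (h : p ∈ Z.sliding) :
    Z.CanSlide p := by
  refine canSlide_of_zero h (slidingField_of_not ?_ ?_)
  · by_contra hne
    have : p ∈ Z.regularSliding := ⟨h, hne⟩
    rw [hr] at this; exact this
  · rintro ⟨L, hL, -⟩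
    rw [hr, nhdsWithin_empty] at hL
    exact hL.ne rfl

lemma canSlide_of_affine {A B : ℝ} (hall : ∀ y, onLine y ∈ Z.sliding)
    (hf : ∀ y, Z.slidingField (onLine y) = onLine (A * y + B)) (h : p ∈ Z.sliding) :
    Z.CanSlide p := by
  obtain ⟨y, hy0, ε, hε, hy⟩ :=
    ContDiffAt.exists_forall_mem_closedBall_exists_eq_forall_mem_Ioo_hasDerivAt₀
      (f := fun y : ℝ => A * y + B) (x₀ := p 1) (by fun_prop) 0
  refine ⟨ε, hε, fun t => onLine (y t), (congrArg onLine hy0).trans (eq_onLine h.1).symm,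
    fun t ht => ⟨hall _, ?_⟩⟩
  rw [hf]
  refine hasDerivWithinAt_pi.2 fun i => ?_
  fin_cases i
  · exact hasDerivWithinAt_const _ _ _
  · exact (hy t ⟨by linarith [ht.1], by linarith [ht.2]⟩).hasDerivWithinAt

lemma canSlide_of_parallel (hZ : Z.Nonsingular) (ha : Z.Ap 0 1 = 0) (hc : Z.Am 0 1 = 0)
    (h : p ∈ Z.sliding) : Z.CanSlide p := by
  obtain ⟨y, rfl⟩ : ∃ y, p = onLine y := ⟨_, eq_onLine h.1⟩
  rw [onLine_mem_sliding] at h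
  have hconst : ∀ u, Z.normalProd u = Z.normalProd y := fun u => by
    simp [normalProd, fp_onLine_zero, fm_onLine_zero, ha, hc]
  exact canSlide_of_solution (hZ.ne h) (fun u _ _ => Eventually.of_forall fun t => by rwa [hconst]) h

/-- Both normal components are multiples of `y - y₀`. Either there are no nonsingular sliding points
and the sliding field is zero, or the whole line slides; then the common factor cancels and the
sliding field extends to an affine field. -/
lemma canSlide_of_singular (hZ : ¬ Z.Nonsingular) (h : p ∈ Z.sliding) : Z.CanSlide p := by
  simp only [Nonsingular, not_forall, not_not] at hZ
  obtain ⟨y₀, hp0, hm0⟩ := hZ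
  have hp : ∀ y, Z.fp (onLine y) 0 = Z.Ap 0 1 * (y - y₀) := fun y => by
    rw [fp_onLine_zero] at hp0 ⊢; linear_combination hp0
  have hm : ∀ y, Z.fm (onLine y) 0 = Z.Am 0 1 * (y - y₀) := fun y => by
    rw [fm_onLine_zero] at hm0 ⊢; linear_combination hm0
  have hP : ∀ y, Z.normalProd y = Z.Ap 0 1 * Z.Am 0 1 * (y - y₀) ^ 2 := fun y => by
    rw [normalProd, hp, hm]; ring
  by_cases hemp : Z.Ap 0 1 = Z.Am 0 1 ∨ 0 < Z.Ap 0 1 * Z.Am 0 1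
  · refine canSlide_of_regularSliding_empty (eq_empty_of_forall_notMem fun q hq => ?_) h
    obtain ⟨hq1, hq2⟩ := hq
    obtain ⟨y, rfl⟩ : ∃ y, q = onLine y := ⟨_, eq_onLine hq1.1⟩
    refine hq2 ?_
    rw [hp, hm]
    rcases hemp with he | hpos
    · rw [he]
    · rw [onLine_mem_sliding, hP] at hq1
      have : (y - y₀) ^ 2 ≤ 0 := nonpos_of_mul_nonpos_right hq1 hpos
      have : y - y₀ = 0 := by nlinarith
      simp [this]
  · push Not at hemp
    obtain ⟨hne, hle⟩ := hemp
    have hall : ∀ y, onLine y ∈ Z.sliding := fun y => by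
      rw [onLine_mem_sliding, hP]; exact mul_nonpos_of_nonpos_of_nonneg hle (sq_nonneg _)
    have hD : Z.Am 0 1 - Z.Ap 0 1 ≠ 0 := sub_ne_zero.2 (Ne.symm hne)
    let A := (Z.Am 0 1 * Z.Ap 1 1 - Z.Ap 0 1 * Z.Am 1 1) / (Z.Am 0 1 - Z.Ap 0 1)
    let B := (Z.Am 0 1 * Z.bp 1 - Z.Ap 0 1 * Z.bm 1) / (Z.Am 0 1 - Z.Ap 0 1)
    have hconv : ∀ y ≠ y₀, Z.convexField (onLine y) = onLine (A * y + B) := fun y hy => by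
      rw [convexField_onLine]
      congr 1
      rw [scalarField, convexField_one, hp, hm, fp_onLine_one, fm_onLine_one]
      have hy' : y - y₀ ≠ 0 := sub_ne_zero.2 hy
      rw [show Z.Am 0 1 * (y - y₀) - Z.Ap 0 1 * (y - y₀) = (Z.Am 0 1 - Z.Ap 0 1) * (y - y₀) by ring]
      simp only [A, B]
      field_simp
      ring
    have hreg : ∀ y, y ≠ y₀ ↔ Z.fm (onLine y) 0 ≠ Z.fp (onLine y) 0 := fun y => by
      rw [hp, hm, ← sub_ne_zero (a := Z.Am 0 1 * _), ← sub_mul, mul_ne_zero_iff, sub_ne_zero (b := y₀)]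
      simp [hD]
    refine canSlide_of_affine hall (A := A) (B := B) (fun y => ?_) h
    by_cases hy : y = y₀
    · subst hy
      refine slidingField_of_tendsto (hm0.trans hp0.symm) ?_ ?_
      · rw [← mem_closure_iff_nhdsWithin_neBot]
        refine map_mem_closure continuous_onLine (s := {y}ᶜ)
          (mem_closure_iff_nhdsWithin_neBot.2 inferInstance) fun u hu => ⟨hall u, (hreg u).1 hu⟩
      · have hcont : Tendsto (fun q : Plane => onLine (A * q 1 + B)) (𝓝[Z.regularSliding] (onLine y))
            (𝓝 (onLine (A * y + B))) := by
          have : Continuous fun q : Plane => onLine (A * q 1 + B) :=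
            continuous_onLine.comp (by fun_prop)
          exact (this.tendsto (onLine y)).mono_left nhdsWithin_le_nhds
        refine hcont.congr' (eventually_mem_nhdsWithin.mono fun q hq => ?_)
        obtain ⟨u, rfl⟩ : ∃ u, q = onLine u := ⟨_, eq_onLine hq.1.1⟩
        exact (hconv u ((hreg u).2 hq.2)).symm
    · rw [slidingField_of_ne ((hreg y).1 hy), hconv y hy]

end PWLSystem

namespace PWLSystem

variable {Z : PWLSystem} {z w : ℝ → Plane} {p q : Plane} {a b c t T : ℝ} {C γ : Set Plane}
  {yL yR y y₀ y₁ : ℝ}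

/-! ### Orbits on an attractive sliding segment -/

lemma image_Icc_union (z : ℝ → Plane) (h1 : a ≤ b) (h2 : b ≤ c) :
    z '' Icc a b ∪ z '' Icc b c = z '' Icc a c := by
  rw [← image_union, Icc_union_Icc_eq_Icc h1 h2]

lemma RightArc.mem_switchLine {r : Plane} (h : Z.RightArc p q C) (hr : r ∈ C)
    (hs : r ∈ switchLine) : r = p ∨ r = q := by
  obtain ⟨w, T, hT, -, rfl, rfl, hw, rfl⟩ := h
  obtain ⟨t, ht, rfl⟩ := hr
  rcases ht.1.eq_or_lt with rfl | h1
  · exact Or.inl rfl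
  · rcases ht.2.eq_or_lt with rfl | h2
    · exact Or.inr rfl
    · exact absurd hs (hw t ⟨h1, h2⟩).1.ne'

lemma LeftArc.mem_switchLine {r : Plane} (h : Z.LeftArc p q C) (hr : r ∈ C)
    (hs : r ∈ switchLine) : r = p ∨ r = q := by
  obtain ⟨w, T, hT, -, rfl, rfl, hw, rfl⟩ := h
  obtain ⟨t, ht, rfl⟩ := hr
  rcases ht.1.eq_or_lt with rfl | h1
  · exact Or.inl rfl
  · rcases ht.2.eq_or_lt with rfl | h2
    · exact Or.inr rfl
    · exact absurd hs (hw t ⟨h1, h2⟩).1.ne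

lemma RightArc.start_mem (h : Z.RightArc p q C) : p ∈ C := by
  obtain ⟨w, T, hT, -, rfl, rfl, -, rfl⟩ := h
  exact ⟨0, ⟨le_rfl, hT.le⟩, rfl⟩

lemma onLine_mem_segment {u v : ℝ} : onLine y ∈ onLine '' uIcc u v ↔ y ∈ uIcc u v :=
  onLine_injective.mem_set_image

lemma onLine_inj : onLine y = onLine y₀ ↔ y = y₀ := onLine_injective.eq_iff

lemma range_neg_fun (z : ℝ → Plane) : range (fun t => -z t) = -range z := by
  ext q
  simp only [mem_range, Set.mem_neg]
  exact exists_congr fun t => neg_eq_iff_eq_neg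

/-- An orbit that cannot slide traverses one of the half planes. -/
lemma Cycle.leave (h : Z.Cycle z T) (hz : z t = onLine y) (hs : ¬ Z.CanSlide (onLine y)) :
    (∃ t' > t, ∃ y', z t' = onLine y' ∧ Z.RightStart (onLine y) ∧
      Z.RightArc (onLine y) (onLine y') (z '' Icc t t')) ∨
    (∃ t' > t, ∃ y', z t' = onLine y' ∧ Z.LeftStart (onLine y) ∧
      Z.LeftArc (onLine y) (onLine y') (z '' Icc t t')) := by
  rcases h.start_of_not_canSlide (t := t) (by rwa [hz]) with ⟨ε, hε, hr⟩ | ⟨ε, hε, hl⟩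
  · obtain ⟨t', ht', hm, hr'⟩ := h.right_phase hε hr
    have harc := h.rightArc ht' hr'
    rw [hz, eq_onLine hm] at harc
    exact Or.inl ⟨t', ht', z t' 1, eq_onLine hm, hz ▸ hr.rightStart h.cont hε, harc⟩
  · obtain ⟨t', ht', hm, hr'⟩ := h.left_phase hε hl
    have harc := h.leftArc ht' hr'
    rw [hz, eq_onLine hm] at harc
    exact Or.inr ⟨t', ht', z t' 1, eq_onLine hm, hz ▸ hl.leftStart h.cont hε, harc⟩

/-- An orbit that can slide slides up to a point where it cannot. -/
lemma Cycle.slide (hZ : Z.Nonsingular) (h : Z.Cycle z T) (hz : z t = onLine y)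
    (hs : Z.CanSlide (onLine y)) :
    ∃ t' > t, ∃ y', z t' = onLine y' ∧ ¬ Z.CanSlide (onLine y') ∧ onLine y' ∈ Z.sliding ∧
      Z.SlidingArc (onLine y) (onLine y') (z '' Icc t t') := by
  obtain ⟨t', ht', hn, hm, hall⟩ := h.slide_phase (t := t) (by rwa [hz])
  have harc := (h.slidesOn_Icc hZ ht' hall).slidingArc ht'
  rw [hz, eq_onLine hm.1] at harc
  exact ⟨t', ht', z t' 1, eq_onLine hm.1, eq_onLine hm.1 ▸ hn, eq_onLine hm.1 ▸ hm, harc⟩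

/-- A system with the attractive sliding segment between `(0, yL)` and `(0, yR)`, whose ends are
tangency points of the left and of the right system. -/
structure AttractiveBand (Z : PWLSystem) (yL yR : ℝ) : Prop where
  nondeg : Z.Nondegenerate
  lt : yL < yR
  posR : 0 < Z.Ap 0 1
  posL : 0 < Z.Am 0 1
  fp_eq : ∀ y, Z.fp (onLine y) 0 = Z.Ap 0 1 * (y - yR)
  fm_eq : ∀ y, Z.fm (onLine y) 0 = Z.Am 0 1 * (y - yL)

namespace AttractiveBand

variable (B : Z.AttractiveBand yL yR)
include B

lemma rot : Z.rot.AttractiveBand (-yR) (-yL) where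
  nondeg := B.nondeg.rot
  lt := neg_lt_neg B.lt
  posR := B.posL
  posL := B.posR
  fp_eq y := by
    rw [rot_fp_onLine, Pi.neg_apply, B.fm_eq]
    change _ = Z.Am 0 1 * _
    ring
  fm_eq y := by
    rw [rot_fm_onLine, Pi.neg_apply, B.fp_eq]
    change _ = Z.Ap 0 1 * _
    ring

lemma fp_neg (h : y < yR) : Z.fp (onLine y) 0 < 0 := by
  rw [B.fp_eq]; exact mul_neg_of_pos_of_neg B.posR (by linarith)

lemma fp_nonneg (h : yR ≤ y) : 0 ≤ Z.fp (onLine y) 0 := by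
  rw [B.fp_eq]; exact mul_nonneg B.posR.le (by linarith)

lemma fm_pos (h : yL < y) : 0 < Z.fm (onLine y) 0 := by
  rw [B.fm_eq]; exact mul_pos B.posL (by linarith)

lemma fm_nonpos (h : y ≤ yL) : Z.fm (onLine y) 0 ≤ 0 := by
  rw [B.fm_eq]; exact mul_nonpos_of_nonneg_of_nonpos B.posL.le (by linarith)

lemma fp_yR : Z.fp (onLine yR) 0 = 0 := by rw [B.fp_eq]; ring
lemma fm_yL : Z.fm (onLine yL) 0 = 0 := by rw [B.fm_eq]; ring

lemma nonsingular : Z.Nonsingular := fun y h h' => by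
  rw [B.fp_eq] at h
  rw [B.fm_eq] at h'
  have h1 := (mul_eq_zero.1 h).resolve_left B.posR.ne'
  have h2 := (mul_eq_zero.1 h').resolve_left B.posL.ne'
  linarith [B.lt]

lemma mem_sliding_iff : onLine y ∈ Z.sliding ↔ y ∈ Icc yL yR := by
  rw [onLine_mem_sliding, normalProd, B.fp_eq, B.fm_eq,
    show Z.Ap 0 1 * (y - yR) * (Z.Am 0 1 * (y - yL)) =
      (Z.Ap 0 1 * Z.Am 0 1) * ((y - yR) * (y - yL)) by ring]
  have hlt := B.lt
  constructor
  · intro h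
    have h' := nonpos_of_mul_nonpos_right h (mul_pos B.posR B.posL)
    exact ⟨by nlinarith, by nlinarith⟩
  · intro h
    exact mul_nonpos_of_nonneg_of_nonpos (mul_pos B.posR B.posL).le
      (mul_nonpos_of_nonpos_of_nonneg (by linarith [h.2]) (by linarith [h.1]))

lemma attractive (h : y ∈ Ioo yL yR) : onLine y ∈ Z.attractive :=
  ⟨B.mem_sliding_iff.2 ⟨h.1.le, h.2.le⟩, B.fp_neg h.2, B.fm_pos h.1⟩

lemma canSlide (h : y ∈ Ioo yL yR) : Z.CanSlide (onLine y) :=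
  canSlide_of_neg (mul_neg_of_neg_of_pos (B.fp_neg h.2) (B.fm_pos h.1))

lemma mem_Icc_of_canSlide (h : Z.CanSlide (onLine y)) : y ∈ Icc yL yR :=
  B.mem_sliding_iff.1 h.mem

lemma not_canSlide_above (hR : ¬ Z.CanSlide (onLine yR)) (h : yR ≤ y) :
    ¬ Z.CanSlide (onLine y) := fun hc => by
  rw [le_antisymm (B.mem_Icc_of_canSlide hc).2 h] at hc
  exact hR hc

lemma not_canSlide_below (hL : y = yL → ¬ Z.CanSlide (onLine yL)) (h : y ≤ yL) :
    ¬ Z.CanSlide (onLine y) := fun hc => by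
  have he := le_antisymm h (B.mem_Icc_of_canSlide hc).1
  rw [he] at hc
  exact hL he hc

lemma right_arc (h : Z.Cycle z T) (hz : z t = onLine y) (hy : yR ≤ y)
    (hs : ¬ Z.CanSlide (onLine y)) :
    ∃ t' > t, ∃ y' ≤ yR, z t' = onLine y' ∧ Z.RightArc (onLine y) (onLine y') (z '' Icc t t') ∧
      Z.RightStart (onLine y) := by
  rcases h.leave hz hs with ⟨t', ht', y', hz', hst, harc⟩ | ⟨t', ht', y', hz', hst, harc⟩
  · refine ⟨t', ht', y', ?_, hz', harc, hst⟩
    by_contra hlt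
    have := harc.end_nonpos (onLine_mem _)
    rw [B.fp_eq] at this
    nlinarith [B.posR, not_le.1 hlt]
  · exact absurd (hst.nonpos (onLine_mem y)) (not_le.2 (B.fm_pos (B.lt.trans_le hy)))

lemma left_arc (h : Z.Cycle z T) (hz : z t = onLine y) (hy : y ≤ yL)
    (hs : ¬ Z.CanSlide (onLine y)) :
    ∃ t' > t, ∃ y' ≥ yL, z t' = onLine y' ∧ Z.LeftArc (onLine y) (onLine y') (z '' Icc t t') ∧
      Z.LeftStart (onLine y) := by
  rcases h.leave hz hs with ⟨t', ht', y', hz', hst, harc⟩ | ⟨t', ht', y', hz', hst, harc⟩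
  · exact absurd (hst.nonneg (onLine_mem y)) (not_le.2 (B.fp_neg (hy.trans_lt B.lt)))
  · refine ⟨t', ht', y', ?_, hz', harc, hst⟩
    by_contra hlt
    have := harc.end_nonneg (onLine_mem _)
    rw [B.fm_eq] at this
    nlinarith [B.posL, not_le.1 hlt]

lemma slide_arc (h : Z.Cycle z T) (hz : z t = onLine y) (hs : Z.CanSlide (onLine y)) :
    ∃ t' > t, ∃ y', (y' = yL ∨ y' = yR) ∧ z t' = onLine y' ∧ ¬ Z.CanSlide (onLine y') ∧
      Z.SlidingArc (onLine y) (onLine y') (z '' Icc t t') := by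
  obtain ⟨t', ht', y', hy', hn, hm, harc⟩ := h.slide B.nonsingular hz hs
  refine ⟨t', ht', y', ?_, hy', hn, harc⟩
  have := B.mem_sliding_iff.1 hm
  by_contra! hne
  exact hn (B.canSlide ⟨this.1.lt_of_ne hne.1.symm, this.2.lt_of_ne hne.2⟩)

lemma visibleRight (h : Z.RightStart (onLine yR)) : Z.VisibleRight (onLine yR) :=
  visibleRight_of (onLine_mem _) B.fp_yR (h.tangent B.nondeg.1 (onLine_mem _) B.fp_yR)
    (B.fm_pos B.lt).ne'

lemma visibleLeft (h : Z.LeftStart (onLine yL)) : Z.VisibleLeft (onLine yL) :=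
  visibleLeft_of (onLine_mem _) B.fm_yL (h.tangent B.nondeg.2 (onLine_mem _) B.fm_yL)
    (B.fp_neg B.lt).ne

/-- Orbits that have spiralled out of the sliding segment never slide again. -/
lemma no_spiral (h : Z.Cycle z T) (hR : ¬ Z.CanSlide (onLine yR))
    (hL : y₀ = yL → ¬ Z.CanSlide (onLine yL)) (h0 : y₀ ≤ yL) (h1 : yR ≤ y₁) {C₁ C₂ : Set Plane}
    (ha : Z.RightArc (onLine yR) (onLine y₀) C₁) (hb : Z.LeftArc (onLine y₀) (onLine y₁) C₂)
    (hz : z t = onLine y₁) : False := by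
  -- By nestedness, right arcs from points at or above `y₁` end at or below `y₀`, and left arcs from
  -- there end at or above `y₁`. The orbit thus stays outside the two given arcs, where sliding is
  -- impossible.
  let P := {s | z s ∈ switchLine ∧ (y₁ ≤ z s 1 ∨ z s 1 ≤ y₀)}
  have c0 : Continuous fun s => z s 1 := (continuous_apply 1).comp h.cont
  have hP : IsClosed P := (isClosed_switchLine.preimage h.cont).inter
    ((isClosed_le continuous_const c0).union (isClosed_le c0 continuous_const))
  have key := forall_mem_of_recurrence (z := z)
    (C := {q | q ∈ switchLine → y₁ ≤ q 1 ∨ q 1 ≤ y₀}) hP ?_ (t₀ := t) (by simp [P, hz, onLine_mem])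
  · obtain ⟨s, hs, hc⟩ := h.exists_canSlide t
    obtain ⟨y, hy⟩ : ∃ y, z s = onLine y := ⟨_, eq_onLine hc.mem.1⟩
    have h2 := key s hs.le
    rw [hy] at hc h2
    rcases h2 (onLine_mem y) with h2 | h2
    · exact B.not_canSlide_above hR (h1.trans h2) hc
    · refine B.not_canSlide_below (fun he => hL ?_) (le_trans h2 h0) hc
      exact le_antisymm h0 (he ▸ h2)
  · rintro s ⟨hs, hs'⟩
    obtain ⟨y, hy⟩ : ∃ y, z s = onLine y := ⟨_, eq_onLine hs⟩
    rw [hy] at hs'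
    rcases hs' with hs' | hs'
    · have hs' : y₁ ≤ y := hs'
      obtain ⟨t', ht', y', hy', hz', harc, -⟩ := B.right_arc h hy (h1.trans hs')
        (B.not_canSlide_above hR (h1.trans hs'))
      have hle : y' ≤ y₀ := by
        have := ha.nested B.nondeg.1 (onLine_mem _) (onLine_mem _) (onLine_mem _) (onLine_mem _)
          harc (by rw [B.fp_yR]; exact B.fp_nonneg (h1.trans hs'))
        rw [B.fp_eq, B.fp_eq] at this
        linarith [le_of_mul_le_mul_left this B.posR]
      refine ⟨t', ht', ⟨by rw [hz']; exact onLine_mem _, Or.inr (by rw [hz']; exact hle)⟩,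
        fun r hr hm => ?_⟩
      rcases harc.mem_switchLine ⟨r, hr, rfl⟩ hm with h3 | h3 <;> rw [h3]
      · exact Or.inl hs'
      · exact Or.inr hle
    · have hs' : y ≤ y₀ := hs'
      obtain ⟨t', ht', y', hy', hz', harc, -⟩ := B.left_arc h hy (hs'.trans h0)
        (B.not_canSlide_below (fun he => hL (le_antisymm h0 (he ▸ hs'))) (hs'.trans h0))
      have hle : y₁ ≤ y' := by
        have := hb.nested B.nondeg.2 (onLine_mem _) (onLine_mem _) (onLine_mem _) (onLine_mem _)
          harc (by rw [B.fm_eq, B.fm_eq]; exact mul_le_mul_of_nonneg_left (by linarith) B.posL.le)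
        rw [B.fm_eq, B.fm_eq] at this
        linarith [le_of_mul_le_mul_left this B.posL]
      refine ⟨t', ht', ⟨by rw [hz']; exact onLine_mem _, Or.inl (by rw [hz']; exact hle)⟩,
        fun r hr hm => ?_⟩
      rcases harc.mem_switchLine ⟨r, hr, rfl⟩ hm with h3 | h3 <;> rw [h3]
      · exact Or.inr hs'
      · exact Or.inl hle

/-- An orbit through both end points that leaves the lower one returns above it, and climbs. -/
lemma from_yL (h : Z.Cycle z T) (hL : ¬ Z.CanSlide (onLine yL)) (hm : onLine yR ∈ range z)
    (hz : z t = onLine yL) :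
    ∃ t' > t, ∃ y₁ > yL, z t' = onLine y₁ ∧ Z.VisibleLeft (onLine yL) ∧
      Z.LeftArc (onLine yL) (onLine y₁) (z '' Icc t t') ∧
      (y₁ < yR → ∃ t'' > t', z t'' = onLine yR ∧
        Z.SlidingArc (onLine y₁) (onLine yR) (z '' Icc t' t'')) := by
  obtain ⟨t', ht', y₁, hy₁, hz', harc, hst⟩ := B.left_arc h hz le_rfl hL
  have hne : yL < y₁ := by
    refine lt_of_le_of_ne hy₁ fun he => ?_
    subst he
    -- Returning exactly to the lower end would make this arc the whole orbit, which then misses the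
    -- upper end.
    rw [h.range_eq B.nondeg B.nonsingular ht' (hz.trans hz'.symm)] at hm
    rcases harc.mem_switchLine hm (onLine_mem _) with h1 | h1 <;>
      exact B.lt.ne' (onLine_inj.1 h1)
  refine ⟨t', ht', y₁, hne, hz', B.visibleLeft hst, harc, fun hlt => ?_⟩
  obtain ⟨t'', ht'', y', rfl | rfl, hz'', -, hsl⟩ := B.slide_arc h hz' (B.canSlide ⟨hne, hlt⟩)
  -- Sliding back down would also close the orbit without meeting `yR`.
  · rw [h.range_eq B.nondeg B.nonsingular (ht'.trans ht'') (hz.trans hz''.symm),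
      ← image_Icc_union z (le_of_lt ht') (le_of_lt ht'')] at hm
    rcases hm with h1 | h1
    · rcases harc.mem_switchLine h1 (onLine_mem _) with h1 | h1
      · exact absurd (onLine_inj.1 h1) B.lt.ne'
      · exact absurd (onLine_inj.1 h1) hlt.ne'
    · rw [hsl.eq_segment B.nonsingular, onLine_mem_segment, uIcc_of_ge hne.le] at h1
      exact absurd h1.2 (not_le.2 hlt)
  · exact ⟨t'', ht'', hz'', hsl⟩

end AttractiveBand

/-! ### Classification of the forward orbits on a band -/

/-- The possible shapes of an orbit that leaves the sliding segment into the right half plane. -/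
def RightClass (Z : PWLSystem) (yL yR : ℝ) (γ : Set Plane) : Prop :=
  (∃ y₀, yL < y₀ ∧ Z.RightLoop yR y₀ γ) ∨
  (∃ y₀ y₁, y₀ < yL ∧ yL < y₁ ∧ Z.BothSidesLoop yR y₀ y₁ γ) ∨
  (onLine yL ∈ γ ∧ onLine yR ∈ γ ∧ Z.ConfigOne γ)

namespace AttractiveBand

variable (B : Z.AttractiveBand yL yR)
include B

lemma sliding_lt {u v : ℝ} {C' : Set Plane} (hu : Z.SlidingArc (onLine u) (onLine yL) C)
    (hv : Z.SlidingArc (onLine v) (onLine yR) C') (h1 : u ∈ Ioo yL yR) (h2 : v ∈ Ioo yL yR) :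
    u < v :=
  hu.lt_of_down_of_up B.nonsingular hv (B.mem_sliding_iff.2 ⟨h1.1.le, h1.2.le⟩) h1.1 h2.2
    h2.1.le h1.2.le

/-- The orbits that start at the upper end point and land inside the sliding segment. -/
lemma class_of_inner (h : Z.Cycle z T) (hR : ¬ Z.CanSlide (onLine yR)) {t₀ t₁ : ℝ}
    (hz₀ : z t₀ = onLine yR) (ht₁ : t₀ < t₁) (hz₁ : z t₁ = onLine y₀)
    (hst : Z.RightStart (onLine yR)) (harc : Z.RightArc (onLine yR) (onLine y₀) (z '' Icc t₀ t₁))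
    (hy₀ : y₀ ∈ Ioo yL yR) :
    Z.RightClass yL yR (range z) ∨ Z.rot.RightClass (-yR) (-yL) (-range z) := by
  have hmem : onLine yR ∈ range z := ⟨t₀, hz₀⟩
  have hV := B.visibleRight hst
  obtain ⟨t₂, ht₂, y', rfl | rfl, hz₂, hL, hsl⟩ := B.slide_arc h hz₁ (B.canSlide hy₀)
  swap
  · refine Or.inl (Or.inl ⟨y₀, hy₀.1, hy₀.2, hV, fun y hy => B.attractive ⟨hy₀.1.trans hy.1, hy.2⟩,
      _, _, harc, hsl, ?_⟩)
    rw [h.range_eq B.nondeg B.nonsingular (ht₁.trans ht₂) (hz₀.trans hz₂.symm),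
      image_Icc_union z ht₁.le (le_of_lt ht₂)]
  obtain ⟨t₃, ht₃, y₁, hy₁, hz₃, hVL, hleft, hup⟩ := B.from_yL h hL hmem hz₂
  have hyL : onLine y' ∈ range z := ⟨t₂, hz₂⟩
  rcases lt_trichotomy y₁ yR with hlt | rfl | hgt
  · obtain ⟨t₄, ht₄, hz₄, hsl'⟩ := hup hlt
    refine Or.inl (Or.inr (Or.inr ⟨hyL, hmem, Or.inr (Or.inr (Or.inr ⟨yR, y', y₀, y₁, hy₀.1,
      B.sliding_lt hsl hsl' hy₀ ⟨hy₁, hlt⟩, hlt, hV, hVL, fun y hy => B.attractive hy,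
      _, _, _, _, harc, hsl, hleft, hsl', ?_⟩))⟩))
    rw [h.range_eq B.nondeg B.nonsingular (((ht₁.trans ht₂).trans ht₃).trans ht₄)
      (hz₀.trans hz₄.symm), image_Icc_union z ht₁.le (le_of_lt ht₂),
      image_Icc_union z (ht₁.trans ht₂).le (le_of_lt ht₃),
      image_Icc_union z ((ht₁.trans ht₂).trans ht₃).le (le_of_lt ht₄)]
  -- Here the left arc ends exactly at the upper tangency point. Started from the lower end and
  -- rotated, the orbit is configuration (c).
  · have e1 := hleft.rot
    have e2 := harc.rot
    have e3 := hsl.rot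
    rw [neg_onLine, neg_onLine] at e1 e2 e3
    have hVR : Z.rot.VisibleLeft (onLine (-y₁)) := by
      rw [← neg_onLine]; exact Z.rot_isSwap.visibleLeft hV
    have hVL' : Z.rot.VisibleRight (onLine (-y')) := by
      refine B.rot.visibleRight ?_
      obtain ⟨w, T', hT', hc, h0, -, hw, -⟩ := e1
      exact ⟨T', hT', w, h0, hc, hw⟩
    refine Or.inr (Or.inr (Or.inr ⟨by rw [← neg_onLine, Set.mem_neg, neg_neg]; exact hmem,
      by rw [← neg_onLine, Set.mem_neg, neg_neg]; exact hyL,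
      Or.inr (Or.inr (Or.inl ⟨-y', -y₁, -y₀, hVR, neg_lt_neg hy₀.2, neg_lt_neg hy₀.1,
      hVL', fun y hy => B.rot.attractive ⟨(neg_lt_neg hy₀.2).trans_le hy.1, hy.2⟩,
      _, _, _, e1, e2, e3, ?_⟩))⟩))
    rw [h.range_eq B.nondeg B.nonsingular ((ht₁.trans ht₂).trans ht₃) (hz₀.trans hz₃.symm),
      ← union_neg, ← union_neg, union_assoc, image_Icc_union z ht₁.le (le_of_lt ht₂), union_comm,
      image_Icc_union z (ht₁.trans ht₂).le (le_of_lt ht₃)]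
  -- Landing above `yR` is impossible: the next right arc lies outside the first one and lands at
  -- `y₂ ≤ y₀`. If it lands at or below the lower end, the orbit spirals outwards; if it slides
  -- down, the orbit closes without `yR`; if it slides up, ascent starts at or below a starting
  -- point of descent.
  · exfalso
    obtain ⟨t₄, ht₄, y₂, hy₂, hz₄, hright, -⟩ := B.right_arc h hz₃ hgt.le
      (B.not_canSlide_above hR hgt.le)
    have hle : y₂ ≤ y₀ := by
      have := harc.nested B.nondeg.1 (onLine_mem _) (onLine_mem _) (onLine_mem _) (onLine_mem _)
        hright (by rw [B.fp_yR]; exact B.fp_nonneg hgt.le)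
      rw [B.fp_eq, B.fp_eq] at this
      linarith [le_of_mul_le_mul_left this B.posR]
    rcases le_or_gt y₂ y' with hle' | hgt'
    · have e1 := hleft.rot
      have e2 := hright.rot
      rw [neg_onLine, neg_onLine] at e1 e2
      exact B.rot.no_spiral h.rot (by rwa [rot_canSlide_onLine, neg_neg])
        (fun _ => by rwa [rot_canSlide_onLine, neg_neg]) (neg_le_neg hgt.le) (neg_le_neg hle')
        e1 e2 (t := t₄) (by rw [hz₄, neg_onLine])
    · have hy₂' : y₂ ∈ Ioo y' yR := ⟨hgt', hle.trans_lt hy₀.2⟩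
      obtain ⟨t₅, ht₅, y'', rfl | rfl, hz₅, -, hsl'⟩ := B.slide_arc h hz₄ (B.canSlide hy₂')
      · rw [h.range_eq B.nondeg B.nonsingular ((ht₃.trans ht₄).trans ht₅) (hz₂.trans hz₅.symm),
          ← image_Icc_union z (ht₃.trans ht₄).le (le_of_lt ht₅),
          ← image_Icc_union z (le_of_lt ht₃) (le_of_lt ht₄)] at hmem
        rcases hmem with (h1 | h1) | h1
        · rcases hleft.mem_switchLine h1 (onLine_mem _) with h1 | h1
          · exact B.lt.ne' (onLine_inj.1 h1)
          · exact hgt.ne (onLine_inj.1 h1)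
        · rcases hright.mem_switchLine h1 (onLine_mem _) with h1 | h1
          · exact hgt.ne (onLine_inj.1 h1)
          · exact hy₂'.2.ne' (onLine_inj.1 h1)
        · rw [hsl'.eq_segment B.nonsingular, onLine_mem_segment, uIcc_of_ge hgt'.le] at h1
          exact absurd h1.2 (not_le.2 hy₂'.2)
      · exact absurd (B.sliding_lt hsl hsl' hy₀ hy₂') (not_lt.2 hle)

/-- The orbits that start at the upper end point and land below the sliding segment. -/
lemma class_of_outer (h : Z.Cycle z T) (hR : ¬ Z.CanSlide (onLine yR)) {t₀ t₁ : ℝ}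
    (hz₀ : z t₀ = onLine yR) (ht₁ : t₀ < t₁) (hz₁ : z t₁ = onLine y₀)
    (hst : Z.RightStart (onLine yR)) (harc : Z.RightArc (onLine yR) (onLine y₀) (z '' Icc t₀ t₁))
    (hy₀ : y₀ < yL) : Z.RightClass yL yR (range z) := by
  have hmem : onLine yR ∈ range z := ⟨t₀, hz₀⟩
  have hV := B.visibleRight hst
  obtain ⟨t₂, ht₂, y₁, hy₁, hz₂, hleft, -⟩ := B.left_arc h hz₁ hy₀.le
    (B.not_canSlide_below (fun he => absurd he hy₀.ne) hy₀.le)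
  have nest : ∀ {y₂ : ℝ} {C : Set Plane}, Z.LeftArc (onLine yL) (onLine y₂) C → y₂ ≤ y₁ :=
    fun hl => by
      have := hl.nested B.nondeg.2 (onLine_mem _) (onLine_mem _) (onLine_mem _) (onLine_mem _)
        hleft (by rw [B.fm_yL]; exact B.fm_nonpos hy₀.le)
      rw [B.fm_eq, B.fm_eq] at this
      linarith [le_of_mul_le_mul_left this B.posL]
  rcases le_or_gt yR y₁ with hge | hlt
  · exact (B.no_spiral h hR (fun he => absurd he hy₀.ne) hy₀.le hge harc hleft hz₂).elim
  rcases eq_or_lt_of_le hy₁ with rfl | hgt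
  · exfalso
    -- Arriving tangentially shows that the lower tangency is visible, so sliding is impossible
    -- there. The orbit must then leave along a left arc, which by nestedness cannot end above the
    -- point `yL` itself.
    have htan := hleft.end_tangent B.nondeg.2 (onLine_mem _) B.fm_yL
    have hL : ¬ Z.CanSlide (onLine yL) := by
      refine not_canSlide_of_outward B.nonsingular (by rw [normalProd, B.fm_yL, mul_zero]) ?_
      rw [inwardRate_of_fm_eq_zero B.fm_yL (B.fp_neg B.lt).ne]
      exact mul_pos_of_neg_of_neg (B.fp_neg B.lt) htan
    obtain ⟨t₃, ht₃, y₂, hy₂, -, -, hleft', -⟩ := B.from_yL h hL hmem hz₂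
    exact absurd (nest hleft') (not_le.2 hy₂)
  obtain ⟨t₃, ht₃, y', rfl | rfl, hz₃, hn, hsl⟩ := B.slide_arc h hz₂ (B.canSlide ⟨hgt, hlt⟩)
  · exfalso
    -- After a descent to the lower end, the inner left arc would land at or below `y₁` and climb
    -- from there, against the order of descent and ascent.
    obtain ⟨t₄, ht₄, y₂, hy₂, hz₄, -, hleft', hup⟩ := B.from_yL h hn hmem hz₃
    have hle := nest hleft'
    obtain ⟨t₅, ht₅, -, hsl'⟩ := hup (hle.trans_lt hlt)
    exact absurd (B.sliding_lt hsl hsl' ⟨hgt, hlt⟩ ⟨hy₂, hle.trans_lt hlt⟩) (not_lt.2 hle)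
  · refine Or.inr (Or.inl ⟨y₀, y₁, hy₀, hgt, hy₀.trans hgt, hlt, hV,
      fun y hy => B.attractive ⟨hgt.trans_le hy.1, hy.2⟩, _, _, _, harc, hleft, hsl, ?_⟩)
    rw [h.range_eq B.nondeg B.nonsingular ((ht₁.trans ht₂).trans ht₃) (hz₀.trans hz₃.symm),
      image_Icc_union z ht₁.le (le_of_lt ht₂), image_Icc_union z (ht₁.trans ht₂).le (le_of_lt ht₃)]

/-- The orbits that start at the upper end point and land at the lower one. -/
lemma class_of_yL (h : Z.Cycle z T) (hR : ¬ Z.CanSlide (onLine yR)) {t₀ t₁ : ℝ}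
    (hz₀ : z t₀ = onLine yR) (ht₁ : t₀ < t₁) (hz₁ : z t₁ = onLine yL)
    (hst : Z.RightStart (onLine yR))
    (harc : Z.RightArc (onLine yR) (onLine yL) (z '' Icc t₀ t₁)) :
    Z.RightClass yL yR (range z) := by
  have hmem : onLine yR ∈ range z := ⟨t₀, hz₀⟩
  have hV := B.visibleRight hst
  refine Or.inr (Or.inr ⟨⟨t₁, hz₁⟩, hmem, ?_⟩)
  by_cases hL : Z.CanSlide (onLine yL)
  · obtain ⟨t₂, ht₂, y', rfl | rfl, hz₂, hn, hsl⟩ := B.slide_arc h hz₁ hL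
    · exact absurd hL hn
    -- Sliding up out of the lower end happens at a positive rate, which makes that point an
    -- invisible tangency of the left system: the limit case of configuration (a).
    have hpos := hsl.scalarField_pos B.nonsingular hL.mem B.lt
    rw [scalarField_of_fm_eq_zero B.fm_yL (B.fp_neg B.lt).ne] at hpos
    refine Or.inl ⟨y', yL, Or.inr (invisibleLeft_of (onLine_mem _) B.fm_yL (mul_pos B.posL hpos)
      (B.fp_neg B.lt).ne), B.lt, hV, fun y hy => B.attractive hy, _, _, harc, hsl, ?_⟩
    rw [h.range_eq B.nondeg B.nonsingular (ht₁.trans ht₂) (hz₀.trans hz₂.symm),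
      image_Icc_union z ht₁.le (le_of_lt ht₂)]
  · obtain ⟨t₂, ht₂, y₁, hy₁, hz₂, hVL, hleft, hup⟩ := B.from_yL h hL hmem hz₁
    rcases le_or_gt yR y₁ with hge | hlt
    · exact (B.no_spiral h hR (fun _ => hL) le_rfl hge harc hleft hz₂).elim
    obtain ⟨t₃, ht₃, hz₃, hsl⟩ := hup hlt
    refine Or.inr (Or.inr (Or.inl ⟨yR, yL, y₁, hVL, hy₁, hlt, hV,
      fun y hy => B.attractive ⟨hy₁.trans_le hy.1, hy.2⟩, _, _, _, harc, hleft, hsl, ?_⟩))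
    rw [h.range_eq B.nondeg B.nonsingular ((ht₁.trans ht₂).trans ht₃) (hz₀.trans hz₃.symm),
      image_Icc_union z ht₁.le (le_of_lt ht₂), image_Icc_union z (ht₁.trans ht₂).le (le_of_lt ht₃)]

lemma class_of_yR (h : Z.Cycle z T) (hR : ¬ Z.CanSlide (onLine yR)) {t₀ : ℝ}
    (hz₀ : z t₀ = onLine yR) :
    Z.RightClass yL yR (range z) ∨ Z.rot.RightClass (-yR) (-yL) (-range z) := by
  obtain ⟨t₁, ht₁, y₀, hy₀, hz₁, harc, hst⟩ := B.right_arc h hz₀ le_rfl hR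
  rcases eq_or_lt_of_le hy₀ with rfl | hlt
  -- An arc that returns to `yR` itself would be the whole orbit and would meet the line only where
  -- sliding is impossible.
  · exfalso
    obtain ⟨s, -, hs⟩ := h.exists_canSlide 0
    have hm : z s ∈ range z := ⟨s, rfl⟩
    rw [h.range_eq B.nondeg B.nonsingular ht₁ (hz₀.trans hz₁.symm)] at hm
    rcases harc.mem_switchLine hm hs.mem.1 with h1 | h1 <;> rw [h1] at hs <;> exact hR hs
  rcases lt_trichotomy y₀ yL with h1 | rfl | h1
  · exact Or.inl (B.class_of_outer h hR hz₀ ht₁ hz₁ hst harc h1)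
  · exact Or.inl (B.class_of_yL h hR hz₀ ht₁ hz₁ hst harc)
  · exact B.class_of_inner h hR hz₀ ht₁ hz₁ hst harc ⟨h1, hlt⟩

/-- Every sliding periodic orbit leaves the sliding segment at one of its end points. -/
lemma exists_exit (h : Z.Cycle z T) :
    (∃ t, z t = onLine yR ∧ ¬ Z.CanSlide (onLine yR)) ∨
    (∃ t, z t = onLine yL ∧ ¬ Z.CanSlide (onLine yL)) := by
  obtain ⟨t, -, ht⟩ := h.exists_canSlide 0
  obtain ⟨y, hy⟩ : ∃ y, z t = onLine y := ⟨_, eq_onLine ht.mem.1⟩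
  obtain ⟨t', -, y', rfl | rfl, hz, hn, -⟩ := B.slide_arc h hy (hy ▸ ht)
  · exact Or.inr ⟨t', hz, hn⟩
  · exact Or.inl ⟨t', hz, hn⟩

lemma class_of_cycle (h : Z.Cycle z T) :
    Z.RightClass yL yR (range z) ∨ Z.rot.RightClass (-yR) (-yL) (-range z) := by
  rcases B.exists_exit h with ⟨t, hz, hn⟩ | ⟨t, hz, hn⟩
  · exact B.class_of_yR h hn hz
  · have := B.rot.class_of_yR h.rot (by rwa [rot_canSlide_onLine, neg_neg]) (t₀ := t)
      (by rw [hz, neg_onLine])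
    rw [range_neg_fun, rot_rot, neg_neg, neg_neg, neg_neg] at this
    exact this.symm

end AttractiveBand

end PWLSystem

namespace PWLSystem

variable {Z : PWLSystem} {z w : ℝ → Plane} {p q : Plane} {a b c t T : ℝ} {C γ : Set Plane}
  {yL yR y y₀ y₁ : ℝ}

lemma RightArc.rightStart (h : Z.RightArc p q C) : Z.RightStart p := by
  obtain ⟨w, T, hT, hc, h0, -, hw, -⟩ := h
  exact ⟨T, hT, w, h0, hc, hw⟩

lemma SlidingArc.canSlide (h : Z.SlidingArc p q C) : Z.CanSlide p := by
  obtain ⟨w, T, hT, h0, -, hw, -⟩ := h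
  exact ⟨T, hT, w, h0, hw.mono Ico_subset_Icc_self⟩

lemma Nonsingular.reverse (h : Z.Nonsingular) : Z.reverse.Nonsingular := fun y h1 h2 =>
  h y (by simpa using h1) (by simpa using h2)

/-! ### Normal forms -/

/-- `Z'` is a normal form of `Z`, by an equivalence from `Z` or from its time reversal that
respects the sliding periodic orbits. -/
structure Models (Z Z' : PWLSystem) (h : Plane ≃ₜ Plane) : Prop where
  nondeg : Z'.Nondegenerate
  equiv : IsSigmaEquivalence Z Z' h ∨ IsSigmaEquivalence Z.reverse Z' h
  orbits : Z'.slidingPeriodicOrbits = image h '' Z.slidingPeriodicOrbits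

lemma image_trans (h k : Plane ≃ₜ Plane) (s : Set Plane) : h.trans k '' s = k '' (h '' s) :=
  image_comp k h s

lemma IsSigmaEquivalence.trans {Z₁ Z₂ : PWLSystem} {h k : Plane ≃ₜ Plane}
    (h₁ : IsSigmaEquivalence Z Z₁ h) (h₂ : IsSigmaEquivalence Z₁ Z₂ k) :
    IsSigmaEquivalence Z Z₂ (h.trans k) := by
  refine ⟨?_, fun p => ⟨?_, ?_⟩⟩ <;> rw [image_trans]
  · rw [h₁.1, h₂.1]
  · rw [(h₁.2 p).1, (h₂.2 _).1]; rfl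
  · rw [(h₁.2 p).2, (h₂.2 _).2]; rfl

lemma IsSigmaEquivalence.reverse {Z' : PWLSystem} {h : Plane ≃ₜ Plane}
    (e : IsSigmaEquivalence Z Z' h) : IsSigmaEquivalence Z.reverse Z'.reverse h :=
  ⟨e.1, fun p => ⟨(e.2 p).2, by
    simpa only [backwardOrbit, reverse_reverse] using (e.2 p).1⟩⟩

lemma Models.trans {Z₁ Z₂ : PWLSystem} {h k : Plane ≃ₜ Plane} (m₁ : Models Z Z₁ h)
    (m₂ : Models Z₁ Z₂ k) : Models Z Z₂ (h.trans k) where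
  nondeg := m₂.nondeg
  equiv := by
    rcases m₁.equiv with e₁ | e₁ <;> rcases m₂.equiv with e₂ | e₂
    · exact Or.inl (e₁.trans e₂)
    · exact Or.inr (e₁.reverse.trans e₂)
    · exact Or.inr (e₁.trans e₂)
    · exact Or.inl ((by simpa using e₁.reverse : IsSigmaEquivalence Z Z₁.reverse h).trans e₂)
  orbits := by
    rw [m₂.orbits, m₁.orbits, image_image]
    exact image_congr fun s _ => (image_trans h k s).symm

lemma IsConj.models {Z' : PWLSystem} {S : Plane ≃L[ℝ] Plane} (h : IsConj Z Z' S)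
    (hN : Z'.Nondegenerate) : Models Z Z' S.toHomeomorph :=
  ⟨hN, Or.inl h.isSigmaEquivalence, h.slidingPeriodicOrbits⟩

lemma isSigmaEquivalence_refl (Z : PWLSystem) : IsSigmaEquivalence Z Z (Homeomorph.refl Plane) := by
  simp [IsSigmaEquivalence]

lemma models_refl (hN : Z.Nondegenerate) : Models Z Z (Homeomorph.refl Plane) :=
  ⟨hN, Or.inl Z.isSigmaEquivalence_refl, by simp⟩

lemma models_reverse (hN : Z.Nondegenerate) : Models Z Z.reverse (Homeomorph.refl Plane) :=
  ⟨hN.reverse, Or.inr Z.reverse.isSigmaEquivalence_refl, by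
    simp [slidingPeriodicOrbits_reverse]⟩

lemma models_rot (hN : Z.Nondegenerate) :
    Models Z Z.rot (ContinuousLinearEquiv.neg ℝ : Plane ≃L[ℝ] Plane).toHomeomorph :=
  IsConj.models (Or.inr Z.rot_isSwap) hN.rot

lemma image_refl (s : Set Plane) : Homeomorph.refl Plane '' s = s := image_id s

lemma image_neg_toHomeomorph (s : Set Plane) :
    (ContinuousLinearEquiv.neg ℝ : Plane ≃L[ℝ] Plane).toHomeomorph '' s = -s :=
  image_neg_eq_neg (s := s)

/-- The system has at most two sliding periodic orbits, and it has a normal form that displays one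
of the configurations if it has one or two of them. -/
def HasConfigurations (Z : PWLSystem) : Prop :=
  Z.slidingPeriodicOrbits.encard ≤ 2 ∧
  (∀ γ, Z.slidingPeriodicOrbits = {γ} → ∃ Z' h, Models Z Z' h ∧ Z'.ConfigOne (h '' γ)) ∧
  (∀ γ₁ γ₂, γ₁ ≠ γ₂ → Z.slidingPeriodicOrbits = {γ₁, γ₂} → ∃ Z' h, Models Z Z' h ∧
    (Z'.ConfigTwo (h '' γ₁) (h '' γ₂) ∨ Z'.ConfigTwo (h '' γ₂) (h '' γ₁)))

lemma HasConfigurations.of_models {N : PWLSystem} {k : Plane ≃ₜ Plane} (m : Models Z N k)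
    (hN : N.HasConfigurations) : Z.HasConfigurations := by
  obtain ⟨h0, h1, h2⟩ := hN
  refine ⟨?_, fun γ hγ => ?_, fun γ₁ γ₂ hne hγ => ?_⟩
  · rwa [m.orbits, (image_injective.2 k.injective).encard_image] at h0
  · obtain ⟨Z', h, m', hc⟩ := h1 (k '' γ) (by rw [m.orbits, hγ, image_singleton])
    exact ⟨Z', k.trans h, m.trans m', by rwa [image_trans]⟩
  · obtain ⟨Z', h, m', hc⟩ := h2 (k '' γ₁) (k '' γ₂)
      ((image_injective.2 k.injective).ne hne) (by rw [m.orbits, hγ, image_pair])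
    exact ⟨Z', k.trans h, m.trans m', by simpa only [image_trans] using hc⟩

lemma hasConfigurations_of_empty (h : Z.slidingPeriodicOrbits = ∅) : Z.HasConfigurations := by
  refine ⟨by simp [h], fun γ hγ => ?_, fun γ₁ γ₂ _ hγ => ?_⟩
  · exact absurd (h.symm.trans hγ).symm (singleton_ne_empty γ)
  · exact absurd (h.symm.trans hγ).symm (insert_nonempty _ _).ne_empty

lemma hasConfigurations_of_unique (hN : Z.Nondegenerate)
    (h : ∀ γ' ∈ Z.slidingPeriodicOrbits, γ' = γ) (hc : Z.ConfigOne γ) : Z.HasConfigurations := by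
  refine ⟨?_, fun γ' hγ' => ⟨Z, _, models_refl hN, ?_⟩, fun γ₁ γ₂ hne hγ => ?_⟩
  · refine le_trans (encard_le_one_iff.2 fun γ₁ γ₂ h₁ h₂ => (h _ h₁).trans (h _ h₂).symm) ?_
    norm_num
  · rw [image_refl, h γ' (hγ' ▸ mem_singleton γ')]; exact hc
  · exact absurd ((h γ₁ (by simp [hγ])).trans (h γ₂ (by simp [hγ])).symm) hne

/-! ### Backward orbits on an attractive segment -/

/-- A right arc from the upper end point of the sliding segment to the lower one, together with a
sliding arc back. -/
def FullLoop (Z : PWLSystem) (yL yR : ℝ) (γ : Set Plane) : Prop :=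
  ∃ C₁ C₂, Z.RightArc (onLine yR) (onLine yL) C₁ ∧ Z.SlidingArc (onLine yL) (onLine yR) C₂ ∧
    γ = C₁ ∪ C₂

namespace AttractiveBand

variable (B : Z.AttractiveBand yL yR)
include B

lemma reverse_mem_sliding_iff : onLine y ∈ Z.reverse.sliding ↔ y ∈ Icc yL yR := by
  rw [reverse_sliding, B.mem_sliding_iff]

lemma reverse_canSlide (h : y ∈ Ioo yL yR) : Z.reverse.CanSlide (onLine y) :=
  canSlide_of_neg (by
    have := mul_neg_of_neg_of_pos (B.fp_neg h.2) (B.fm_pos h.1)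
    simpa [normalProd] using this)

lemma reverse_rightArc_end_ge (h : Z.reverse.RightArc p (onLine y) C) : yR ≤ y := by
  by_contra! hlt
  have h1 := h.end_nonpos (onLine_mem _)
  have h2 := B.fp_neg hlt
  rw [reverse_fp, Pi.neg_apply] at h1
  linarith

lemma reverse_leftArc_end_le (h : Z.reverse.LeftArc p (onLine y) C) : y ≤ yL := by
  by_contra! hlt
  have h1 := h.end_nonneg (onLine_mem _)
  have h2 := B.fm_pos hlt
  rw [reverse_fm, Pi.neg_apply] at h1
  linarith

lemma reverse_rightArc_nested {y' : ℝ} {C' : Set Plane}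
    (h : Z.reverse.RightArc (onLine yL) (onLine y₀) C)
    (h' : Z.reverse.RightArc (onLine y) (onLine y') C') (hy : y ≤ yL) : y₀ ≤ y' := by
  have := h.nested B.nondeg.reverse.1 (onLine_mem _) (onLine_mem _) (onLine_mem _) (onLine_mem _)
    h' (by
      rw [reverse_fp, reverse_fp, Pi.neg_apply, Pi.neg_apply, B.fp_eq, B.fp_eq]
      nlinarith [B.posR])
  rw [reverse_fp, reverse_fp, Pi.neg_apply, Pi.neg_apply, B.fp_eq, B.fp_eq, neg_le_neg_iff] at this
  linarith [le_of_mul_le_mul_left this B.posR]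

/-- In backward time, an orbit that leaves the lower end point cannot leave the sliding segment
for good. -/
lemma reverse_no_spiral (h : Z.reverse.Cycle z T) (hL : ¬ Z.reverse.CanSlide (onLine yL))
    (h1 : yR ≤ y₀) (hR : y₀ = yR → ¬ Z.reverse.CanSlide (onLine yR))
    (ha : Z.reverse.RightArc (onLine yL) (onLine y₀) C) (hz : z t = onLine y₀) : False := by
  -- Backward left arcs end at or below `yL` wherever they start, and nestedness sends right arcs
  -- from there to points at or above `y₀`. A right start above the band is excluded because sliding
  -- would be possible.
  let P := {s | z s ∈ switchLine ∧ (z s 1 ≤ yL ∨ y₀ ≤ z s 1)}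
  have c0 : Continuous fun s => z s 1 := (continuous_apply 1).comp h.cont
  have hP : IsClosed P := (isClosed_switchLine.preimage h.cont).inter
    ((isClosed_le c0 continuous_const).union (isClosed_le continuous_const c0))
  have hout : ∀ y, (y ≤ yL ∨ y₀ ≤ y) → ¬ Z.reverse.CanSlide (onLine y) := by
    intro y hy hc
    have hm := B.reverse_mem_sliding_iff.1 hc.mem
    rcases hy with hy | hy
    · rw [le_antisymm hy hm.1] at hc; exact hL hc
    · rw [le_antisymm hm.2 (h1.trans hy)] at hc
      exact hR (le_antisymm (hy.trans hm.2) h1) hc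
  have key := forall_mem_of_recurrence (z := z)
    (C := {q | q ∈ switchLine → q 1 ≤ yL ∨ y₀ ≤ q 1}) hP ?_ (t₀ := t)
    (by simp [P, hz, onLine_mem])
  · obtain ⟨s, hs, hc⟩ := h.exists_canSlide t
    obtain ⟨y, hy⟩ : ∃ y, z s = onLine y := ⟨_, eq_onLine hc.mem.1⟩
    have h2 := key s hs.le
    rw [hy] at hc h2
    exact hout y (h2 (onLine_mem y)) hc
  · rintro s ⟨hs, hs'⟩
    obtain ⟨y, hy⟩ : ∃ y, z s = onLine y := ⟨_, eq_onLine hs⟩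
    rw [hy] at hs'
    have hs' : y ≤ yL ∨ y₀ ≤ y := hs'
    have hc := hout y hs'
    have hn := B.nondeg.reverse
    have hns := B.nonsingular.reverse
    rcases h.leave hy hc with ⟨t', ht', y', hz', hst, harc⟩ | ⟨t', ht', y', hz', hst, harc⟩
    · have hle : y₀ ≤ y' := by
        rcases hs' with hs' | hs'
        · exact B.reverse_rightArc_nested ha harc hs'
        · exact absurd (canSlide_of_rightStart hn hns hst (by
            have := B.fm_pos (B.lt.trans_le (h1.trans hs'))
            rw [reverse_fm, Pi.neg_apply]; linarith)) hc
      refine ⟨t', ht', ⟨by rw [hz']; exact onLine_mem _, Or.inr (by rw [hz']; exact hle)⟩,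
        fun r hr hm => ?_⟩
      rcases harc.mem_switchLine ⟨r, hr, rfl⟩ hm with h3 | h3 <;> rw [h3]
      · exact hs'
      · exact Or.inr hle
    · have hle := B.reverse_leftArc_end_le harc
      refine ⟨t', ht', ⟨by rw [hz']; exact onLine_mem _, Or.inl (by rw [hz']; exact hle)⟩,
        fun r hr hm => ?_⟩
      rcases harc.mem_switchLine ⟨r, hr, rfl⟩ hm with h3 | h3 <;> rw [h3]
      · exact hs'
      · exact Or.inl hle

lemma fullLoop_of_exit (h : Z.reverse.Cycle z T) (hL : ¬ Z.reverse.CanSlide (onLine yL))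
    (hz : z t = onLine yL) : Z.FullLoop yL yR (range z) := by
  have hn := B.nondeg.reverse
  have hns := B.nonsingular.reverse
  rcases h.leave hz hL with ⟨t', ht', y', hz', hst, harc⟩ | ⟨t', ht', y', hz', hst, harc⟩
  swap
  · exact absurd (canSlide_of_leftStart hn hns hst (by
      have := B.fp_neg B.lt
      rw [reverse_fp, Pi.neg_apply]; linarith)) hL
  have hge := B.reverse_rightArc_end_ge harc
  obtain ⟨rfl, hR⟩ : y' = yR ∧ Z.reverse.CanSlide (onLine yR) := by
    by_contra hne
    exact B.reverse_no_spiral h hL hge (fun he hc => hne ⟨he, hc⟩) harc hz'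
  obtain ⟨t'', ht'', y'', hz'', hc, hm, hsl⟩ := h.slide hns hz' hR
  have hy'' : y'' = yL := by
    have := B.reverse_mem_sliding_iff.1 hm
    by_contra hne
    rcases this.2.eq_or_lt with rfl | hlt
    · exact hc hR
    · exact hc (B.reverse_canSlide ⟨this.1.lt_of_ne (Ne.symm hne), hlt⟩)
  subst hy''
  have e1 := harc.reverse
  have e2 := hsl.reverse
  rw [reverse_reverse] at e1 e2
  refine ⟨_, _, e1, e2, ?_⟩
  rw [h.range_eq hn hns (ht'.trans ht'') (hz.trans hz''.symm),
    image_Icc_union z (le_of_lt ht') (le_of_lt ht'')]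

lemma fullLoop_of_reverse (h : Z.reverse.Cycle z T) :
    Z.FullLoop yL yR (range z) ∨ Z.rot.FullLoop (-yR) (-yL) (-range z) := by
  obtain ⟨t, -, ht⟩ := h.exists_canSlide 0
  obtain ⟨y, hy⟩ : ∃ y, z t = onLine y := ⟨_, eq_onLine ht.mem.1⟩
  obtain ⟨t', -, y', hz, hn, hm, -⟩ := h.slide B.nonsingular.reverse hy (hy ▸ ht)
  have hI := B.reverse_mem_sliding_iff.1 hm
  rcases hI.1.eq_or_lt with rfl | h1
  · exact Or.inl (B.fullLoop_of_exit h hn hz)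
  rcases hI.2.eq_or_lt with rfl | h2
  · right
    have hr := h.rot
    rw [← rot_reverse] at hr
    have := B.rot.fullLoop_of_exit hr (t := t')
      (by rwa [rot_reverse, rot_canSlide_onLine, neg_neg]) (by rw [hz, neg_onLine])
    rwa [range_neg_fun] at this
  · exact absurd (B.reverse_canSlide ⟨h1, h2⟩) hn

lemma configOne_of_fullLoop (hf : Z.FullLoop yL yR γ) : Z.ConfigOne γ := by
  obtain ⟨C₁, C₂, harc, hsl, rfl⟩ := hf
  have hpos := hsl.scalarField_pos B.nonsingular hsl.canSlide.mem B.lt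
  rw [scalarField_of_fm_eq_zero B.fm_yL (B.fp_neg B.lt).ne] at hpos
  exact Or.inl ⟨yR, yL, Or.inr (invisibleLeft_of (onLine_mem _) B.fm_yL (mul_pos B.posL hpos)
    (B.fp_neg B.lt).ne), B.lt, B.visibleRight harc.rightStart, fun y hy => B.attractive hy,
    _, _, harc, hsl, rfl⟩

lemma eq_of_fullLoop (hf : Z.FullLoop yL yR γ) {γ' : Set Plane} (hf' : Z.FullLoop yL yR γ') :
    γ' = γ := by
  obtain ⟨C₁, C₂, h1, h2, rfl⟩ := hf
  obtain ⟨D₁, D₂, h1', h2', rfl⟩ := hf'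
  rw [(h1.unique (onLine_mem _) (onLine_mem _) h1').2, h2.eq_segment B.nonsingular,
    h2'.eq_segment B.nonsingular]

/-- Sliding out of the lower end is possible, so every forward orbit exits at the upper end, and the
right arc from there is determined. -/
lemma fullLoop_of_cycle (hf : Z.FullLoop yL yR γ) (h : Z.Cycle z T) :
    Z.FullLoop yL yR (range z) := by
  obtain ⟨C₁, C₂, h1, h2, rfl⟩ := hf
  rcases B.exists_exit h with ⟨t, hz, hn⟩ | ⟨t, hz, hn⟩
  swap
  · exact absurd h2.canSlide hn
  obtain ⟨t', ht', y', hy', hz', harc, -⟩ := B.right_arc h hz le_rfl hn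
  have hy := onLine_injective (h1.unique (onLine_mem _) (onLine_mem _) harc).1
  subst hy
  obtain ⟨t'', ht'', y'', rfl | rfl, hz'', hn', hsl⟩ := B.slide_arc h hz' h2.canSlide
  · exact absurd h2.canSlide hn'
  refine ⟨_, _, harc, hsl, ?_⟩
  rw [h.range_eq B.nondeg B.nonsingular (ht'.trans ht'') (hz.trans hz''.symm),
    image_Icc_union z (le_of_lt ht') (le_of_lt ht'')]

lemma hasConfigurations_of_fullLoop (hf : Z.FullLoop yL yR γ) : Z.HasConfigurations := by
  refine hasConfigurations_of_unique B.nondeg (γ := γ) (fun γ' hγ' => B.eq_of_fullLoop hf ?_)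
    (B.configOne_of_fullLoop hf)
  rcases hγ' with h' | h' <;> obtain ⟨w, T', hw, rfl⟩ := isForwardSlidingPeriodicOrbit_iff.1 h'
  · exact B.fullLoop_of_cycle hf hw
  -- The rotated alternative would contain a sliding arc from `yR` down to `yL`, opposite to the one
  -- in the given loop.
  · refine (B.fullLoop_of_reverse hw).resolve_right fun hr => ?_
    obtain ⟨D₁, D₂, -, hD, -⟩ := hr
    obtain ⟨C₁, C₂, -, hC, -⟩ := hf
    have := hD.rot
    rw [rot_rot, neg_onLine, neg_onLine, neg_neg, neg_neg] at this
    exact hC.not_both B.nonsingular B.lt this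

/-! ### Two forward orbits on an attractive segment -/

lemma configOneB_of_bothSides (h0 : y₀ < yL) (hb : Z.BothSidesLoop yR y₀ y₁ γ) :
    Z.ConfigOneB γ :=
  ⟨yR, y₀, y₁, ⟨onLine_mem _, mul_pos_of_neg_of_neg (B.fp_neg (h0.trans B.lt)) (by
    rw [B.fm_eq]; exact mul_neg_of_pos_of_neg B.posL (by linarith))⟩, hb⟩

lemma configOne_of_rightClass (h : Z.RightClass yL yR γ) : Z.ConfigOne γ := by
  rcases h with ⟨y₀, h0, h⟩ | ⟨y₀, y₁, h0, -, h⟩ | ⟨-, -, h⟩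
  · exact Or.inl ⟨yR, y₀, Or.inl (B.attractive ⟨h0, h.1⟩), h⟩
  · exact Or.inr (Or.inl (B.configOneB_of_bothSides h0 h))
  · exact h

end AttractiveBand

lemma RightLoop.mem (h : Z.RightLoop yR y₀ γ) : onLine yR ∈ γ := by
  obtain ⟨-, -, -, C₁, C₂, h1, -, rfl⟩ := h
  exact Or.inl h1.start_mem

lemma BothSidesLoop.mem (h : Z.BothSidesLoop yR y₀ y₁ γ) : onLine yR ∈ γ := by
  obtain ⟨-, -, -, -, C₁, C₂, C₃, h1, -, -, rfl⟩ := h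
  exact Or.inl (Or.inl h1.start_mem)

lemma RightClass.mem (h : Z.RightClass yL yR γ) : onLine yR ∈ γ := by
  rcases h with ⟨y₀, -, h⟩ | ⟨y₀, y₁, -, -, h⟩ | ⟨-, h, -⟩
  · exact h.mem
  · exact h.mem
  · exact h

namespace AttractiveBand

variable (B : Z.AttractiveBand yL yR)
include B

lemma configTwoB {φ : Set Plane} {u : ℝ} (h0 : yL < y₀) (h : Z.RightLoop yR y₀ γ)
    (hu : -yR < u) (h' : Z.rot.RightLoop (-yL) u (-φ)) : Z.ConfigTwo γ φ := by
  obtain ⟨h1, -, -, D₁, D₂, d1, d2, hD⟩ := h'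
  have hV := B.rot.visibleRight d1.rightStart
  have hV := Z.rot.rot_isSwap.visibleLeft hV
  replace d1 := d1.rot
  replace d2 := d2.rot
  rw [rot_rot] at hV
  simp only [rot_rot, neg_onLine, neg_neg] at d1 d2
  have hV : Z.VisibleLeft (onLine yL) := by
    have e : (ContinuousLinearEquiv.neg ℝ : Plane ≃L[ℝ] Plane) (onLine (-yL)) = onLine yL := by
      simp [neg_onLine]
    rwa [e] at hV
  obtain ⟨C₁, C₂, c1, c2, hC⟩ := h.2.2.2
  refine Or.inr (Or.inl ⟨yR, y₀, yL, -u, by linarith, B.sliding_lt d2 c2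
    ⟨by linarith, by linarith⟩ ⟨h0, h.1⟩, fun y hy => B.attractive hy, h, hV, _, _, d1, d2, ?_⟩)
  rw [← union_neg, ← hD, neg_neg]

lemma configTwoC {φ : Set Plane} {u v : ℝ} (h0 : yL < y₀) (h : Z.RightLoop yR y₀ γ)
    (hu : u < -yR) (hv : -yR < v) (h' : Z.rot.BothSidesLoop (-yL) u v (-φ)) :
    Z.ConfigTwo γ φ := by
  obtain ⟨-, h1, -, -, D₁, D₂, D₃, d1, d2, d3, hD⟩ := h'
  have hV := B.rot.visibleRight d1.rightStart
  have hV := Z.rot.rot_isSwap.visibleLeft hV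
  replace d1 := d1.rot
  replace d2 := d2.rot
  replace d3 := d3.rot
  rw [rot_rot] at hV
  simp only [rot_rot, neg_onLine, neg_neg] at d1 d2 d3
  have hV : Z.VisibleLeft (onLine yL) := by
    have e : (ContinuousLinearEquiv.neg ℝ : Plane ≃L[ℝ] Plane) (onLine (-yL)) = onLine yL := by
      simp [neg_onLine]
    rwa [e] at hV
  obtain ⟨C₁, C₂, c1, c2, hC⟩ := h.2.2.2
  refine Or.inr (Or.inr ⟨yR, y₀, yL, -u, -v, by linarith, B.sliding_lt d3 c2
    ⟨by linarith, by linarith⟩ ⟨h0, h.1⟩, by linarith, fun y hy => B.attractive hy, h, hV,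
    ⟨onLine_mem _, ?_⟩, _, _, _, d1, d2, d3, ?_⟩)
  · rw [B.fp_eq, B.fm_eq]
    exact mul_pos (mul_pos B.posR (by linarith)) (mul_pos B.posL (by linarith [B.lt]))
  · rw [← union_neg, ← union_neg, ← hD, neg_neg]

/-- The right arc of `φ` starts above `yR`, so it is nested outside that of `γ` and lands at or
below `y₀ < yL`; but it has to land above `yL` in order to slide. -/
lemma not_bothSides {φ : Set Plane} {u v : ℝ} (h0 : y₀ < yL) (h : Z.BothSidesLoop yR y₀ y₁ γ)
    (hu : u < -yR) (h' : Z.rot.BothSidesLoop (-yL) u v (-φ)) : False := by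
  obtain ⟨-, h1, -, -, D₁, D₂, D₃, d1, d2, d3, hD⟩ := h'
  replace d2 := d2.rot
  simp only [rot_rot, neg_onLine] at d2
  obtain ⟨C₁, C₂, C₃, c1, c2, c3, hC⟩ := h.2.2.2.2
  have := c1.nested B.nondeg.1 (onLine_mem _) (onLine_mem _) (onLine_mem _) (onLine_mem _)
    d2 (by rw [B.fp_yR]; exact B.fp_nonneg (by linarith))
  rw [B.fp_eq, B.fp_eq] at this
  linarith [le_of_mul_le_mul_left this B.posR]

lemma exists_configTwo {φ : Set Plane} (h : Z.RightClass yL yR γ) (hL : onLine yL ∉ γ)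
    (h' : Z.rot.RightClass (-yR) (-yL) (-φ)) (hR : onLine yR ∉ φ) :
    ∃ Z' k, Models Z Z' k ∧
      (Z'.ConfigTwo (k '' γ) (k '' φ) ∨ Z'.ConfigTwo (k '' φ) (k '' γ)) := by
  have hR' : onLine (-yR) ∉ -φ := by rwa [Set.mem_neg, neg_onLine, neg_neg]
  rcases h with ⟨y₀, h0, h⟩ | ⟨y₀, y₁, h0, h1, h⟩ | ⟨h, -⟩
  · refine ⟨Z, _, models_refl B.nondeg, Or.inl ?_⟩
    rw [image_refl, image_refl]
    rcases h' with ⟨u, hu, h'⟩ | ⟨u, v, hu, hv, h'⟩ | ⟨h', -⟩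
    · exact B.configTwoB h0 h hu h'
    · exact B.configTwoC h0 h hu hv h'
    · exact absurd h' hR'
  · rcases h' with ⟨u, hu, h'⟩ | ⟨u, v, hu, hv, h'⟩ | ⟨h', -⟩
    -- Now `γ` is the orbit that surrounds the other one; rotation exchanges their roles.
    · refine ⟨Z.rot, _, models_rot B.nondeg, Or.inr ?_⟩
      rw [image_neg_toHomeomorph, image_neg_toHomeomorph]
      refine B.rot.configTwoC (u := y₀) (v := y₁) hu h' (by rwa [neg_neg]) (by rwa [neg_neg]) ?_
      rwa [rot_rot, neg_neg, neg_neg]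
    · exact (B.not_bothSides h0 h hu h').elim
    · exact absurd h' hR'
  -- An orbit through both end points would meet the other one, so this shape does not occur in a
  -- pair.
  · exact absurd h hL

/-- Every orbit passes through one of the two end points, and orbits with a common point coincide.
This gives the bound and puts the two orbits of a pair at opposite ends. -/
lemma hasConfigurations_of_forward (hb : ∀ γ, ¬ Z.reverse.IsForwardSlidingPeriodicOrbit γ) :
    Z.HasConfigurations := by
  have hcyc : ∀ γ ∈ Z.slidingPeriodicOrbits, ∃ z T, Z.Cycle z T ∧ γ = range z := fun γ hγ =>
    isForwardSlidingPeriodicOrbit_iff.1 (hγ.resolve_right (hb γ))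
  have hcls : ∀ γ ∈ Z.slidingPeriodicOrbits,
      Z.RightClass yL yR γ ∨ Z.rot.RightClass (-yR) (-yL) (-γ) := fun γ hγ => by
    obtain ⟨z, T, hz, rfl⟩ := hcyc γ hγ
    exact B.class_of_cycle hz
  have hrot : ∀ γ, Z.rot.RightClass (-yR) (-yL) (-γ) → onLine yL ∈ γ := fun γ hγ => by
    simpa [neg_onLine] using hγ.mem
  have hmeet : ∀ γ₁ ∈ Z.slidingPeriodicOrbits, ∀ γ₂ ∈ Z.slidingPeriodicOrbits, ∀ p ∈ γ₁, p ∈ γ₂ →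
      γ₁ = γ₂ := fun γ₁ h₁ γ₂ h₂ p hp₁ hp₂ => by
    obtain ⟨z, T, hz, rfl⟩ := hcyc γ₁ h₁
    obtain ⟨w, T', hw, rfl⟩ := hcyc γ₂ h₂
    exact hz.range_eq_of_meet B.nondeg B.nonsingular hw ⟨p, hp₁, hp₂⟩
  refine ⟨?_, fun γ hγ => ?_, fun γ₁ γ₂ hne hγ => ?_⟩
  · have hsub : Z.slidingPeriodicOrbits ⊆ {γ ∈ Z.slidingPeriodicOrbits | onLine yR ∈ γ} ∪
        {γ ∈ Z.slidingPeriodicOrbits | onLine yL ∈ γ} := fun γ hγ =>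
      (hcls γ hγ).imp (fun h => ⟨hγ, h.mem⟩) (fun h => ⟨hγ, hrot γ h⟩)
    refine (encard_le_encard hsub).trans ((encard_union_le _ _).trans ?_)
    rw [← one_add_one_eq_two]
    exact add_le_add
      (encard_le_one_iff.2 fun γ₁ γ₂ h₁ h₂ => hmeet γ₁ h₁.1 γ₂ h₂.1 _ h₁.2 h₂.2)
      (encard_le_one_iff.2 fun γ₁ γ₂ h₁ h₂ => hmeet γ₁ h₁.1 γ₂ h₂.1 _ h₁.2 h₂.2)
  · rcases hcls γ (by simp [hγ]) with h | h
    · refine ⟨Z, _, models_refl B.nondeg, ?_⟩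
      rw [image_refl]
      exact B.configOne_of_rightClass h
    · refine ⟨Z.rot, _, models_rot B.nondeg, ?_⟩
      rw [image_neg_toHomeomorph]
      exact B.rot.configOne_of_rightClass h
  · have m₁ : γ₁ ∈ Z.slidingPeriodicOrbits := by simp [hγ]
    have m₂ : γ₂ ∈ Z.slidingPeriodicOrbits := by simp [hγ]
    have hdis : ∀ p ∈ γ₁, p ∉ γ₂ := fun p h₁ h₂ => hne (hmeet _ m₁ _ m₂ p h₁ h₂)
    rcases hcls γ₁ m₁ with h₁ | h₁ <;> rcases hcls γ₂ m₂ with h₂ | h₂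
    · exact absurd h₂.mem (hdis _ h₁.mem)
    · exact B.exists_configTwo h₁ (fun h => hdis _ h (hrot _ h₂)) h₂ (hdis _ h₁.mem)
    · obtain ⟨Z', k, m, hc⟩ := B.exists_configTwo h₂ (hdis _ (hrot _ h₁)) h₁
        (fun h => hdis _ h h₂.mem)
      exact ⟨Z', k, m, hc.symm⟩
    · exact absurd (hrot _ h₂) (hdis _ (hrot _ h₁))

theorem hasConfigurations : Z.HasConfigurations := by
  by_cases hb : ∃ γ, Z.reverse.IsForwardSlidingPeriodicOrbit γ
  · obtain ⟨γ, hγ⟩ := hb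
    obtain ⟨z, T, hz, rfl⟩ := isForwardSlidingPeriodicOrbit_iff.1 hγ
    rcases B.fullLoop_of_reverse hz with h | h
    · exact B.hasConfigurations_of_fullLoop h
    · exact (B.rot.hasConfigurations_of_fullLoop h).of_models (models_rot B.nondeg)
  · exact B.hasConfigurations_of_forward (not_exists.1 hb)

end AttractiveBand

end PWLSystem

namespace PWLSystem

variable {Z : PWLSystem} {z w : ℝ → Plane} {p q : Plane} {a b c t T : ℝ} {C γ : Set Plane}
  {yL yR y y₀ y₁ : ℝ}

/-! ### Orbits on an attractive sliding ray -/

lemma isForwardSlidingPeriodicOrbit_reverse_rot (h : Z.reverse.IsForwardSlidingPeriodicOrbit γ) :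
    Z.reverse.rot.IsForwardSlidingPeriodicOrbit (-γ) := by
  have := IsConj.isForwardSlidingPeriodicOrbit (Or.inr Z.reverse.rot_isSwap) h
  rwa [show (ContinuousLinearEquiv.neg ℝ : Plane ≃L[ℝ] Plane) '' γ = -γ from
    image_neg_eq_neg] at this

/-- A system that slides attractively below the tangency point `(0, yR)` of the right system, and
has no attractive sliding segment that ends at two tangency points. -/
structure AttractiveRay (Z : PWLSystem) (yR : ℝ) : Prop where
  nondeg : Z.Nondegenerate
  posR : 0 < Z.Ap 0 1
  nonposL : Z.Am 0 1 ≤ 0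
  fp_eq : ∀ y, Z.fp (onLine y) 0 = Z.Ap 0 1 * (y - yR)
  fm_yR : 0 < Z.fm (onLine yR) 0

namespace AttractiveRay

variable (B : Z.AttractiveRay yR)
include B

lemma fp_yR : Z.fp (onLine yR) 0 = 0 := by rw [B.fp_eq]; ring

lemma fp_neg (h : y < yR) : Z.fp (onLine y) 0 < 0 := by
  rw [B.fp_eq]; exact mul_neg_of_pos_of_neg B.posR (by linarith)

lemma fp_pos (h : yR < y) : 0 < Z.fp (onLine y) 0 := by
  rw [B.fp_eq]; exact mul_pos B.posR (by linarith)

lemma fm_pos (h : y ≤ yR) : 0 < Z.fm (onLine y) 0 := by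
  have h1 := B.fm_yR
  rw [fm_onLine_zero] at h1 ⊢
  nlinarith [B.nonposL]

lemma nonsingular : Z.Nonsingular := fun y h => by
  rw [B.fp_eq] at h
  have h1 := (mul_eq_zero.1 h).resolve_left B.posR.ne'
  exact (B.fm_pos (by linarith)).ne'

lemma attractive (h : y < yR) : onLine y ∈ Z.attractive :=
  ⟨⟨onLine_mem y, (mul_neg_of_neg_of_pos (B.fp_neg h) (B.fm_pos h.le)).le⟩, B.fp_neg h,
    B.fm_pos h.le⟩

lemma canSlide (h : y < yR) : Z.CanSlide (onLine y) :=
  canSlide_of_neg (mul_neg_of_neg_of_pos (B.fp_neg h) (B.fm_pos h.le))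

/-- Sliding is possible wherever the normal product is negative, so an exit is a tangency point;
above `yR` it can only be one of the left system. -/
lemma exit_cases (h : onLine y ∈ Z.sliding) (hn : ¬ Z.CanSlide (onLine y)) :
    y = yR ∨ yR < y ∧ Z.fm (onLine y) 0 = 0 := by
  rcases lt_trichotomy y yR with h1 | h1 | h1
  · exact absurd (B.canSlide h1) hn
  · exact Or.inl h1
  · refine Or.inr ⟨h1, ?_⟩
    by_contra hne
    rw [onLine_mem_sliding] at h
    exact hn (canSlide_of_neg (h.lt_of_ne (mul_ne_zero (B.fp_pos h1).ne' hne)))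

/-- Sliding from the attractive ray ends at its end point. -/
lemma slide_arc (h : Z.Cycle z T) (hz : z t = onLine y) (hy : y ≤ yR)
    (hs : Z.CanSlide (onLine y)) :
    ∃ t' > t, z t' = onLine yR ∧ ¬ Z.CanSlide (onLine yR) ∧
      Z.SlidingArc (onLine y) (onLine yR) (z '' Icc t t') := by
  obtain ⟨t', ht', y', hz', hn, hm, hsl⟩ := h.slide B.nonsingular hz hs
  rcases B.exit_cases hm hn with rfl | ⟨h1, h2⟩
  · exact ⟨t', ht', hz', hn, hsl⟩
  · exfalso
    -- A slide ending above `yR` would pass this midpoint. Both normal components are positive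
    -- there, the left one because it is affine, positive at `yR` and zero at `y'`.
    have hmem : onLine ((yR + y') / 2) ∈ Z.sliding := by
      have h3 : onLine ((yR + y') / 2) ∈ z '' Icc t t' := by
        rw [hsl.eq_segment B.nonsingular]
        refine mem_image_of_mem _ ?_
        rw [uIcc_of_le (hy.trans h1.le)]
        constructor <;> linarith
      obtain ⟨w, T', hT', -, -, hw, hC⟩ := hsl
      rw [hC] at h3
      obtain ⟨s, hs, hs'⟩ := h3
      rw [← hs']
      exact (hw s hs).1
    rw [onLine_mem_sliding] at hmem
    refine absurd hmem (not_le.2 (mul_pos (B.fp_pos (by linarith)) ?_))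
    have h4 := B.fm_yR
    rw [fm_onLine_zero] at h2 h4 ⊢
    linarith

lemma right_arc (h : Z.Cycle z T) (hz : z t = onLine yR) (hs : ¬ Z.CanSlide (onLine yR)) :
    ∃ t' > t, ∃ y' ≤ yR, z t' = onLine y' ∧
      Z.RightArc (onLine yR) (onLine y') (z '' Icc t t') := by
  rcases h.leave hz hs with ⟨t', ht', y', hz', hst, harc⟩ | ⟨t', ht', y', hz', hst, harc⟩
  · refine ⟨t', ht', y', ?_, hz', harc⟩
    by_contra hlt
    exact absurd (harc.end_nonpos (onLine_mem _)) (not_le.2 (B.fp_pos (not_le.1 hlt)))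
  · exact absurd (hst.nonpos (onLine_mem _)) (not_le.2 B.fm_yR)

/-- Once below the end point of the ray, an orbit never meets the switching line above it. -/
lemma le_of_le (h : Z.Cycle z T) (hz : z t = onLine y) (hy : y ≤ yR) :
    ∀ s ≥ t, z s ∈ switchLine → z s 1 ≤ yR := by
  let P := {s | z s ∈ switchLine ∧ z s 1 ≤ yR}
  have c0 : Continuous fun s => z s 1 := (continuous_apply 1).comp h.cont
  have hP : IsClosed P := (isClosed_switchLine.preimage h.cont).inter
    (isClosed_le c0 continuous_const)
  refine forall_mem_of_recurrence (z := z) (C := {q | q ∈ switchLine → q 1 ≤ yR}) hP ?_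
    (t₀ := t) ⟨hz ▸ onLine_mem y, by rw [hz]; exact hy⟩
  rintro s ⟨hs, hs'⟩
  obtain ⟨u, hu⟩ : ∃ u, z s = onLine u := ⟨_, eq_onLine hs⟩
  rw [hu] at hs'
  have hs' : u ≤ yR := hs'
  by_cases hc : Z.CanSlide (onLine u)
  · obtain ⟨t', ht', hz', -, hsl⟩ := B.slide_arc h hu hs' hc
    refine ⟨t', ht', ⟨by rw [hz']; exact onLine_mem _, by rw [hz']; exact le_rfl⟩,
      fun r hr hm => ?_⟩
    have h3 : z r ∈ z '' Icc s t' := ⟨r, hr, rfl⟩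
    rw [hsl.eq_segment B.nonsingular, uIcc_of_le hs'] at h3
    obtain ⟨v, hv, hv'⟩ := h3
    rw [← hv']
    exact hv.2
  · obtain rfl : u = yR := by
      by_contra hne
      exact hc (B.canSlide (hs'.lt_of_ne hne))
    obtain ⟨t', ht', y', hy', hz', harc⟩ := B.right_arc h hu hc
    refine ⟨t', ht', ⟨by rw [hz']; exact onLine_mem _, by rw [hz']; exact hy'⟩,
      fun r hr hm => ?_⟩
    rcases harc.mem_switchLine ⟨r, hr, rfl⟩ hm with h3 | h3 <;> rw [h3]
    · exact hs'
    · exact hy'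

/-- From an exit above `yR`, a right arc would land at or below `yR`, from where the line above is
never met again, against periodicity. A left start there would make sliding possible. -/
lemma exists_exit (h : Z.Cycle z T) : ∃ t, z t = onLine yR ∧ ¬ Z.CanSlide (onLine yR) := by
  obtain ⟨t, -, ht⟩ := h.exists_canSlide 0
  obtain ⟨y, hy⟩ : ∃ y, z t = onLine y := ⟨_, eq_onLine ht.mem.1⟩
  obtain ⟨t', -, y', hz, hn, hm, -⟩ := h.slide B.nonsingular hy (hy ▸ ht)
  rcases B.exit_cases hm hn with rfl | ⟨h1, h2⟩
  · exact ⟨t', hz, hn⟩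
  exfalso
  rcases h.leave hz hn with ⟨t'', ht'', y'', hz'', hst, harc⟩ | ⟨t'', ht'', y'', hz'', hst, harc⟩
  · have hle : y'' ≤ yR := by
      by_contra hlt
      exact absurd (harc.end_nonpos (onLine_mem _)) (not_le.2 (B.fp_pos (not_le.1 hlt)))
    obtain ⟨n, hnT⟩ := exists_add_nat_mul_gt h.Tpos t'' t'
    have h3 := B.le_of_le h hz'' hle (t' + n * T) hnT.le
    rw [h.per.nat_mul n t', hz] at h3
    exact absurd (h3 (onLine_mem _)) (not_le.2 h1)
  · exact hn (canSlide_of_leftStart B.nondeg B.nonsingular hst (B.fp_pos h1))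

lemma rightLoop_of_cycle (h : Z.Cycle z T) : ∃ y₀, Z.RightLoop yR y₀ (range z) := by
  obtain ⟨t, hz, hn⟩ := B.exists_exit h
  obtain ⟨t', ht', y', hy', hz', harc⟩ := B.right_arc h hz hn
  have hlt : y' < yR := by
    refine hy'.lt_of_ne fun he => ?_
    subst he
    obtain ⟨s, -, hs⟩ := h.exists_canSlide 0
    have hm : z s ∈ range z := ⟨s, rfl⟩
    rw [h.range_eq B.nondeg B.nonsingular ht' (hz.trans hz'.symm)] at hm
    rcases harc.mem_switchLine hm hs.mem.1 with h1 | h1 <;> rw [h1] at hs <;> exact hn hs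
  obtain ⟨t'', ht'', hz'', -, hsl⟩ := B.slide_arc h hz' hlt.le (B.canSlide hlt)
  refine ⟨y', hlt, visibleRight_of (onLine_mem _) B.fp_yR
    (harc.rightStart.tangent B.nondeg.1 (onLine_mem _) B.fp_yR) B.fm_yR.ne',
    fun y hy => B.attractive hy.2, _, _, harc, hsl, ?_⟩
  rw [h.range_eq B.nondeg B.nonsingular (ht'.trans ht'') (hz.trans hz''.symm),
    image_Icc_union z (le_of_lt ht') (le_of_lt ht'')]

lemma eq_of_forward {γ' : Set Plane} (h : Z.IsForwardSlidingPeriodicOrbit γ)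
    (h' : Z.IsForwardSlidingPeriodicOrbit γ') : γ = γ' := by
  obtain ⟨z, T, hz, rfl⟩ := isForwardSlidingPeriodicOrbit_iff.1 h
  obtain ⟨w, T', hw, rfl⟩ := isForwardSlidingPeriodicOrbit_iff.1 h'
  obtain ⟨t, ht, -⟩ := B.exists_exit hz
  obtain ⟨s, hs, -⟩ := B.exists_exit hw
  exact hz.range_eq_of_meet B.nondeg B.nonsingular hw ⟨onLine yR, ⟨t, ht⟩, ⟨s, hs⟩⟩

lemma exists_rightLoop (h : Z.IsForwardSlidingPeriodicOrbit γ) :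
    ∃ y₀, Z.RightLoop yR y₀ γ := by
  obtain ⟨z, T, hz, rfl⟩ := isForwardSlidingPeriodicOrbit_iff.1 h
  exact B.rightLoop_of_cycle hz

lemma configOne (h : Z.IsForwardSlidingPeriodicOrbit γ) : Z.ConfigOne γ := by
  obtain ⟨y₀, h⟩ := B.exists_rightLoop h
  exact Or.inl ⟨yR, y₀, Or.inl (B.attractive h.1), h⟩

/-- The tangency point of the left system is a mirror image of the one of the right system. -/
lemma reverse_rot (hneg : Z.Am 0 1 < 0) :
    ∃ yL > yR, (∀ y, Z.fm (onLine y) 0 = Z.Am 0 1 * (y - yL)) ∧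
      Z.reverse.rot.AttractiveRay (-yL) := by
  have hfm : ∀ y, Z.fm (onLine y) 0 = Z.Am 0 1 * (y - -(Z.bm 0 / Z.Am 0 1)) := fun y => by
    rw [fm_onLine_zero, sub_neg_eq_add, mul_add, mul_div_cancel₀ _ hneg.ne]
  have hlt : yR < -(Z.bm 0 / Z.Am 0 1) := by
    have := B.fm_yR
    rw [hfm] at this
    nlinarith
  refine ⟨_, hlt, hfm, B.nondeg.reverse.rot, neg_pos.2 hneg, neg_nonpos.2 B.posR.le, fun y => ?_, ?_⟩
  · rw [rot_fp_onLine, Pi.neg_apply, reverse_fm, Pi.neg_apply, hfm]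
    change _ = -Z.Am 0 1 * _
    ring
  · rw [rot_fm_onLine, Pi.neg_apply, reverse_fp, Pi.neg_apply, neg_neg, neg_neg]
    exact B.fp_pos hlt

/-- Without a tangency point of the left system there are no backward orbits. -/
lemma not_backward (h0 : Z.Am 0 1 = 0) : ¬ Z.reverse.IsForwardSlidingPeriodicOrbit γ := by
  intro hγ
  obtain ⟨z, T, h, -⟩ := isForwardSlidingPeriodicOrbit_iff.1 hγ
  have hfm : ∀ y, Z.reverse.fm (onLine y) 0 < 0 := fun y => by
    have := B.fm_yR
    rw [fm_onLine_zero, h0] at this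
    rw [reverse_fm, Pi.neg_apply, fm_onLine_zero, h0]
    linarith
  have hns := B.nonsingular.reverse
  obtain ⟨t, -, ht⟩ := h.exists_canSlide 0
  obtain ⟨y, hy⟩ : ∃ y, z t = onLine y := ⟨_, eq_onLine ht.mem.1⟩
  obtain ⟨t', -, y', hz, hn, -, -⟩ := h.slide hns hy (hy ▸ ht)
  -- The reversed left field points to the left along the whole line: a right start then allows
  -- sliding, and a left arc can never come back.
  rcases h.leave hz hn with ⟨_, -, _, -, hst, -⟩ | ⟨_, -, _, -, -, harc⟩
  · exact hn (canSlide_of_rightStart B.nondeg.reverse hns hst (hfm y'))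
  · exact absurd (harc.end_nonneg (onLine_mem _)) (not_le.2 (hfm _))

/-- Two orbits of opposite directions. -/
lemma configTwoA {φ : Set Plane} (h : Z.RightLoop yR y₀ γ) (hlt : yR < yL)
    (hneg : Z.Am 0 1 < 0) (hfm : ∀ y, Z.fm (onLine y) 0 = Z.Am 0 1 * (y - yL)) {u : ℝ}
    (h' : Z.reverse.rot.RightLoop (-yL) u (-φ)) : Z.ConfigTwo γ φ := by
  obtain ⟨hu, hV, -, D₁, D₂, d1, d2, hD⟩ := h'
  have e1 := d1.rot
  have e2 := d2.rot
  rw [rot_rot] at e1 e2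
  replace e1 := e1.reverse
  replace e2 := e2.reverse
  simp only [reverse_reverse, neg_onLine, neg_neg] at e1 e2
  have hL : Z.fm (onLine yL) 0 = 0 := by rw [hfm]; ring
  have hV : Z.VisibleLeft (onLine yL) := visibleLeft_of (onLine_mem _) hL
    -- Visibility at `yL` is read off from the tangential arrival of the left arc.
    (e1.end_tangent B.nondeg.2 (onLine_mem _) hL) (B.fp_pos hlt).ne'
  refine Or.inl ⟨yR, y₀, yL, -u, hlt, by linarith, B.attractive h.1, h, fun y hy =>
    ⟨onLine_mem _, mul_pos (B.fp_pos hy.1) ?_⟩, hV, fun y hy => ?_, _, _, e2, e1, ?_⟩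
  · rw [hfm]; exact mul_pos_of_neg_of_neg hneg (by linarith [hy.2])
  · have h1 := B.fp_pos (hlt.trans hy.1)
    have h2 : Z.fm (onLine y) 0 < 0 := by
      rw [hfm]; exact mul_neg_of_neg_of_pos hneg (by linarith [hy.1])
    exact ⟨⟨onLine_mem _, (mul_neg_of_pos_of_neg h1 h2).le⟩, h1, h2⟩
  · rw [union_comm, ← union_neg, ← hD, neg_neg]

lemma models_reverse_rot : Models Z Z.reverse.rot
    (ContinuousLinearEquiv.neg ℝ : Plane ≃L[ℝ] Plane).toHomeomorph :=
  (models_reverse B.nondeg).trans (models_rot B.nondeg.reverse)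

lemma am_neg (h : Z.reverse.IsForwardSlidingPeriodicOrbit γ) : Z.Am 0 1 < 0 :=
  B.nonposL.lt_of_ne fun h0 => B.not_backward h0 h

lemma eq_of_backward {γ' : Set Plane} (h : Z.reverse.IsForwardSlidingPeriodicOrbit γ)
    (h' : Z.reverse.IsForwardSlidingPeriodicOrbit γ') : γ = γ' := by
  obtain ⟨yL, -, -, B'⟩ := B.reverse_rot (B.am_neg h)
  exact neg_injective (B'.eq_of_forward (isForwardSlidingPeriodicOrbit_reverse_rot h) (isForwardSlidingPeriodicOrbit_reverse_rot h'))

lemma exists_configTwo {φ : Set Plane} (h : Z.IsForwardSlidingPeriodicOrbit γ)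
    (h' : Z.reverse.IsForwardSlidingPeriodicOrbit φ) : Z.ConfigTwo γ φ := by
  obtain ⟨yL, hlt, hfm, B'⟩ := B.reverse_rot (B.am_neg h')
  obtain ⟨y₀, hl⟩ := B.exists_rightLoop h
  obtain ⟨u, hl'⟩ := B'.exists_rightLoop (isForwardSlidingPeriodicOrbit_reverse_rot h')
  exact B.configTwoA hl hlt (B.am_neg h') hfm hl'

theorem hasConfigurations : Z.HasConfigurations := by
  refine ⟨?_, fun γ hγ => ?_, fun γ₁ γ₂ hne hγ => ?_⟩
  · change ({γ | Z.IsForwardSlidingPeriodicOrbit γ} ∪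
      {γ | Z.reverse.IsForwardSlidingPeriodicOrbit γ} : Set (Set Plane)).encard ≤ 2
    refine (encard_union_le _ _).trans ?_
    rw [← one_add_one_eq_two]
    exact add_le_add (encard_le_one_iff.2 fun _ _ => B.eq_of_forward)
      (encard_le_one_iff.2 fun _ _ => B.eq_of_backward)
  · have hm : γ ∈ Z.slidingPeriodicOrbits := by simp [hγ]
    rcases hm with h | h
    · refine ⟨Z, _, models_refl B.nondeg, ?_⟩
      rw [image_refl]
      exact B.configOne h
    · obtain ⟨yL, -, -, B'⟩ := B.reverse_rot (B.am_neg h)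
      refine ⟨_, _, B.models_reverse_rot, ?_⟩
      rw [image_neg_toHomeomorph]
      exact B'.configOne (isForwardSlidingPeriodicOrbit_reverse_rot h)
  · have h₁ : γ₁ ∈ Z.slidingPeriodicOrbits := by simp [hγ]
    have h₂ : γ₂ ∈ Z.slidingPeriodicOrbits := by simp [hγ]
    refine ⟨Z, _, models_refl B.nondeg, ?_⟩
    rw [image_refl, image_refl]
    rcases h₁ with h₁ | h₁ <;> rcases h₂ with h₂ | h₂
    · exact absurd (B.eq_of_forward h₁ h₂) hne
    · exact Or.inl (B.exists_configTwo h₁ h₂)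
    · exact Or.inr (B.exists_configTwo h₂ h₁)
    · exact absurd (B.eq_of_backward h₁ h₂) hne

end AttractiveRay

/-! ### Reduction to the normal forms -/

lemma hasConfigurations_of_canSlide (h : ∀ p ∈ Z.sliding, Z.CanSlide p)
    (h' : ∀ p ∈ Z.reverse.sliding, Z.reverse.CanSlide p) : Z.HasConfigurations := by
  refine hasConfigurations_of_empty (eq_empty_of_forall_notMem fun γ hγ => ?_)
  rcases hγ with hγ | hγ <;> obtain ⟨z, T, hz, -⟩ := isForwardSlidingPeriodicOrbit_iff.1 hγ
  · exact no_cycle_of_canSlide h hz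
  · exact no_cycle_of_canSlide h' hz

lemma Nonsingular.rot (h : Z.Nonsingular) : Z.rot.Nonsingular := fun y h1 h2 =>
  h (-y) (by simpa [rot_fm_onLine] using h2) (by simpa [rot_fp_onLine] using h1)

lemma flipY_fp_onLine : Z.flipY.fp (onLine y) 0 = Z.fp (onLine (-y)) 0 := by
  simp [fp_onLine_zero, flipY]

lemma flipY_fm_onLine : Z.flipY.fm (onLine y) 0 = Z.fm (onLine (-y)) 0 := by
  simp [fm_onLine_zero, flipY]

lemma Nonsingular.flipY (h : Z.Nonsingular) : Z.flipY.Nonsingular := fun y h1 h2 =>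
  h (-y) (flipY_fp_onLine ▸ h1) (flipY_fm_onLine ▸ h2)

lemma models_flipY (hN : Z.Nondegenerate) : Models Z Z.flipY reflectY.toHomeomorph :=
  IsConj.models (Or.inl Z.flipY_isKeep) hN.flipY

lemma flipY_Ap : Z.flipY.Ap 0 1 = -Z.Ap 0 1 := by simp [flipY]

/-- The systems whose right tangency point bounds an attractive sliding region from above. -/
lemma hasConfigurations_of_attractive (hN : Z.Nondegenerate) (hpos : 0 < Z.Ap 0 1)
    (h0 : Z.fp (onLine yR) 0 = 0) (hfm : 0 < Z.fm (onLine yR) 0) : Z.HasConfigurations := by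
  have hfp : ∀ y, Z.fp (onLine y) 0 = Z.Ap 0 1 * (y - yR) := fun y => by
    rw [fp_onLine_zero] at h0 ⊢; linear_combination h0
  rcases lt_or_ge 0 (Z.Am 0 1) with hL | hL
  · have hfm' : ∀ y, Z.fm (onLine y) 0 = Z.Am 0 1 * (y - -(Z.bm 0 / Z.Am 0 1)) := fun y => by
      rw [fm_onLine_zero, sub_neg_eq_add, mul_add, mul_div_cancel₀ _ hL.ne']
    refine AttractiveBand.hasConfigurations ⟨hN, ?_, hpos, hL, hfp, hfm'⟩
    rw [hfm'] at hfm
    linarith [(mul_pos_iff_of_pos_left hL).1 hfm]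
  · exact AttractiveRay.hasConfigurations ⟨hN, hpos, hL, hfp, hfm⟩

/-- If the left field points to the left at the tangency point, time reversal corrects this but
spoils the sign of the slope, which the reflection in the x-axis restores. -/
lemma hasConfigurations_of_pos (hN : Z.Nondegenerate) (hZ : Z.Nonsingular) (hpos : 0 < Z.Ap 0 1) :
    Z.HasConfigurations := by
  obtain ⟨yR, h0⟩ : ∃ yR, Z.fp (onLine yR) 0 = 0 := ⟨-(Z.bp 0 / Z.Ap 0 1), by
    rw [fp_onLine_zero, mul_neg, mul_div_cancel₀ _ hpos.ne', neg_add_cancel]⟩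
  rcases lt_or_gt_of_ne (hZ yR h0) with h | h
  · refine HasConfigurations.of_models ((models_reverse hN).trans (models_flipY hN.reverse))
      (hasConfigurations_of_attractive (yR := -yR) hN.reverse.flipY ?_ ?_ ?_)
    · rw [flipY_Ap]; simpa [PWLSystem.reverse] using hpos
    · rw [flipY_fp_onLine, neg_neg, reverse_fp, Pi.neg_apply, h0, neg_zero]
    · rw [flipY_fm_onLine, neg_neg, reverse_fm, Pi.neg_apply]; linarith
  · exact hasConfigurations_of_attractive hN hpos h0 h

lemma hasConfigurations_of_ne (hN : Z.Nondegenerate) (hZ : Z.Nonsingular) (hne : Z.Ap 0 1 ≠ 0) :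
    Z.HasConfigurations := by
  rcases lt_or_gt_of_ne hne with h | h
  · exact (hasConfigurations_of_pos hN.flipY hZ.flipY (by rw [flipY_Ap]; linarith)).of_models
      (models_flipY hN)
  · exact hasConfigurations_of_pos hN hZ h

theorem hasConfigurations (hN : Z.Nondegenerate) : Z.HasConfigurations := by
  by_cases hZ : Z.Nonsingular
  · by_cases hp : Z.Ap 0 1 = 0
    · by_cases hm : Z.Am 0 1 = 0
      · exact hasConfigurations_of_canSlide (fun p => canSlide_of_parallel hZ hp hm)
          fun p => canSlide_of_parallel hZ.reverse (by simp [PWLSystem.reverse, hp])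
            (by simp [PWLSystem.reverse, hm])
      · exact (hasConfigurations_of_ne hN.rot hZ.rot hm).of_models (models_rot hN)
    · exact hasConfigurations_of_ne hN hZ hp
  · exact hasConfigurations_of_canSlide (fun p => canSlide_of_singular hZ)
      fun p => canSlide_of_singular fun h => hZ (by simpa using h.reverse)

end PWLSystem

theorem theorem1 (Z : PWLSystem) (hZ : Z.Nondegenerate) :
    Z.slidingPeriodicOrbits.encard ≤ 2 ∧
    (∀ γ : Set Plane, Z.slidingPeriodicOrbits = {γ} →
      ∃ (Z' : PWLSystem) (h : Plane ≃ₜ Plane), Z'.Nondegenerate ∧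
        (PWLSystem.IsSigmaEquivalence Z Z' h ∨ PWLSystem.IsSigmaEquivalence Z.reverse Z' h) ∧
        Z'.slidingPeriodicOrbits = {h '' γ} ∧ Z'.ConfigOne (h '' γ)) ∧
    (∀ γ₁ γ₂ : Set Plane, γ₁ ≠ γ₂ → Z.slidingPeriodicOrbits = {γ₁, γ₂} →
      ∃ (Z' : PWLSystem) (h : Plane ≃ₜ Plane), Z'.Nondegenerate ∧
        (PWLSystem.IsSigmaEquivalence Z Z' h ∨ PWLSystem.IsSigmaEquivalence Z.reverse Z' h) ∧
        Z'.slidingPeriodicOrbits = {h '' γ₁, h '' γ₂} ∧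
        (Z'.ConfigTwo (h '' γ₁) (h '' γ₂) ∨ Z'.ConfigTwo (h '' γ₂) (h '' γ₁))) := by
  obtain ⟨h0, h1, h2⟩ := PWLSystem.hasConfigurations hZ
  refine ⟨h0, fun γ hγ => ?_, fun γ₁ γ₂ hne hγ => ?_⟩
  · obtain ⟨Z', h, m, hc⟩ := h1 γ hγ
    exact ⟨Z', h, m.nondeg, m.equiv, by rw [m.orbits, hγ, image_singleton], hc⟩
  · obtain ⟨Z', h, m, hc⟩ := h2 γ₁ γ₂ hne hγ
    exact ⟨Z', h, m.nondeg, m.equiv, by rw [m.orbits, hγ, image_pair], hc⟩
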